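/- Setting. Consider reinforcement learning with horizon $H$, state space $\mathcal S\subseteq\mathbb R^m$ (states at step $h$ lie in a set $\mathcal S_h$), action space $\mathcal A$, initial distribution $\mu_1$ on $\mathcal S_1$, reward $r:\mathcal S\times\mathcal A\to[0,1]$, deterministic dynamics $T_\theta:\mathcal S\times\mathcal A\to\mathcal S$ ($\theta\in\Theta$) that map $\mathcal S_h\times\mathcal A$ into $\mathcal S_{h+1}$, and stochastic policies $\pi_\psi(\cdot\mid s)$ ($\psi\in\mathbb R^d$) with positive densities, twice continuously differentiable in $\psi$, with respect to a fixed $\sigma$-finite measure on $\mathcal A$. Let $\rho^\psi_\theta$ be the law of the trajectory $\tau=(s_1,a_1,\dots,s_H,a_H)$ of $\pi_\psi$ under $T_\theta$, let $V^\psi_\theta(s_h)$ be the expected reward collected in steps $h,\dots,H$ starting from $s_h$, and let $\eta(\theta,\psi)=\mathbb E_{s_1\sim\mu_1}V^\psi_\theta(s_1)$. Let $\theta^\star\in\Theta$ be the true parameter, and suppose that the return is normalized: $\eta(\theta^\star,\psi)\in[0,1]$ for all $\psi$. Assumptions. With $\zeta_h>0$, for all $\theta\in\Theta$ and $\psi,\psi'\in\mathbb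 R^d$: (1) $\eta(\theta,\cdot)$ is twice continuously differentiable, $\|\nabla_\psi\eta(\theta,\psi)\|_2\le\zeta_g$, $\|\nabla_\psi^2\eta(\theta,\psi)\|_{\rm sp}\le\zeta_h$, and $\|\nabla^2_\psi\eta(\theta,\psi)-\nabla^2_\psi\eta(\theta,\psi')\|_{\rm sp}\le\zeta_{3rd}\|\psi-\psi'\|_2$. (2) $V^\psi_\theta(s)$ is twice continuously differentiable in $\psi$, and for any states $s,s'$ of the same step, $|V^\psi_\theta(s)-V^\psi_\theta(s')|\le L_0\|s-s'\|_2$, $\|\nabla_\psi V^\psi_\theta(s)-\nabla_\psi V^\psi_\theta(s')\|_2\le L_1\|s-s'\|_2$, and $\|\nabla^2_\psi V^\psi_\theta(s)-\nabla^2_\psi V^\psi_\theta(s')\|_{\rm sp}\le L_2\|s-s'\|_2$. (3) For every state $s$, with $g=\nabla_\psi\log\pi_\psi(a\mid s)$, $K=\nabla^2_\psi\log\pi_\psi(a\mid s)$ and $a\sim\pi_\psi(\cdot\mid s)$: $\|\mathbb E[gg^\top]\|_{\rm sp}\le\chi_g$, $\|\mathbb E[g^{\otimes4}]\|_{\rm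 sp}\le\chi_f$, $\|\mathbb E[KK^\top]\|_{\rm sp}\le\chi_h$, where $\|B\|_{\rm sp}=\sup_{\|u\|_2=1}\langle B,u^{\otimes k}\rangle$ for these symmetric $k$-tensors. Loss, complexity and learner. For a pair of trajectories let $$\ell((\tau,\tau');\theta)=\sum_{(s,a)\in\tau}\|T_\theta(s,a)-T_{\theta^\star}(s,a)\|_2^2+\sum_{(s,a)\in\tau'}\|T_\theta(s,a)-T_{\theta^\star}(s,a)\|_2^2 .$$ Let $\mathcal Z$ be the set of pairs of trajectories whose $h$-th states lie in $\mathcal S_h$, and let $$\mathfrak R^{dyn}_T=\sup_{\mathbf z}\,\mathbb E_{\sigma}\Big[\sup_{\theta\in\Theta}\sum_{t=1}^T\sigma_t\,\ell(\mathbf z_t(\sigma_1,\dots,\sigma_{t-1});\theta)\Big],$$ where $\sigma_1,\dots,\sigma_T$ are independent uniform signs and $\mathbf z=(\mathbf z_t:\{\pm1\}^{t-1}\to\mathcal Z)_{t\le T}$ ranges over all $\mathcal Z$-valued trees. Suppose $\mathfrak R^{dyn}_T<\infty$. An online learner $\mathcal R$ maps each finite sequence of data to a probability distribution on $\Theta$;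 we fix one whose expected regret satisfies $$\sum_{t=1}^T\mathbb E_{\theta\sim\mathcal R(z_1,\dots,z_{t-1})}\ell(z_t;\theta)-\inf_{\theta\in\Theta}\sum_{t=1}^T\ell(z_t;\theta)\le2\mathfrak R^{dyn}_T\qquad\text{for all }z_1,\dots,z_T\in\mathcal Z .$$ Algorithm (ViOlin for RL). Choose $\psi_0$ arbitrarily. In round $t=1,2,\dots$, let $p_t=\mathcal R(z_1,\dots,z_{t-1})$, let $\psi_t\in\arg\max_\psi\mathbb E_{\theta\sim p_t}[\eta(\theta,\psi)]$ (assumed to exist and selected measurably from the data), sample independent trajectories $\tau_t\sim\rho^{\psi_t}_{\theta^\star}$ and $\tau'_t\sim\rho^{\psi_{t-1}}_{\theta^\star}$, and put $z_t=(\tau_t,\tau_t')$. Local regret. Let $\mathfrak A_{\epsilon_g,\epsilon_h}$ be the set of $\psi$ with $\|\nabla_\psi\eta(\theta^\star,\psi)\|_2\le\epsilon_g$ and $\lambda_{\max}(\nabla^2_\psi\eta(\theta^\star,\psi))\le\epsilon_h$, and let $\textsc{reg}_{\epsilon_g,\epsilon_h}(T)=\sum_{t=1}^T\big(\inf_{\psi\in\mathfrak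 A_{\epsilon_g,\epsilon_h}}\eta(\theta^\star,\psi)-\eta(\theta^\star,\psi_t)\big)$. Theorem. Let $C_1=2+\zeta_g/\zeta_h$ and $$c_1=HL_0^2(4H^2\chi_h+4H^4\chi_f+2H^2\chi_g+1)+HL_1^2(8H^2\chi_g+2)+4HL_2^2 .$$ For every $0<\epsilon\le\min(1,\zeta_{3rd}/16)$ the set $\mathfrak A_{\epsilon,6\sqrt{\zeta_{3rd}\epsilon}}$ is non-empty, the local regret is integrable, and $$\mathbb E\big[\textsc{reg}_{\epsilon,6\sqrt{\zeta_{3rd}\epsilon}}(T)\big]\le\Big(1+C_1\sqrt{2c_1T\,\mathfrak R^{dyn}_T}\Big)\max\big(2\zeta_h\epsilon^{-2},\ \sqrt{\zeta_{3rd}}\,\epsilon^{-3/2}\big).$$ -/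

import Mathlib

open MeasureTheory ProbabilityTheory
open scoped RealInnerProductSpace

noncomputable section

namespace ViOlinRL

/-! ### Local maxima and smoothness of functions of the policy parameter -/

/-- The Hessian of `f` at `x`, as a linear operator (the derivative of the gradient);
its operator norm is the spectral norm. -/
def hess {d : ℕ} (f : EuclideanSpace ℝ (Fin d) → ℝ) (x : EuclideanSpace ℝ (Fin d)) :
    EuclideanSpace ℝ (Fin d) →L[ℝ] EuclideanSpace ℝ (Fin d) :=
  fderiv ℝ (gradient f) x

/-- The set of `(εg, εh)`-approximate local maxima of `f`: the gradient has norm at most `εg` and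
every eigenvalue of the Hessian is at most `εh`. -/
def approxLocalMaxima {d : ℕ} (f : EuclideanSpace ℝ (Fin d) → ℝ) (εg εh : ℝ) :
    Set (EuclideanSpace ℝ (Fin d)) :=
  {x | ‖gradient f x‖ ≤ εg ∧
    ∀ μ : ℝ, Module.End.HasEigenvalue
      (hess f x : EuclideanSpace ℝ (Fin d) →ₗ[ℝ] EuclideanSpace ℝ (Fin d)) μ → μ ≤ εh}

/-- `f` is twice continuously differentiable, with gradient bounded by `ζg`, Hessian bounded by
`ζh` in spectral norm, and `ζ3`-Lipschitz Hessian. -/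
structure SmoothBounds {d : ℕ} (f : EuclideanSpace ℝ (Fin d) → ℝ) (ζg ζh ζ3 : ℝ) : Prop where
  contDiff : ContDiff ℝ 2 f
  grad_le : ∀ x, ‖gradient f x‖ ≤ ζg
  hess_le : ∀ x, ‖hess f x‖ ≤ ζh
  hess_lip : ∀ x y, ‖hess f x - hess f y‖ ≤ ζ3 * ‖x - y‖

/-! ### Sequential Rademacher complexity and online learning -/

/-- The sequential Rademacher complexity over `T` rounds of the loss class
`{z ↦ ℓ z θ : θ}` on the set `𝒵` of data points.  A `𝒵`-valued tree is a family of maps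
`z t : {±1}^t → 𝒵` (`t = 0, …, T - 1`), and the complexity is the supremum over all trees of
`E_ε [sup_θ ∑ t, ε t * ℓ (z t (ε 0, …, ε (t - 1))) θ]`, for independent uniform signs `ε`.
It may be infinite. -/
def seqRademacher {Z Θ : Type*} (T : ℕ) (𝒵 : Set Z) (ℓ : Z → Θ → ℝ) : EReal :=
  ⨆ z : (t : Fin T) → (Fin t → ℤˣ) → 𝒵,
    ((((2 : ℝ) ^ T)⁻¹ : ℝ) : EReal) * ∑ ε : Fin T → ℤˣ, ⨆ θ : Θ,
      ((∑ t : Fin T, ((ε t : ℤ) : ℝ) *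
        ℓ (z t (fun i => ε (Fin.castLE t.isLt.le i)) : Z) θ : ℝ) : EReal)

/-- The first `t` entries of a sequence of length `T`. -/
def histUpTo {Z : Type*} {T : ℕ} (z : Fin T → Z) (t : Fin T) : Fin t → Z :=
  fun i => z (Fin.castLE t.isLt.le i)

/-- The expected regret of an online learner on the data sequence `z`.  In round `t` the learner
maps the previous data to a distribution on `Θ`, from which its parameter is drawn. -/
def onlineRegret {Z Θ : Type*} [MeasurableSpace Z] [MeasurableSpace Θ]
    (R : (t : ℕ) → Kernel (Fin t → Z) Θ) (ℓ : Z → Θ → ℝ) {T : ℕ} (z : Fin T → Z) : ℝ :=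
  (∑ t : Fin T, ∫ θ, ℓ (z t) θ ∂(R t (histUpTo z t))) - ⨅ θ, ∑ t : Fin T, ℓ (z t) θ

/-- The online learner `R` has expected regret at most twice the sequential Rademacher
complexity of the loss class, against every adversary choosing
data in `𝒵`.  (The distribution played in a round is a function of the earlier data, so an adversary
that reacts to the learner's distributions is no more than an arbitrary sequence of data.) -/
def HasRademacherRegret {Z Θ : Type*} [MeasurableSpace Z] [MeasurableSpace Θ]
    (R : (t : ℕ) → Kernel (Fin t → Z) Θ) (T : ℕ) (𝒵 : Set Z) (ℓ : Z → Θ → ℝ) : Prop :=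
  ∀ z : Fin T → Z, (∀ t, z t ∈ 𝒵) →
    ((onlineRegret R ℓ z : ℝ) : EReal) ≤ 2 * seqRademacher T 𝒵 ℓ

/-! ### Reinforcement learning with deterministic dynamics and stochastic policies -/

/-- A finite horizon reinforcement learning problem with states `S ⊆ ℝ^m`, actions `A`, a class of
deterministic dynamics indexed by `Θ` and a class of stochastic policies indexed by `ℝ^d`.
`stage h` is the set of possible states at step `h = 0, …, H - 1`; these sets may, but need not, be
disjoint. -/
structure Problem {m : ℕ} (S : Set (EuclideanSpace ℝ (Fin m))) (A : Type*) [MeasurableSpace A]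
    (d : ℕ) (Θ : Type*) [MeasurableSpace Θ] where
  /-- the horizon -/
  H : ℕ
  /-- the states that can occur at a given step -/
  stage : ℕ → Set S
  measurableSet_stage : ∀ h, MeasurableSet (stage h)
  /-- the law of the initial state -/
  μ₁ : Measure S
  isProbabilityMeasure_μ₁ : IsProbabilityMeasure μ₁
  ae_mem_stage : ∀ᵐ s ∂μ₁, s ∈ stage 0
  /-- the dynamics -/
  dyn : Θ → S → A → S
  measurable_dyn : Measurable fun x : Θ × S × A => dyn x.1 x.2.1 x.2.2
  dyn_mem_stage : ∀ θ h, h + 1 < H → ∀ s ∈ stage h, ∀ a, dyn θ s a ∈ stage (h + 1)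
  /-- the reward -/
  r : S → A → ℝ
  measurable_r : Measurable fun x : S × A => r x.1 x.2
  r_mem : ∀ s a, r s a ∈ Set.Icc (0 : ℝ) 1
  /-- the reference measure for the densities of the policies -/
  ν : Measure A
  sigmaFinite_ν : SigmaFinite ν
  /-- the density `dens ψ s a` of the policy with parameter `ψ` at action `a` in state `s` -/
  dens : EuclideanSpace ℝ (Fin d) → S → A → ℝ
  measurable_dens :
    Measurable fun x : EuclideanSpace ℝ (Fin d) × S × A => dens x.1 x.2.1 x.2.2
  dens_pos : ∀ ψ s a, 0 < dens ψ s a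
  lintegral_dens : ∀ ψ s, ∫⁻ a, ENNReal.ofReal (dens ψ s a) ∂ν = 1

namespace Problem

variable {m : ℕ} {S : Set (EuclideanSpace ℝ (Fin m))} {A : Type*} [MeasurableSpace A]
  {d : ℕ} {Θ : Type*} [MeasurableSpace Θ] (M : Problem S A d Θ)

/-- The distribution of the action chosen by the policy with parameter `ψ` in state `s`. -/
def policy (ψ : EuclideanSpace ℝ (Fin d)) (s : S) : Measure A :=
  M.ν.withDensity fun a => ENNReal.ofReal (M.dens ψ s a)

/-- The law of the next `k` state-action pairs, starting in state `s`, under the policy `ψ` and the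
dynamics `θ`. -/
def trajFrom (θ : Θ) (ψ : EuclideanSpace ℝ (Fin d)) : (k : ℕ) → S → Measure (Fin k → S × A)
  | 0, _ => Measure.dirac Fin.elim0
  | k + 1, s => (M.policy ψ s).bind fun a =>
      (trajFrom θ ψ k (M.dyn θ s a)).map fun τ => (Fin.cons (s, a) τ : Fin (k + 1) → S × A)

/-- A trajectory: the state-action pairs of the `H` steps of an episode. -/
abbrev Traj : Type _ := Fin M.H → S × A

/-- The law of the trajectory of an episode. -/
def trajLaw (θ : Θ) (ψ : EuclideanSpace ℝ (Fin d)) : Measure M.Traj :=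
  M.μ₁.bind fun s => M.trajFrom θ ψ M.H s

/-- The value at state `s` at step `h`: the expected total reward of the steps `h, …, H - 1`. -/
def value (θ : Θ) (ψ : EuclideanSpace ℝ (Fin d)) (h : ℕ) (s : S) : ℝ :=
  ∫ τ, ∑ i, M.r (τ i).1 (τ i).2 ∂(M.trajFrom θ ψ (M.H - h) s)

/-- The expected return `η(θ, ψ)` of the policy `ψ` under the dynamics `θ`. -/
def ret (θ : Θ) (ψ : EuclideanSpace ℝ (Fin d)) : ℝ :=
  ∫ s, M.value θ ψ 0 s ∂M.μ₁

/-- Lipschitz continuity in the state of the value function, of its gradient and of its Hessian with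
respect to the policy parameter. -/
structure ValueLipschitz (L₀ L₁ L₂ : ℝ) : Prop where
  contDiff : ∀ θ, ∀ h < M.H, ∀ s ∈ M.stage h, ContDiff ℝ 2 fun ψ => M.value θ ψ h s
  value_lip : ∀ θ ψ, ∀ h < M.H, ∀ s ∈ M.stage h, ∀ s' ∈ M.stage h,
    |M.value θ ψ h s - M.value θ ψ h s'| ≤ L₀ * ‖(s : EuclideanSpace ℝ (Fin m)) - s'‖
  grad_lip : ∀ θ ψ, ∀ h < M.H, ∀ s ∈ M.stage h, ∀ s' ∈ M.stage h,
    ‖gradient (fun ψ' => M.value θ ψ' h s) ψ - gradient (fun ψ' => M.value θ ψ' h s') ψ‖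
      ≤ L₁ * ‖(s : EuclideanSpace ℝ (Fin m)) - s'‖
  hess_lip : ∀ θ ψ, ∀ h < M.H, ∀ s ∈ M.stage h, ∀ s' ∈ M.stage h,
    ‖hess (fun ψ' => M.value θ ψ' h s) ψ - hess (fun ψ' => M.value θ ψ' h s') ψ‖
      ≤ L₂ * ‖(s : EuclideanSpace ℝ (Fin m)) - s'‖

/-- The score `∇_ψ log π_ψ(a | s)`. -/
def score (ψ : EuclideanSpace ℝ (Fin d)) (s : S) (a : A) : EuclideanSpace ℝ (Fin d) :=
  gradient (fun ψ' => Real.log (M.dens ψ' s a)) ψ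

/-- The Hessian `∇²_ψ log π_ψ(a | s)`. -/
def scoreHess (ψ : EuclideanSpace ℝ (Fin d)) (s : S) (a : A) :
    EuclideanSpace ℝ (Fin d) →L[ℝ] EuclideanSpace ℝ (Fin d) :=
  hess (fun ψ' => Real.log (M.dens ψ' s a)) ψ

/-- Regularity of the policies.  The injective norm of a symmetric tensor `B` of order `k` is the
supremum over unit vectors `u` of `⟨B, u ⊗ ⋯ ⊗ u⟩`; for the tensors `E[g gᵀ]`, `E[g ⊗ g ⊗ g ⊗ g]`
and `E[K Kᵀ]` (`g` the score, `K` the symmetric Hessian of the log-density) this pairing is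
`E⟨g, u⟩²`, `E⟨g, u⟩⁴` and `E‖K u‖²`. -/
structure PolicyRegular (χg χf χh : ℝ) : Prop where
  contDiff : ∀ s a, ContDiff ℝ 2 fun ψ => Real.log (M.dens ψ s a)
  second_moment : ∀ ψ s u, ‖u‖ = 1 →
    Integrable (fun a => ⟪M.score ψ s a, u⟫ ^ 2) (M.policy ψ s) ∧
      ∫ a, ⟪M.score ψ s a, u⟫ ^ 2 ∂(M.policy ψ s) ≤ χg
  fourth_moment : ∀ ψ s u, ‖u‖ = 1 →
    Integrable (fun a => ⟪M.score ψ s a, u⟫ ^ 4) (M.policy ψ s) ∧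
      ∫ a, ⟪M.score ψ s a, u⟫ ^ 4 ∂(M.policy ψ s) ≤ χf
  hess_moment : ∀ ψ s u, ‖u‖ = 1 →
    Integrable (fun a => ‖M.scoreHess ψ s a u‖ ^ 2) (M.policy ψ s) ∧
      ∫ a, ‖M.scoreHess ψ s a u‖ ^ 2 ∂(M.policy ψ s) ≤ χh

/-- A data point of the online learner: a pair of trajectories. -/
abbrev Datum : Type _ := M.Traj × M.Traj

/-- The pairs of trajectories whose states belong to the appropriate stages. -/
def admissible : Set M.Datum :=
  {z | ∀ i : Fin M.H, (z.1 i).1 ∈ M.stage i ∧ (z.2 i).1 ∈ M.stage i}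

/-- The squared dynamics-prediction loss of the parameter `θ` on a pair of trajectories, when the
ground truth is `θs`. -/
def loss (θs : Θ) (z : M.Datum) (θ : Θ) : ℝ :=
  (∑ i, ‖(M.dyn θ (z.1 i).1 (z.1 i).2 : EuclideanSpace ℝ (Fin m)) -
      M.dyn θs (z.1 i).1 (z.1 i).2‖ ^ 2) +
  ∑ i, ‖(M.dyn θ (z.2 i).1 (z.2 i).2 : EuclideanSpace ℝ (Fin m)) -
      M.dyn θs (z.2 i).1 (z.2 i).2‖ ^ 2

/-- The sequential Rademacher complexity of the dynamics-prediction loss. -/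
def dynRademacher (θs : Θ) (T : ℕ) : EReal :=
  seqRademacher T M.admissible (M.loss θs)

end Problem

/-- An instance of the algorithm ViOlin for reinforcement learning.  From the data of the first `t`
rounds, `learner t` computes a distribution on the dynamics parameters, and `plan t` is the
parameter of a policy that maximizes the expected virtual return under this distribution. -/
structure Alg {m : ℕ} {S : Set (EuclideanSpace ℝ (Fin m))} {A : Type*} [MeasurableSpace A]
    {d : ℕ} {Θ : Type*} [MeasurableSpace Θ] (M : Problem S A d Θ) where
  /-- the online learner -/
  learner : (t : ℕ) → Kernel (Fin t → M.Datum) Θ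
  isMarkovKernel_learner : ∀ t, IsMarkovKernel (learner t)
  /-- the initial policy parameter, which is arbitrary -/
  ψ₀ : EuclideanSpace ℝ (Fin d)
  /-- the policy parameter of the round that follows the given data -/
  plan : (t : ℕ) → (Fin t → M.Datum) → EuclideanSpace ℝ (Fin d)
  measurable_plan : ∀ t, Measurable (plan t)
  plan_argmax : ∀ t hist ψ,
    ∫ θ, M.ret θ ψ ∂(learner t hist) ≤ ∫ θ, M.ret θ (plan t hist) ∂(learner t hist)

namespace Alg

variable {m : ℕ} {S : Set (EuclideanSpace ℝ (Fin m))} {A : Type*} [MeasurableSpace A]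
  {d : ℕ} {Θ : Type*} [MeasurableSpace Θ] {M : Problem S A d Θ} (alg : Alg M)

/-- The policy parameter of the previous round. -/
def prev : (t : ℕ) → (Fin t → M.Datum) → EuclideanSpace ℝ (Fin d)
  | 0, _ => alg.ψ₀
  | t + 1, hist => alg.plan t fun i => hist i.castSucc

/-- The law of the data of a round given the data of the earlier rounds: two independent
trajectories under the true dynamics `θs`, for the current and for the previous policy. -/
def roundLaw (θs : Θ) (t : ℕ) (hist : Fin t → M.Datum) : Measure M.Datum :=
  (M.trajLaw θs (alg.plan t hist)).prod (M.trajLaw θs (alg.prev t hist))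

/-- The law of the data of the first `t` rounds. -/
def runLaw (θs : Θ) : (t : ℕ) → Measure (Fin t → M.Datum)
  | 0 => Measure.dirac Fin.elim0
  | t + 1 => (runLaw θs t).bind fun hist =>
      (alg.roundLaw θs t hist).map fun z => (Fin.snoc hist z : Fin (t + 1) → M.Datum)

/-- The `(εg, εh)`-local regret over `T` rounds, as a function of the data of the run. -/
def localRegret (θs : Θ) (εg εh : ℝ) {T : ℕ} (hist : Fin T → M.Datum) : ℝ :=
  ∑ t : Fin T, ((⨅ ψ : approxLocalMaxima (M.ret θs) εg εh, M.ret θs ψ) -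
    M.ret θs (alg.plan t (histUpTo hist t)))

end Alg

/-- The constant `c₁`. -/
def c₁ (H L₀ L₁ L₂ χg χf χh : ℝ) : ℝ :=
  H * L₀ ^ 2 * (4 * H ^ 2 * χh + 4 * H ^ 4 * χf + 2 * H ^ 2 * χg + 1) +
    H * L₁ ^ 2 * (8 * H ^ 2 * χg + 2) + 4 * H * L₂ ^ 2

end ViOlinRL

end

/-! The argument is a potential argument for f = η(θ*, ·). In each round the new parameter maximizes
the average of η(θ, ·) over the learner's distribution. If every η(θ, ·) nearly agrees with f to
second order at the previous parameter, and in value at the new one, then the new parameter does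
almost as well under f as any fixed competitor near the previous one. When the previous parameter is
not an approximate local maximum, a gradient step or a step along a leading eigenvector is such a
competitor, and it gains at least `gain`. The direction and the length of the step depend on f
alone, so they serve all θ at once (`exists_ascent`, `Problem.round_progress`). When it is an
approximate local maximum, it competes itself and only the model error is lost.

The model errors are controlled by `Problem.ret_error_bounds`. The simulation lemma
`Problem.valueToGo_sub` writes η(θ, ψ) - η(θ*, ψ) as a sum over steps of one-step value gaps along
true trajectories, and each gap is Lipschitz in the prediction error. Both the gap and the
trajectory law depend on ψ. A change of measure fixes the law and moves its dependence on ψ into a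
likelihood ratio, whose derivatives are score terms with controlled moments. First differences and
symmetric second differences are bounded along a line and the step is then sent to zero, so nothing
is differentiated under an integral. Cauchy–Schwarz yields squared errors of at most c₁ times the
expected squared prediction loss.

That loss is what the online learner minimizes. Since θ* has loss zero, the regret guarantee bounds
the learner's cumulative loss along every admissible data sequence by twice the Rademacher
complexity, and Fubini transfers this to the run (`Alg.integrable_sum_roundErr`).

Finally `sum_le_of_recursion` turns the progress inequalities into gain · regret ≤ 1 + total error.
The square root of the loss is replaced by a linear bound with a free parameter κ, which is
optimized only after taking expectations (`le_sqrt_of_forall_le`). -/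

namespace ViOlinRL

/-! ### Measurable families of probability measures -/

section Kernels

variable {α β γ : Type*} [MeasurableSpace α] [MeasurableSpace β] [MeasurableSpace γ]

lemma measurable_lintegral_of_measurable {κ : α → Measure β} (hκ : Measurable κ)
    (hp : ∀ a, IsProbabilityMeasure (κ a)) {F : α × β → ENNReal} (hF : Measurable F) :
    Measurable fun a => ∫⁻ b, F (a, b) ∂κ a := by
  let K : Kernel α β := ⟨κ, hκ⟩
  have : IsMarkovKernel K := ⟨hp⟩
  exact hF.lintegral_kernel_prod_right' (κ := K)

lemma measurable_integral_of_measurable {κ : α → Measure β} (hκ : Measurable κ)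
    (hp : ∀ a, IsProbabilityMeasure (κ a)) {F : α × β → ℝ} (hF : Measurable F) :
    Measurable fun a => ∫ b, F (a, b) ∂κ a := by
  let K : Kernel α β := ⟨κ, hκ⟩
  have : IsMarkovKernel K := ⟨hp⟩
  exact (hF.stronglyMeasurable.integral_kernel_prod_right' (κ := K)).measurable

lemma measurable_map_of_measurable {κ : α → Measure β} (hκ : Measurable κ)
    (hp : ∀ a, IsProbabilityMeasure (κ a)) {f : α × β → γ} (hf : Measurable f) :
    Measurable fun a => (κ a).map fun b => f (a, b) := by
  refine Measure.measurable_of_measurable_coe _ fun B hB => ?_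
  let K : Kernel α β := ⟨κ, hκ⟩
  have : IsMarkovKernel K := ⟨hp⟩
  have h := Kernel.measurable_kernel_prodMk_left (κ := K) (hf hB)
  convert! h using 2 with a
  rw [Measure.map_apply (by fun_prop) hB]
  rfl

lemma measurable_bind_of_measurable {κ : α → Measure β} (hκ : Measurable κ)
    (hp : ∀ a, IsProbabilityMeasure (κ a)) {η : α × β → Measure γ} (hη : Measurable η) :
    Measurable fun a => (κ a).bind fun b => η (a, b) := by
  refine Measure.measurable_of_measurable_coe _ fun B hB => ?_
  have h := measurable_lintegral_of_measurable hκ hp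
    (F := fun x => η x B) ((Measure.measurable_coe hB).comp hη)
  convert! h using 2 with a
  have h' : Measurable fun b => η (a, b) := hη.comp measurable_prodMk_left
  rw [Measure.bind_apply hB h'.aemeasurable]

lemma ae_bind_of_forall_ae {μ : Measure α} {κ : α → Measure β} (hκ : Measurable κ) {p : β → Prop}
    (hp : MeasurableSet {b | p b}) (h : ∀ᵐ a ∂μ, ∀ᵐ b ∂κ a, p b) : ∀ᵐ b ∂μ.bind κ, p b := by
  rw [ae_iff, show {b | ¬ p b} = {b | p b}ᶜ from rfl, Measure.bind_apply hp.compl hκ.aemeasurable]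
  have h' : Measurable fun a => κ a {b | p b}ᶜ := (Measure.measurable_coe hp.compl).comp hκ
  rw [lintegral_eq_zero_iff h']
  filter_upwards [h] with a ha using ha

lemma integral_bind_of_bounded {μ : Measure α} [IsProbabilityMeasure μ] {κ : α → Measure β}
    (hκ : Measurable κ) (hp : ∀ a, IsProbabilityMeasure (κ a)) {f : β → ℝ} (hf : Measurable f)
    {C : ℝ} (hC : ∀ b, |f b| ≤ C) :
    ∫ b, f b ∂μ.bind κ = ∫ a, ∫ b, f b ∂κ a ∂μ := by
  let K : Kernel α β := ⟨κ, hκ⟩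
  have : IsMarkovKernel K := ⟨hp⟩
  have : IsProbabilityMeasure (K ∘ₘ μ) := inferInstance
  have hi : Integrable f (K ∘ₘ μ) :=
    Integrable.of_bound hf.aestronglyMeasurable C (Filter.Eventually.of_forall hC)
  have := Kernel.integral_comp (κ := Kernel.const Unit μ) (η := K) (a := ()) (f := f)
  rw [← Measure.comp_eq_comp_const_apply] at this
  simp only [Kernel.const_apply] at this
  exact this hi

lemma integrable_of_measurable_of_bound {μ : Measure α} [IsFiniteMeasure μ] {f : α → ℝ}
    (hf : Measurable f) (C : ℝ) (h : ∀ a, |f a| ≤ C) : Integrable f μ :=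
  Integrable.of_bound hf.aestronglyMeasurable C (Filter.Eventually.of_forall h)

lemma abs_integral_le_of_bound {μ : Measure α} [IsProbabilityMeasure μ] {f : α → ℝ} {C : ℝ}
    (h : ∀ a, |f a| ≤ C) : |∫ a, f a ∂μ| ≤ C := by
  have h' : ∀ᵐ a ∂μ, ‖f a‖ ≤ C := Filter.Eventually.of_forall h
  simpa using norm_integral_le_of_norm_le_const h'

end Kernels

/-! ### Trajectory laws and change of measure between policies -/

namespace Problem

variable {m : ℕ} {S : Set (EuclideanSpace ℝ (Fin m))} {A : Type*} [MeasurableSpace A]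
  {d : ℕ} {Θ : Type*} [MeasurableSpace Θ] (M : Problem S A d Θ)

instance : IsProbabilityMeasure M.μ₁ := M.isProbabilityMeasure_μ₁

instance : SigmaFinite M.ν := M.sigmaFinite_ν

instance (ψ : EuclideanSpace ℝ (Fin d)) (s : S) : IsProbabilityMeasure (M.policy ψ s) := by
  constructor
  rw [policy, withDensity_apply _ MeasurableSet.univ, Measure.restrict_univ]
  exact M.lintegral_dens ψ s

lemma measurable_policy : Measurable fun x : EuclideanSpace ℝ (Fin d) × S => M.policy x.1 x.2 := by
  refine Measure.measurable_of_measurable_coe _ fun B hB => ?_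
  simp only [policy, withDensity_apply _ hB]
  refine Measurable.lintegral_prod_right' (f := fun y : (EuclideanSpace ℝ (Fin d) × S) × A =>
    ENNReal.ofReal (M.dens y.1.1 y.1.2 y.2)) ?_
  exact (M.measurable_dens.comp (by fun_prop : Measurable fun y :
    (EuclideanSpace ℝ (Fin d) × S) × A => (y.1.1, y.1.2, y.2))).ennreal_ofReal

lemma measurable_finCons (k : ℕ) :
    Measurable fun x : (S × A) × (Fin k → S × A) => (Fin.cons x.1 x.2 : Fin (k + 1) → S × A) := by
  refine measurable_pi_lambda _ fun i => ?_
  refine Fin.cases ?_ (fun j => ?_) i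
  · simpa using measurable_fst
  · simp only [Fin.cons_succ]; fun_prop

lemma trajFrom_aux (k : ℕ) :
    (Measurable fun x : Θ × EuclideanSpace ℝ (Fin d) × S => M.trajFrom x.1 x.2.1 k x.2.2) ∧
    ∀ θ ψ s, IsProbabilityMeasure (M.trajFrom θ ψ k s) := by
  induction k with
  | zero => exact ⟨measurable_const, fun _ _ _ => by simp only [trajFrom]; infer_instance⟩
  | succ k ih =>
    obtain ⟨hm, hp⟩ := ih
    have hη : Measurable fun y : (Θ × EuclideanSpace ℝ (Fin d) × S) × A =>
        (M.trajFrom y.1.1 y.1.2.1 k (M.dyn y.1.1 y.1.2.2 y.2)).map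
          fun τ => (Fin.cons (y.1.2.2, y.2) τ : Fin (k + 1) → S × A) := by
      refine measurable_map_of_measurable
        (κ := fun y : (Θ × EuclideanSpace ℝ (Fin d) × S) × A =>
          M.trajFrom y.1.1 y.1.2.1 k (M.dyn y.1.1 y.1.2.2 y.2)) ?_ (fun y => hp _ _ _)
        (f := fun z => (Fin.cons (z.1.1.2.2, z.1.2) z.2 : Fin (k + 1) → S × A)) ?_
      · exact hm.comp (measurable_fst.fst.prodMk (measurable_fst.snd.fst.prodMk
          (M.measurable_dyn.comp (by fun_prop : Measurable fun y :
            (Θ × EuclideanSpace ℝ (Fin d) × S) × A => (y.1.1, y.1.2.2, y.2)))))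
      · exact (measurable_finCons k).comp ((measurable_fst.fst.snd.snd.prodMk
          measurable_fst.snd).prodMk measurable_snd)
    refine ⟨?_, fun θ ψ s => ?_⟩
    · exact measurable_bind_of_measurable (η := fun y => (M.trajFrom y.1.1 y.1.2.1 k
          (M.dyn y.1.1 y.1.2.2 y.2)).map fun τ => (Fin.cons (y.1.2.2, y.2) τ : Fin (k + 1) → S × A))
        (κ := fun x : Θ × EuclideanSpace ℝ (Fin d) × S => M.policy x.2.1 x.2.2)
        (M.measurable_policy.comp measurable_snd) (fun _ => inferInstance) hη
    · refine isProbabilityMeasure_bind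
        (hη.comp (measurable_prodMk_left (x := (θ, ψ, s)))).aemeasurable
        (Filter.Eventually.of_forall fun a => ?_)
      have := hp θ ψ (M.dyn θ s a)
      exact Measure.isProbabilityMeasure_map ((measurable_finCons k).comp
        measurable_prodMk_left).aemeasurable

lemma measurable_trajFrom (k : ℕ) :
    Measurable fun x : Θ × EuclideanSpace ℝ (Fin d) × S => M.trajFrom x.1 x.2.1 k x.2.2 :=
  (M.trajFrom_aux k).1

instance (θ : Θ) (ψ : EuclideanSpace ℝ (Fin d)) (k : ℕ) (s : S) :
    IsProbabilityMeasure (M.trajFrom θ ψ k s) :=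
  (M.trajFrom_aux k).2 θ ψ s

lemma measurable_dyn_right (θ : Θ) (s : S) : Measurable fun a => M.dyn θ s a :=
  M.measurable_dyn.comp (by fun_prop : Measurable fun a : A => (θ, s, a))

lemma measurable_trajFrom_dyn (θ : Θ) (ψ : EuclideanSpace ℝ (Fin d)) (k : ℕ) (s : S) :
    Measurable fun a => M.trajFrom θ ψ k (M.dyn θ s a) :=
  (M.measurable_trajFrom k).comp
    (measurable_const.prodMk (measurable_const.prodMk (M.measurable_dyn_right θ s)))

lemma measurable_trajFrom_step (θ : Θ) (ψ : EuclideanSpace ℝ (Fin d)) (k : ℕ) (s : S) :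
    Measurable fun a => (M.trajFrom θ ψ k (M.dyn θ s a)).map
      fun τ => (Fin.cons (s, a) τ : Fin (k + 1) → S × A) :=
  measurable_map_of_measurable (M.measurable_trajFrom_dyn θ ψ k s) (fun _ => inferInstance)
    (f := fun z => (Fin.cons (s, z.1) z.2 : Fin (k + 1) → S × A))
    ((measurable_finCons k).comp ((measurable_const.prodMk measurable_fst).prodMk measurable_snd))

lemma measurable_finCons_right (k : ℕ) (x : S × A) :
    Measurable fun τ => (Fin.cons x τ : Fin (k + 1) → S × A) :=
  (measurable_finCons k).comp measurable_prodMk_left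

lemma lintegral_trajFrom_succ (θ : Θ) (ψ : EuclideanSpace ℝ (Fin d)) (k : ℕ) (s : S)
    {F : (Fin (k + 1) → S × A) → ENNReal} (hF : Measurable F) :
    ∫⁻ τ, F τ ∂M.trajFrom θ ψ (k + 1) s =
      ∫⁻ a, ∫⁻ τ, F (Fin.cons (s, a) τ) ∂M.trajFrom θ ψ k (M.dyn θ s a) ∂M.policy ψ s := by
  rw [trajFrom, Measure.lintegral_bind (M.measurable_trajFrom_step θ ψ k s).aemeasurable
    hF.aemeasurable]
  refine lintegral_congr fun a => ?_
  rw [lintegral_map hF (measurable_finCons_right k _)]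

lemma integral_trajFrom_succ (θ : Θ) (ψ : EuclideanSpace ℝ (Fin d)) (k : ℕ) (s : S)
    {F : (Fin (k + 1) → S × A) → ℝ} (hF : Measurable F) {C : ℝ} (hC : ∀ τ, |F τ| ≤ C) :
    ∫ τ, F τ ∂M.trajFrom θ ψ (k + 1) s =
      ∫ a, ∫ τ, F (Fin.cons (s, a) τ) ∂M.trajFrom θ ψ k (M.dyn θ s a) ∂M.policy ψ s := by
  rw [trajFrom, integral_bind_of_bounded (M.measurable_trajFrom_step θ ψ k s)
    (fun a => Measure.isProbabilityMeasure_map (measurable_finCons_right k _).aemeasurable) hF hC]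
  refine integral_congr_ae (Filter.Eventually.of_forall fun a => ?_)
  exact integral_map (measurable_finCons_right k _).aemeasurable hF.aestronglyMeasurable

lemma ae_trajFrom_succ (θ : Θ) (ψ : EuclideanSpace ℝ (Fin d)) (k : ℕ) (s : S)
    {p : (Fin (k + 1) → S × A) → Prop} (hp : MeasurableSet {τ | p τ})
    (h : ∀ a, ∀ᵐ τ ∂M.trajFrom θ ψ k (M.dyn θ s a), p (Fin.cons (s, a) τ)) :
    ∀ᵐ τ ∂M.trajFrom θ ψ (k + 1) s, p τ := by
  rw [trajFrom]
  refine ae_bind_of_forall_ae (M.measurable_trajFrom_step θ ψ k s) hp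
    (Filter.Eventually.of_forall fun a => ?_)
  rw [ae_map_iff (measurable_finCons_right k _).aemeasurable hp]
  exact h a

/-- Trajectories stay in the prescribed stages. -/
lemma ae_trajFrom_mem_stage (θ : Θ) (ψ : EuclideanSpace ℝ (Fin d)) (k h : ℕ) (hk : h + k ≤ M.H)
    (s : S) (hs : s ∈ M.stage h) :
    ∀ᵐ τ ∂M.trajFrom θ ψ k s, ∀ i : Fin k, (τ i).1 ∈ M.stage (h + i) := by
  induction k generalizing h s with
  | zero => exact Filter.Eventually.of_forall fun _ i => i.elim0
  | succ k ih =>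
    refine M.ae_trajFrom_succ θ ψ k s ?_ fun a => ?_
    · simp only [Set.ofPred_forall]
      exact MeasurableSet.iInter fun i =>
        (measurable_pi_apply i).fst (M.measurableSet_stage _)
    · rcases k with _ | k
      · refine Filter.Eventually.of_forall fun τ i => ?_
        obtain rfl : i = 0 := by omega
        simpa using hs
      · filter_upwards [ih (h + 1) (by omega) (M.dyn θ s a)
          (M.dyn_mem_stage θ h (by omega) s hs a)] with τ hτ i
        refine Fin.cases ?_ (fun j => ?_) i
        · simpa using hs
        · simpa [add_assoc, add_comm, add_left_comm] using hτ j

lemma measurable_trajLaw_kernel (θ : Θ) (ψ : EuclideanSpace ℝ (Fin d)) :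
    Measurable fun s => M.trajFrom θ ψ M.H s :=
  (M.measurable_trajFrom M.H).comp (by fun_prop : Measurable fun s : S => (θ, ψ, s))

instance (θ : Θ) (ψ : EuclideanSpace ℝ (Fin d)) : IsProbabilityMeasure (M.trajLaw θ ψ) :=
  isProbabilityMeasure_bind (M.measurable_trajLaw_kernel θ ψ).aemeasurable
    (Filter.Eventually.of_forall fun _ => inferInstance)

lemma measurable_trajLaw (θ : Θ) : Measurable fun ψ => M.trajLaw θ ψ :=
  measurable_bind_of_measurable (κ := fun _ : EuclideanSpace ℝ (Fin d) => M.μ₁) measurable_const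
    (fun _ => inferInstance) (η := fun x => M.trajFrom θ x.1 M.H x.2)
    ((M.measurable_trajFrom M.H).comp
      (by fun_prop : Measurable fun x : EuclideanSpace ℝ (Fin d) × S => (θ, x.1, x.2)))

lemma ae_trajLaw_mem_stage (θ : Θ) (ψ : EuclideanSpace ℝ (Fin d)) :
    ∀ᵐ τ ∂M.trajLaw θ ψ, ∀ i : Fin M.H, (τ i).1 ∈ M.stage i := by
  refine ae_bind_of_forall_ae (M.measurable_trajLaw_kernel θ ψ) ?_ ?_
  · simp only [Set.ofPred_forall]
    exact MeasurableSet.iInter fun i => (measurable_pi_apply i).fst (M.measurableSet_stage _)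
  · filter_upwards [M.ae_mem_stage] with s hs
    simpa using M.ae_trajFrom_mem_stage θ ψ M.H 0 (by simp) s hs

/-- The marginals of a trajectory inherit uniform bounds on one-step expectations. -/
lemma lintegral_trajFrom_coord_le (θ : Θ) (ψ : EuclideanSpace ℝ (Fin d)) {φ : S × A → ENNReal}
    (hφ : Measurable φ) {c : ENNReal} (hc : ∀ s, ∫⁻ a, φ (s, a) ∂M.policy ψ s ≤ c) (k : ℕ) (s : S)
    (i : Fin k) : ∫⁻ τ, φ (τ i) ∂M.trajFrom θ ψ k s ≤ c := by
  induction k generalizing s with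
  | zero => exact i.elim0
  | succ k ih =>
    rw [M.lintegral_trajFrom_succ θ ψ k s (F := fun τ => φ (τ i)) (by fun_prop)]
    refine Fin.cases ?_ (fun j => ?_) i
    · simpa using hc s
    · simp only [Fin.cons_succ]
      calc _ ≤ ∫⁻ _, c ∂M.policy ψ s := lintegral_mono fun a => ih _ j
        _ = c := by simp

lemma lintegral_trajLaw_coord_le (θ : Θ) (ψ : EuclideanSpace ℝ (Fin d)) {φ : S × A → ENNReal}
    (hφ : Measurable φ) {c : ENNReal} (hc : ∀ s, ∫⁻ a, φ (s, a) ∂M.policy ψ s ≤ c)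
    (i : Fin M.H) : ∫⁻ τ, φ (τ i) ∂M.trajLaw θ ψ ≤ c := by
  have h : Measurable fun τ : M.Traj => φ (τ i) := hφ.comp (measurable_pi_apply i)
  rw [trajLaw, Measure.lintegral_bind (M.measurable_trajLaw_kernel θ ψ).aemeasurable
    h.aemeasurable]
  calc _ ≤ ∫⁻ _, c ∂M.μ₁ := lintegral_mono fun s => M.lintegral_trajFrom_coord_le θ ψ hφ hc _ s i
    _ = c := by simp

/-- The likelihood ratio of the first `n` actions. -/
noncomputable def ratio (ψ₀ ψ : EuclideanSpace ℝ (Fin d)) {k : ℕ} (n : ℕ) (τ : Fin k → S × A) : ENNReal :=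
  ∏ j : Fin k, if (j : ℕ) < n then
    ENNReal.ofReal (M.dens ψ (τ j).1 (τ j).2 / M.dens ψ₀ (τ j).1 (τ j).2) else 1

lemma measurable_dens_comp {γ : Type*} [MeasurableSpace γ] {f : γ → EuclideanSpace ℝ (Fin d)}
    {g : γ → S × A} (hf : Measurable f) (hg : Measurable g) :
    Measurable fun x => M.dens (f x) (g x).1 (g x).2 :=
  M.measurable_dens.comp (hf.prodMk hg)

lemma measurable_ratio (ψ₀ ψ : EuclideanSpace ℝ (Fin d)) {k : ℕ} (n : ℕ) :
    Measurable (M.ratio ψ₀ ψ n : (Fin k → S × A) → ENNReal) := by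
  refine Finset.measurable_prod _ fun j _ => ?_
  split_ifs
  · exact ((M.measurable_dens_comp measurable_const (measurable_pi_apply j)).div
      (M.measurable_dens_comp measurable_const (measurable_pi_apply j))).ennreal_ofReal
  · exact measurable_const

/-- All policies have densities with respect to the same measure, and positivity of the density of
`ψ₀` lets it cancel in the ratio. -/
lemma lintegral_policy_change (ψ₀ ψ : EuclideanSpace ℝ (Fin d)) (s : S) {φ : A → ENNReal}
    (hφ : Measurable φ) :
    ∫⁻ a, φ a ∂M.policy ψ s =
      ∫⁻ a, φ a * ENNReal.ofReal (M.dens ψ s a / M.dens ψ₀ s a) ∂M.policy ψ₀ s := by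
  have h1 : ∀ ψ, Measurable fun a => M.dens ψ s a := fun ψ =>
    M.measurable_dens.comp (by fun_prop : Measurable fun a : A => (ψ, s, a))
  have h2 : Measurable fun a => φ a * ENNReal.ofReal (M.dens ψ s a / M.dens ψ₀ s a) :=
    hφ.mul ((h1 ψ).div (h1 ψ₀)).ennreal_ofReal
  rw [policy, policy, lintegral_withDensity_eq_lintegral_mul _ (h1 ψ).ennreal_ofReal hφ,
    lintegral_withDensity_eq_lintegral_mul _ (h1 ψ₀).ennreal_ofReal h2]
  refine lintegral_congr fun a => ?_
  have h0 := M.dens_pos ψ₀ s a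
  simp only [Pi.mul_apply]
  rw [mul_left_comm, ← ENNReal.ofReal_mul h0.le, mul_div_cancel₀ _ h0.ne', mul_comm]

/-- Change of measure for functions of the first `n` state-action pairs of a trajectory. -/
lemma lintegral_trajFrom_change (θ : Θ) (ψ₀ ψ : EuclideanSpace ℝ (Fin d)) (k n : ℕ) (s : S)
    {F : (Fin k → S × A) → ENNReal} (hF : Measurable F)
    (hn : ∀ τ τ', (∀ j : Fin k, (j : ℕ) < n → τ j = τ' j) → F τ = F τ') :
    ∫⁻ τ, F τ ∂M.trajFrom θ ψ k s = ∫⁻ τ, F τ * M.ratio ψ₀ ψ n τ ∂M.trajFrom θ ψ₀ k s := by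
  induction k generalizing n s with
  | zero => simp [trajFrom, ratio]
  | succ k ih =>
    rcases n with _ | n
    -- With an empty prefix `F` is constant, the ratio is one, and both laws have mass one.
    · obtain ⟨τ₀⟩ : Nonempty (Fin (k + 1) → S × A) :=
        nonempty_of_isProbabilityMeasure (M.trajFrom θ ψ (k + 1) s)
      have h : ∀ τ, F τ = F τ₀ := fun τ => hn _ _ fun j hj => absurd hj (Nat.not_lt_zero _)
      simp [h, ratio]
    · have h1 : Measurable fun τ => F τ * M.ratio ψ₀ ψ (n + 1) τ :=
        hF.mul (M.measurable_ratio ψ₀ ψ _)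
      rw [M.lintegral_trajFrom_succ θ ψ k s hF, M.lintegral_trajFrom_succ θ ψ₀ k s h1]
      -- The first factor of the ratio changes the law of the first action; the other `n` factors
      -- come from the induction hypothesis for the tail.
      rw [M.lintegral_policy_change ψ₀ ψ s]
      · refine lintegral_congr fun a => ?_
        rw [ih n (M.dyn θ s a) (F := fun τ => F (Fin.cons (s, a) τ))
          (hF.comp (measurable_finCons_right k _))]
        · have h2 : Measurable fun τ => F (Fin.cons (s, a) τ) * M.ratio ψ₀ ψ n τ :=
            (hF.comp (measurable_finCons_right k _)).mul (M.measurable_ratio ψ₀ ψ n)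
          rw [← lintegral_mul_const _ h2]
          refine lintegral_congr fun τ => ?_
          simp only [ratio, Fin.prod_univ_succ, Fin.cons_zero, Fin.cons_succ, Fin.val_zero,
            Nat.zero_lt_succ, if_true, Fin.val_succ, Nat.succ_lt_succ_iff]
          ring
        · intro τ τ' h
          refine hn _ _ fun j => ?_
          refine Fin.cases ?_ (fun i => ?_) j
          · simp
          · intro hi
            simpa using h i (by simpa using hi)
      · exact measurable_lintegral_of_measurable (M.measurable_trajFrom_dyn θ ψ k s)
          (fun _ => inferInstance) (F := fun z => F (Fin.cons (s, z.1) z.2))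
          (hF.comp ((measurable_finCons k).comp
            ((measurable_const.prodMk measurable_fst).prodMk measurable_snd)))

lemma lintegral_trajLaw_change (θ : Θ) (ψ₀ ψ : EuclideanSpace ℝ (Fin d)) (n : ℕ)
    {F : M.Traj → ENNReal} (hF : Measurable F)
    (hn : ∀ τ τ', (∀ j : Fin M.H, (j : ℕ) < n → τ j = τ' j) → F τ = F τ') :
    ∫⁻ τ, F τ ∂M.trajLaw θ ψ = ∫⁻ τ, F τ * M.ratio ψ₀ ψ n τ ∂M.trajLaw θ ψ₀ := by
  have h1 : Measurable fun τ => F τ * M.ratio ψ₀ ψ n τ := hF.mul (M.measurable_ratio ψ₀ ψ n)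
  rw [trajLaw, trajLaw, Measure.lintegral_bind (M.measurable_trajLaw_kernel θ ψ).aemeasurable
    hF.aemeasurable, Measure.lintegral_bind (M.measurable_trajLaw_kernel θ ψ₀).aemeasurable
    h1.aemeasurable]
  exact lintegral_congr fun s => M.lintegral_trajFrom_change θ ψ₀ ψ _ n s hF hn

end Problem

/-! ### Values and the simulation lemma -/

namespace Problem

variable {m : ℕ} {S : Set (EuclideanSpace ℝ (Fin m))} {A : Type*} [MeasurableSpace A]
  {d : ℕ} {Θ : Type*} [MeasurableSpace Θ] (M : Problem S A d Θ)

/-- The expected total reward of the next `k` steps. -/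
noncomputable def valueToGo (θ : Θ) (ψ : EuclideanSpace ℝ (Fin d)) (k : ℕ) (s : S) : ℝ :=
  ∫ τ, ∑ i, M.r (τ i).1 (τ i).2 ∂(M.trajFrom θ ψ k s)

lemma measurable_sum_reward (k : ℕ) :
    Measurable fun τ : Fin k → S × A => ∑ i, M.r (τ i).1 (τ i).2 :=
  Finset.measurable_sum _ fun i _ => M.measurable_r.comp (measurable_pi_apply i)

lemma sum_reward_nonneg {k : ℕ} (τ : Fin k → S × A) : 0 ≤ ∑ i, M.r (τ i).1 (τ i).2 :=
  Finset.sum_nonneg fun _ _ => (M.r_mem _ _).1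

lemma sum_reward_le {k : ℕ} (τ : Fin k → S × A) : ∑ i, M.r (τ i).1 (τ i).2 ≤ k := by
  calc ∑ i, M.r (τ i).1 (τ i).2 ≤ ∑ _i : Fin k, (1 : ℝ) :=
        Finset.sum_le_sum fun _ _ => (M.r_mem _ _).2
    _ = k := by simp

lemma abs_sum_reward_le {k : ℕ} (τ : Fin k → S × A) : |∑ i, M.r (τ i).1 (τ i).2| ≤ k := by
  rw [abs_of_nonneg (M.sum_reward_nonneg τ)]
  exact M.sum_reward_le τ

lemma abs_valueToGo_le (θ : Θ) (ψ : EuclideanSpace ℝ (Fin d)) (k : ℕ) (s : S) :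
    |M.valueToGo θ ψ k s| ≤ k :=
  abs_integral_le_of_bound fun τ => M.abs_sum_reward_le τ

lemma valueToGo_nonneg (θ : Θ) (ψ : EuclideanSpace ℝ (Fin d)) (k : ℕ) (s : S) :
    0 ≤ M.valueToGo θ ψ k s :=
  integral_nonneg fun τ => M.sum_reward_nonneg τ

lemma measurable_valueToGo (k : ℕ) :
    Measurable fun x : Θ × EuclideanSpace ℝ (Fin d) × S => M.valueToGo x.1 x.2.1 k x.2.2 :=
  measurable_integral_of_measurable (M.measurable_trajFrom k) (fun _ => inferInstance)
    (F := fun x => ∑ i, M.r (x.2 i).1 (x.2 i).2)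
    ((M.measurable_sum_reward k).comp measurable_snd)

lemma measurable_valueToGo_comp {γ : Type*} [MeasurableSpace γ] (k : ℕ) {f : γ → Θ}
    {g : γ → EuclideanSpace ℝ (Fin d)} {h : γ → S} (hf : Measurable f) (hg : Measurable g)
    (hh : Measurable h) : Measurable fun x => M.valueToGo (f x) (g x) k (h x) :=
  (M.measurable_valueToGo k).comp (hf.prodMk (hg.prodMk hh))

lemma measurable_dyn_comp {γ : Type*} [MeasurableSpace γ] {f : γ → Θ} {g : γ → S × A}
    (hf : Measurable f) (hg : Measurable g) : Measurable fun x => M.dyn (f x) (g x).1 (g x).2 :=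
  M.measurable_dyn.comp (hf.prodMk hg)

lemma valueToGo_succ (θ : Θ) (ψ : EuclideanSpace ℝ (Fin d)) (k : ℕ) (s : S) :
    M.valueToGo θ ψ (k + 1) s =
      ∫ a, (M.r s a + M.valueToGo θ ψ k (M.dyn θ s a)) ∂M.policy ψ s := by
  rw [valueToGo, M.integral_trajFrom_succ θ ψ k s (M.measurable_sum_reward _)
    M.abs_sum_reward_le]
  refine integral_congr_ae (Filter.Eventually.of_forall fun a => ?_)
  simp only [Fin.sum_univ_succ, Fin.cons_zero, Fin.cons_succ]
  rw [integral_add (integrable_const _)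
    (integrable_of_measurable_of_bound (M.measurable_sum_reward k) k M.abs_sum_reward_le)]
  simp [valueToGo]

/-- The effect on the value-to-go of predicting a transition by the dynamics `θ` instead of `θs`. -/
noncomputable def valueGap (θs θ : Θ) (ψ : EuclideanSpace ℝ (Fin d)) (k : ℕ) (x : S × A) : ℝ :=
  M.valueToGo θ ψ k (M.dyn θ x.1 x.2) - M.valueToGo θ ψ k (M.dyn θs x.1 x.2)

lemma measurable_valueGap_comp {γ : Type*} [MeasurableSpace γ] (θs θ : Θ) (k : ℕ)
    {g : γ → EuclideanSpace ℝ (Fin d)} {h : γ → S × A} (hg : Measurable g) (hh : Measurable h) :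
    Measurable fun x => M.valueGap θs θ (g x) k (h x) :=
  (M.measurable_valueToGo_comp k measurable_const hg
    (M.measurable_dyn_comp measurable_const hh)).sub
  (M.measurable_valueToGo_comp k measurable_const hg
    (M.measurable_dyn_comp measurable_const hh))

lemma abs_valueGap_le (θs θ : Θ) (ψ : EuclideanSpace ℝ (Fin d)) (k : ℕ) (x : S × A) :
    |M.valueGap θs θ ψ k x| ≤ 2 * k := by
  have h1 := M.abs_valueToGo_le θ ψ k (M.dyn θ x.1 x.2)
  have h2 := M.abs_valueToGo_le θ ψ k (M.dyn θs x.1 x.2)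
  rw [abs_le] at *
  unfold valueGap
  constructor <;> linarith

/-- The simulation lemma: the values of two dynamics differ by the expected one-step gaps along a
trajectory of the second one. -/
lemma valueToGo_sub (θs θ : Θ) (ψ : EuclideanSpace ℝ (Fin d)) (k : ℕ) (s : S) :
    M.valueToGo θ ψ k s - M.valueToGo θs ψ k s =
      ∫ τ, ∑ i : Fin k, M.valueGap θs θ ψ (k - (i + 1)) (τ i) ∂M.trajFrom θs ψ k s := by
  induction k generalizing s with
  | zero => simp [valueToGo]
  | succ k ih =>
    have hm : ∀ k, Measurable fun τ : Fin k → S × A =>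
        ∑ i : Fin k, M.valueGap θs θ ψ (k - (i + 1)) (τ i) := fun k =>
      Finset.measurable_sum _ fun i _ =>
        M.measurable_valueGap_comp θs θ _ measurable_const (measurable_pi_apply i)
    have hb : ∀ k, ∀ τ : Fin k → S × A,
        |∑ i : Fin k, M.valueGap θs θ ψ (k - (i + 1)) (τ i)| ≤ ∑ _i : Fin k, (2 * k : ℝ) := by
      intro k τ
      refine (Finset.abs_sum_le_sum_abs _ _).trans (Finset.sum_le_sum fun i _ => ?_)
      refine (M.abs_valueGap_le θs θ ψ _ _).trans ?_
      have : ((k - (i + 1) : ℕ) : ℝ) ≤ k := by exact_mod_cast Nat.sub_le _ _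
      linarith
    have hI : ∀ θ' : Θ, Integrable
        (fun a => M.r s a + M.valueToGo θ ψ k (M.dyn θ' s a)) (M.policy ψ s) := by
      intro θ'
      have hr : Measurable fun a => M.r s a :=
        M.measurable_r.comp (by fun_prop : Measurable fun a : A => (s, a))
      refine integrable_of_measurable_of_bound (hr.add (M.measurable_valueToGo_comp k
        measurable_const measurable_const (M.measurable_dyn_right θ' s))) (1 + k) fun a => ?_
      refine (abs_add_le _ _).trans (add_le_add ?_ (M.abs_valueToGo_le _ _ _ _))
      rw [abs_of_nonneg (M.r_mem _ _).1]
      exact (M.r_mem _ _).2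
    have hI2 : Integrable (fun a => M.r s a + M.valueToGo θs ψ k (M.dyn θs s a))
        (M.policy ψ s) := by
      have hr : Measurable fun a => M.r s a :=
        M.measurable_r.comp (by fun_prop : Measurable fun a : A => (s, a))
      refine integrable_of_measurable_of_bound (hr.add (M.measurable_valueToGo_comp k
        measurable_const measurable_const (M.measurable_dyn_right θs s))) (1 + k) fun a => ?_
      refine (abs_add_le _ _).trans (add_le_add ?_ (M.abs_valueToGo_le _ _ _ _))
      rw [abs_of_nonneg (M.r_mem _ _).1]
      exact (M.r_mem _ _).2
    rw [M.valueToGo_succ, M.valueToGo_succ, ← integral_sub (hI θ) hI2,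
      M.integral_trajFrom_succ θs ψ k s (hm (k + 1)) (hb (k + 1))]
    refine integral_congr_ae (Filter.Eventually.of_forall fun a => ?_)
    simp only [Fin.sum_univ_succ, Fin.cons_zero, Fin.cons_succ, Fin.val_zero, Fin.val_succ,
      Nat.add_sub_add_right]
    rw [integral_add (integrable_const _)
      (integrable_of_measurable_of_bound (hm k) _ (hb k)), ← ih]
    simp [valueGap]

/-- The simulation lemma averaged over the initial state. The sum stands outside the integral so
that each step can later be reweighted by the likelihood ratio of its own prefix only. -/
lemma ret_sub (θs θ : Θ) (ψ : EuclideanSpace ℝ (Fin d)) :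
    M.ret θ ψ - M.ret θs ψ =
      ∑ i : Fin M.H, ∫ τ, M.valueGap θs θ ψ (M.H - (i + 1)) (τ i) ∂M.trajLaw θs ψ := by
  have hI : ∀ θ' : Θ, Integrable (fun s => M.value θ' ψ 0 s) M.μ₁ := fun θ' =>
    integrable_of_measurable_of_bound (M.measurable_valueToGo_comp _ measurable_const
      measurable_const measurable_id) _ fun s => M.abs_valueToGo_le _ _ _ _
  have hm : ∀ i : Fin M.H, Measurable fun τ : M.Traj =>
      M.valueGap θs θ ψ (M.H - (i + 1)) (τ i) := fun i =>
    M.measurable_valueGap_comp θs θ _ measurable_const (measurable_pi_apply i)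
  have hb : ∀ τ : M.Traj,
      |∑ i : Fin M.H, M.valueGap θs θ ψ (M.H - (i + 1)) (τ i)| ≤ ∑ _i : Fin M.H, (2 * M.H : ℝ) := by
    intro τ
    refine (Finset.abs_sum_le_sum_abs _ _).trans (Finset.sum_le_sum fun i _ => ?_)
    refine (M.abs_valueGap_le θs θ ψ _ _).trans ?_
    have : ((M.H - (i + 1) : ℕ) : ℝ) ≤ M.H := by exact_mod_cast Nat.sub_le _ _
    linarith
  rw [← integral_finsetSum _ fun i _ =>
    integrable_of_measurable_of_bound (hm i) _ fun τ => M.abs_valueGap_le _ _ _ _ _]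
  rw [ret, ret, ← integral_sub (hI θ) (hI θs), trajLaw,
    integral_bind_of_bounded (M.measurable_trajLaw_kernel θs ψ) (fun _ => inferInstance)
      (Finset.measurable_sum _ fun i _ => hm i) hb]
  refine integral_congr_ae (Filter.Eventually.of_forall fun s => ?_)
  exact M.valueToGo_sub θs θ ψ M.H s

lemma ret_nonneg (θ : Θ) (ψ : EuclideanSpace ℝ (Fin d)) : 0 ≤ M.ret θ ψ :=
  integral_nonneg fun s => M.valueToGo_nonneg _ _ _ s

lemma abs_ret_le (θ : Θ) (ψ : EuclideanSpace ℝ (Fin d)) : |M.ret θ ψ| ≤ M.H :=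
  abs_integral_le_of_bound fun s => M.abs_valueToGo_le θ ψ M.H s

lemma measurable_ret : Measurable fun x : Θ × EuclideanSpace ℝ (Fin d) => M.ret x.1 x.2 :=
  measurable_integral_of_measurable (κ := fun _ : Θ × EuclideanSpace ℝ (Fin d) => M.μ₁)
    measurable_const (fun _ => inferInstance)
    (F := fun x => M.value x.1.1 x.1.2 0 x.2)
    (M.measurable_valueToGo_comp _ measurable_fst.fst measurable_fst.snd measurable_snd)

end Problem

/-! ### Taylor bounds along lines -/

section Line

variable {d : ℕ} {f : EuclideanSpace ℝ (Fin d) → ℝ}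

lemma contDiff_gradient (hf : ContDiff ℝ 2 f) : ContDiff ℝ 1 (gradient f) := by
  have h : ContDiff ℝ 1 (fderiv ℝ f) := hf.fderiv_right (by norm_num)
  exact (InnerProductSpace.toDual ℝ (EuclideanSpace ℝ (Fin d))).symm.contDiff.comp h

lemma hasDerivAt_line (x v : EuclideanSpace ℝ (Fin d)) (t : ℝ) :
    HasDerivAt (fun t : ℝ => x + t • v) v t := by
  simpa using ((hasDerivAt_id t).smul_const v).const_add x

lemma hasDerivAt_comp_line (hf : ContDiff ℝ 2 f) (x v : EuclideanSpace ℝ (Fin d)) (t : ℝ) :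
    HasDerivAt (fun t : ℝ => f (x + t • v)) ⟪gradient f (x + t • v), v⟫ t := by
  have h1 : DifferentiableAt ℝ f (x + t • v) := (hf.differentiable (by norm_num)) _
  have h2 := h1.hasGradientAt.hasFDerivAt.comp_hasDerivAt t (hasDerivAt_line x v t)
  simpa [Function.comp_def] using h2

lemma hasDerivAt_gradient_line (hf : ContDiff ℝ 2 f) (x v : EuclideanSpace ℝ (Fin d)) (t : ℝ) :
    HasDerivAt (fun t : ℝ => ⟪gradient f (x + t • v), v⟫) ⟪hess f (x + t • v) v, v⟫ t := by
  have h1 : DifferentiableAt ℝ (gradient f) (x + t • v) :=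
    ((contDiff_gradient hf).differentiable (by norm_num)) _
  have h2 := (h1.hasFDerivAt.comp_hasDerivAt t (hasDerivAt_line x v t)).inner ℝ
    (hasDerivAt_const t v)
  simpa [hess] using h2

lemma continuous_hess_line (hf : ContDiff ℝ 2 f) (x v : EuclideanSpace ℝ (Fin d)) :
    Continuous fun t : ℝ => ⟪hess f (x + t • v) v, v⟫ := by
  have h1 : Continuous (hess f) := (contDiff_gradient hf).continuous_fderiv (by norm_num)
  have h2 : Continuous fun t : ℝ => x + t • v := by fun_prop
  exact ((h1.comp h2).clm_apply continuous_const).inner continuous_const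

/-- A function that vanishes at zero and has nonnegative derivative on the half-line is nonnegative
there; this is used for `h'` and then for `h`. Taylor bounds follow by taking for `h` the difference
of the two sides. -/
lemma nonneg_of_deriv2_nonneg {h h' h'' : ℝ → ℝ} (hd : ∀ t, HasDerivAt h (h' t) t)
    (hd' : ∀ t, HasDerivAt h' (h'' t) t) (h0 : h 0 = 0) (h0' : h' 0 = 0)
    (hnn : ∀ t, 0 ≤ t → 0 ≤ h'' t) {t : ℝ} (ht : 0 ≤ t) : 0 ≤ h t := by
  have key : ∀ g g' : ℝ → ℝ, (∀ t, HasDerivAt g (g' t) t) → g 0 = 0 →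
      (∀ t, 0 ≤ t → 0 ≤ g' t) → ∀ t, 0 ≤ t → 0 ≤ g t := by
    intro g g' hg hg0 hg' t ht
    have hm : MonotoneOn g (Set.Ici 0) := by
      refine monotoneOn_of_deriv_nonneg (convex_Ici 0)
        (fun x _ => (hg x).continuousAt.continuousWithinAt)
        (fun x _ => (hg x).differentiableAt.differentiableWithinAt) fun x hx => ?_
      rw [(hg x).deriv]
      exact hg' x (by simpa using (interior_subset hx))
    have := hm (Set.mem_Ici.2 le_rfl) (Set.mem_Ici.2 ht) ht
    rwa [hg0] at this
  exact key h h' hd h0 (key h' h'' hd' h0' hnn) t ht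

lemma abs_inner_apply_le (B : EuclideanSpace ℝ (Fin d) →L[ℝ] EuclideanSpace ℝ (Fin d))
    (v : EuclideanSpace ℝ (Fin d)) : |⟪B v, v⟫| ≤ ‖B‖ * ‖v‖ ^ 2 := by
  calc |⟪B v, v⟫| ≤ ‖B v‖ * ‖v‖ := abs_real_inner_le_norm _ _
    _ ≤ (‖B‖ * ‖v‖) * ‖v‖ := by gcongr; exact B.le_opNorm v
    _ = _ := by ring

variable {ζg ζh ζ3 : ℝ}

/-- Second order Taylor bound along a line, from below. -/
lemma SmoothBounds.quadratic_lower (hf : SmoothBounds f ζg ζh ζ3)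
    (x v : EuclideanSpace ℝ (Fin d)) {t : ℝ} (ht : 0 ≤ t) :
    f x + t * ⟪gradient f x, v⟫ - ζh * ‖v‖ ^ 2 * t ^ 2 / 2 ≤ f (x + t • v) := by
  have := nonneg_of_deriv2_nonneg
    (h := fun t => f (x + t • v) - f x - t * ⟪gradient f x, v⟫ + ζh * ‖v‖ ^ 2 * t ^ 2 / 2)
    (h' := fun t => ⟪gradient f (x + t • v), v⟫ - ⟪gradient f x, v⟫ + ζh * ‖v‖ ^ 2 * t)
    (h'' := fun t => ⟪hess f (x + t • v) v, v⟫ + ζh * ‖v‖ ^ 2) ?_ ?_ (by simp) (by simp) ?_ ht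
  · linarith
  · intro t
    have h1 := ((hasDerivAt_comp_line hf.contDiff x v t).sub_const (f x)).sub
      ((hasDerivAt_id t).mul_const ⟪gradient f x, v⟫)
    have h2 := ((hasDerivAt_pow 2 t).const_mul (ζh * ‖v‖ ^ 2)).div_const 2
    refine (h1.add h2).congr_deriv ?_
    simp; ring
  · intro t
    have h1 := (hasDerivAt_gradient_line hf.contDiff x v t).sub_const ⟪gradient f x, v⟫
    have h2 := (hasDerivAt_id t).const_mul (ζh * ‖v‖ ^ 2)
    refine (h1.add h2).congr_deriv ?_
    simp
  · intro t _
    have h1 := (abs_le.1 (abs_inner_apply_le (hess f (x + t • v)) v)).1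
    have h2 := mul_le_mul_of_nonneg_right (hf.hess_le (x + t • v)) (sq_nonneg ‖v‖)
    linarith

/-- Third order Taylor bound along a unit direction. -/
lemma SmoothBounds.cubic_bound (hf : SmoothBounds f ζg ζh ζ3)
    (x : EuclideanSpace ℝ (Fin d)) {u : EuclideanSpace ℝ (Fin d)} (hu : ‖u‖ = 1) {t : ℝ}
    (ht : 0 ≤ t) :
    |f (x + t • u) - (f x + t * ⟪gradient f x, u⟫ + t ^ 2 / 2 * ⟪hess f x u, u⟫)| ≤
      ζ3 * t ^ 3 / 6 := by
  have hdiff : ∀ t : ℝ, 0 ≤ t →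
      |⟪hess f (x + t • u) u, u⟫ - ⟪hess f x u, u⟫| ≤ ζ3 * t := by
    intro t ht
    have h1 := abs_inner_apply_le (hess f (x + t • u) - hess f x) u
    have h2 := hf.hess_lip (x + t • u) x
    rw [sub_apply, inner_sub_left, hu] at h1
    simp only [add_sub_cancel_left, norm_smul, hu, Real.norm_eq_abs, abs_of_nonneg ht] at h2
    linarith
  -- The sign `σ` treats the upper and the lower bound together.
  have key : ∀ σ : ℝ, (σ = 1 ∨ σ = -1) →
      0 ≤ ζ3 * t ^ 3 / 6 - σ *
        (f (x + t • u) - (f x + t * ⟪gradient f x, u⟫ + t ^ 2 / 2 * ⟪hess f x u, u⟫)) := by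
    intro σ hσ
    refine nonneg_of_deriv2_nonneg
      (h := fun t => ζ3 * t ^ 3 / 6 - σ *
        (f (x + t • u) - (f x + t * ⟪gradient f x, u⟫ + t ^ 2 / 2 * ⟪hess f x u, u⟫)))
      (h' := fun t => ζ3 * t ^ 2 / 2 - σ *
        (⟪gradient f (x + t • u), u⟫ - (⟪gradient f x, u⟫ + t * ⟪hess f x u, u⟫)))
      (h'' := fun t => ζ3 * t - σ * (⟪hess f (x + t • u) u, u⟫ - ⟪hess f x u, u⟫))
      ?_ ?_ (by simp) (by simp) ?_ ht
    · intro t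
      have h1 := ((hasDerivAt_pow 3 t).const_mul ζ3).div_const 6
      have h2 := (((hasDerivAt_id t).mul_const ⟪gradient f x, u⟫).const_add (f x)).add
        (((hasDerivAt_pow 2 t).div_const 2).mul_const ⟪hess f x u, u⟫)
      refine (h1.sub (((hasDerivAt_comp_line hf.contDiff x u t).sub h2).const_mul σ)).congr_deriv ?_
      simp; ring
    · intro t
      have h1 := ((hasDerivAt_pow 2 t).const_mul ζ3).div_const 2
      have h2 := ((hasDerivAt_id t).mul_const ⟪hess f x u, u⟫).const_add ⟪gradient f x, u⟫
      refine (h1.sub (((hasDerivAt_gradient_line hf.contDiff x u t).sub h2).const_mul σ)).congr_deriv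
        ?_
      simp; ring
    · intro t ht
      have := abs_le.1 (hdiff t ht)
      rcases hσ with rfl | rfl <;> linarith
  have h1 := key 1 (Or.inl rfl)
  have h2 := key (-1) (Or.inr rfl)
  rw [abs_le]
  constructor <;> linarith

end Line

/-! ### Ascent directions that are robust to model error -/

section Ascent

variable {d : ℕ} {f : EuclideanSpace ℝ (Fin d) → ℝ} {ζg ζh ζ3 ε : ℝ}

/-- The guaranteed improvement away from approximate local maxima. -/
noncomputable def gain (ζh ζ3 ε : ℝ) : ℝ := min (ε ^ 2 / (2 * ζh)) (ε * Real.sqrt (ε / ζ3))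

lemma gain_pos (hζh : 0 < ζh) (hζ3 : 0 < ζ3) (hε : 0 < ε) : 0 < gain ζh ζ3 ε := by
  unfold gain; positivity

/-- Cauchy–Schwarz for four terms gives the factor √4. The weights are at most one because the step
`α` is. -/
lemma sum_le_two_mul_of_sq_le {x a b c E : ℝ} (hE : 0 ≤ E)
    (h : x ^ 2 + a ^ 2 + b ^ 2 + c ^ 2 ≤ E ^ 2) {α : ℝ} (hα0 : 0 ≤ α) (hα : α ≤ 1) :
    |x| + |a| + α * |b| + α ^ 2 / 2 * |c| ≤ 2 * E := by
  rw [← sq_abs x, ← sq_abs a, ← sq_abs b, ← sq_abs c] at h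
  have hb : α * |b| ≤ |b| := mul_le_of_le_one_left (abs_nonneg _) hα
  have hc : α ^ 2 / 2 * |c| ≤ |c| := mul_le_of_le_one_left (abs_nonneg _) (by nlinarith)
  have : |x| + |a| + |b| + |c| ≤ 2 * E := by
    refine abs_le_of_sq_le_sq' ?_ (by positivity) |>.2
    nlinarith [sq_nonneg (|x| - |a|), sq_nonneg (|x| - |b|), sq_nonneg (|x| - |c|),
      sq_nonneg (|a| - |b|), sq_nonneg (|a| - |c|), sq_nonneg (|b| - |c|)]
  linarith

/-- At a point that is not an approximate local maximum of `f` there is a direction of ascent that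
also serves every smooth `g` which is close to `f` to second order at that point. -/
lemma exists_ascent (hζh : 0 < ζh) (hf : SmoothBounds f ζg ζh ζ3) (hε : 0 < ε)
    (hε1 : ε ≤ ζ3 / 16) {x : EuclideanSpace ℝ (Fin d)}
    (hx : x ∉ approxLocalMaxima f ε (6 * Real.sqrt (ζ3 * ε))) :
    ∃ u : EuclideanSpace ℝ (Fin d), ‖u‖ = 1 ∧ ∃ α : ℝ, ∀ g, SmoothBounds g ζg ζh ζ3 →
      ∀ y E : ℝ, 0 ≤ E →
        y ^ 2 + (g x - f x) ^ 2 + ⟪gradient g x - gradient f x, u⟫ ^ 2 +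
          ⟪(hess g x - hess f x) u, u⟫ ^ 2 ≤ E ^ 2 →
        f x + gain ζh ζ3 ε - (2 + ζg / ζh) * E ≤ g (x + α • u) - y := by
  have hζ3 : 0 < ζ3 := by linarith
  have hζg : 0 ≤ ζg := (norm_nonneg _).trans (hf.grad_le 0)
  by_cases hgrad : ‖gradient f x‖ ≤ ε
  · obtain ⟨μ, hμ, hμε⟩ : ∃ μ : ℝ, Module.End.HasEigenvalue
        (hess f x : EuclideanSpace ℝ (Fin d) →ₗ[ℝ] EuclideanSpace ℝ (Fin d)) μ ∧
        6 * Real.sqrt (ζ3 * ε) < μ := by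
      by_contra! hcon
      exact hx ⟨hgrad, fun μ hμ => hcon μ hμ⟩
    obtain ⟨w, hw⟩ := hμ.exists_hasEigenvector
    have hw0 : w ≠ 0 := hw.2
    have hww : hess f x w = μ • w := hw.apply_eq_smul
    obtain ⟨u, hu, huμ, hug⟩ : ∃ u : EuclideanSpace ℝ (Fin d), ‖u‖ = 1 ∧
        ⟪hess f x u, u⟫ = μ ∧ 0 ≤ ⟪gradient f x, u⟫ := by
      have h1 : ‖(‖w‖⁻¹ • w : EuclideanSpace ℝ (Fin d))‖ = 1 := norm_smul_inv_norm (𝕜 := ℝ) hw0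
      have h2 : hess f x (‖w‖⁻¹ • w) = μ • (‖w‖⁻¹ • w) := by
        rw [map_smul, hww, smul_comm]
      set u₀ : EuclideanSpace ℝ (Fin d) := ‖w‖⁻¹ • w
      have h3 : ⟪hess f x u₀, u₀⟫ = μ := by
        rw [h2, real_inner_smul_left, real_inner_self_eq_norm_sq, h1]; ring
      -- Reversing the eigenvector keeps the quadratic form, so the first-order term can be made
      -- nonnegative.
      rcases le_total 0 ⟪gradient f x, u₀⟫ with h | h
      · exact ⟨u₀, h1, h3, h⟩
      · exact ⟨-u₀, by rwa [norm_neg], by simpa using h3, by simpa using h⟩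
    set α : ℝ := Real.sqrt (ε / ζ3) with hα
    have hα0 : 0 ≤ α := Real.sqrt_nonneg _
    have hαsq : α ^ 2 = ε / ζ3 := Real.sq_sqrt (by positivity)
    have hα1 : α ≤ 1 := by
      refine Real.sqrt_le_iff.2 ⟨zero_le_one, ?_⟩
      rw [one_pow, div_le_one hζ3]; linarith
    have hs : Real.sqrt (ζ3 * ε) = ζ3 * α := by
      rw [Real.sqrt_eq_iff_mul_self_eq (by positivity) (by positivity)]
      have : ζ3 * α * (ζ3 * α) = ζ3 ^ 2 * α ^ 2 := by ring
      rw [this, hαsq]; field_simp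
    -- The threshold equals `6 * ζ3 * α`, so the second-order term gains at least `3 * ζ3 * α ^ 3`.
    -- The cubic remainder costs at most `ζ3 * α ^ 3 / 6`, and the required gain is at most `ε * α =
    -- ζ3 * α ^ 3`.
    refine ⟨u, hu, α, fun g hg y E hE hsq => ?_⟩
    have hT := (abs_le.1 (hg.cubic_bound x hu hα0)).1
    have hsum := sum_le_two_mul_of_sq_le hE hsq hα0 hα1
    rw [sub_apply, inner_sub_left, inner_sub_left, huμ] at hsum
    have h1 := neg_abs_le (g x - f x)
    have h2 := mul_le_mul_of_nonneg_left
      (neg_abs_le (⟪gradient g x, u⟫ - ⟪gradient f x, u⟫)) hα0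
    have h3 := mul_le_mul_of_nonneg_left
      (neg_abs_le (⟪hess g x u, u⟫ - μ)) (by positivity : 0 ≤ α ^ 2 / 2)
    have h4 := le_abs_self y
    have h5 : gain ζh ζ3 ε ≤ ε * α := min_le_right _ _
    have hε' : ε = ζ3 * α ^ 2 := by rw [hαsq]; field_simp
    have h6 : α ^ 2 / 2 * (6 * (ζ3 * α)) ≤ α ^ 2 / 2 * μ := by
      rw [← hs]; gcongr
    have h7 : 0 ≤ α * ⟪gradient f x, u⟫ := by positivity
    have h8 : 0 ≤ ζg / ζh * E := by positivity
    have h9 : 0 ≤ ζ3 * α ^ 3 := by positivity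
    have h10 : ε * α = ζ3 * α ^ 3 := by rw [hε']; ring
    nlinarith
  · push Not at hgrad
    have hn : 0 < ‖gradient f x‖ := hε.trans hgrad
    set G := ‖gradient f x‖ with hG
    have hu : ‖(G⁻¹ • gradient f x : EuclideanSpace ℝ (Fin d))‖ = 1 :=
      norm_smul_inv_norm (𝕜 := ℝ) (norm_pos_iff.1 hn)
    have hGu : ⟪gradient f x, G⁻¹ • gradient f x⟫ = G := by
      rw [real_inner_smul_right, real_inner_self_eq_norm_sq, ← hG]; field_simp
    set u : EuclideanSpace ℝ (Fin d) := G⁻¹ • gradient f x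
    -- The step `G / ζh` maximizes `t * G - ζh * t ^ 2 / 2`, with value `G ^ 2 / (2 * ζh)`. The
    -- error in the gradient is multiplied by this step, which is at most `ζg / ζh`; together with
    -- the two errors in value this gives the factor `2 + ζg / ζh`.
    refine ⟨u, hu, G / ζh, fun g hg y E hE hsq => ?_⟩
    have hα0 : 0 ≤ G / ζh := by positivity
    have hT := hg.quadratic_lower x u hα0
    have hEle : ∀ z : ℝ, z ^ 2 ≤ E ^ 2 → |z| ≤ E := fun z hz => abs_le_of_sq_le_sq hz hE
    have hy : |y| ≤ E := hEle y (by
      nlinarith [sq_nonneg (g x - f x), sq_nonneg ⟪gradient g x - gradient f x, u⟫,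
        sq_nonneg ⟪(hess g x - hess f x) u, u⟫])
    have h1 : |g x - f x| ≤ E := hEle _ (by
      nlinarith [sq_nonneg y, sq_nonneg ⟪gradient g x - gradient f x, u⟫,
        sq_nonneg ⟪(hess g x - hess f x) u, u⟫])
    have h2 : |⟪gradient g x - gradient f x, u⟫| ≤ E := hEle _ (by
      nlinarith [sq_nonneg y, sq_nonneg (g x - f x),
        sq_nonneg ⟪(hess g x - hess f x) u, u⟫])
    rw [inner_sub_left, hGu] at h2
    rw [hu] at hT
    have h3 : gain ζh ζ3 ε ≤ ε ^ 2 / (2 * ζh) := min_le_left _ _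
    have h4 : ε ^ 2 / (2 * ζh) ≤ G ^ 2 / (2 * ζh) := by gcongr
    have h5 : G / ζh * G - ζh * 1 ^ 2 * (G / ζh) ^ 2 / 2 = G ^ 2 / (2 * ζh) := by
      field_simp; ring
    have h6 : G / ζh * (G - E) ≤ G / ζh * ⟪gradient g x, u⟫ :=
      mul_le_mul_of_nonneg_left (by linarith [(abs_le.1 h2).1]) hα0
    have h7 : G / ζh * E ≤ ζg / ζh * E := by gcongr; exact hf.grad_le x
    have h8 := (abs_le.1 h1).1
    have h9 := (abs_le.1 hy).2
    linarith

/-- A function that is bounded above has approximate local maxima. -/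
lemma approxLocalMaxima_nonempty (hζh : 0 < ζh) (hf : SmoothBounds f ζg ζh ζ3) (hε : 0 < ε)
    (hε1 : ε ≤ ζ3 / 16) {C : ℝ} (hC : ∀ x, f x ≤ C) :
    (approxLocalMaxima f ε (6 * Real.sqrt (ζ3 * ε))).Nonempty := by
  by_contra hne
  rw [Set.not_nonempty_iff_eq_empty] at hne
  -- With `g = f` and no error, every point could be improved by the same amount, and iterating
  -- would exceed any bound.
  have hstep : ∀ x, ∃ y, f x + gain ζh ζ3 ε ≤ f y := by
    intro x
    obtain ⟨u, _, α, h⟩ := exists_ascent hζh hf hε hε1 (x := x) (by rw [hne]; simp)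
    exact ⟨x + α • u, by simpa using h f hf 0 0 le_rfl (by simp)⟩
  have hg := gain_pos hζh (by linarith : 0 < ζ3) hε
  have hN : ∀ n : ℕ, ∃ y, f 0 + n * gain ζh ζ3 ε ≤ f y := by
    intro n
    induction n with
    | zero => exact ⟨0, by simp⟩
    | succ n ih =>
      obtain ⟨y, hy⟩ := ih
      obtain ⟨z, hz⟩ := hstep y
      exact ⟨z, by push_cast; linarith⟩
  obtain ⟨n, hn⟩ := exists_nat_gt ((C - f 0) / gain ζh ζ3 ε)
  obtain ⟨y, hy⟩ := hN n
  rw [div_lt_iff₀ hg] at hn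
  linarith [hC y]

end Ascent

/-! ### Differences of integrals of weighted families -/

section Differences

variable {X : Type*} [MeasurableSpace X] {P : Measure X}

/-- A pointwise derivative of a jointly measurable function is jointly measurable. -/
lemma measurable_of_hasDerivAt {F F' : ℝ → X → ℝ} (hF : Measurable (Function.uncurry F))
    (hd : ∀ t x, HasDerivAt (fun t => F t x) (F' t x) t) : Measurable (Function.uncurry F') := by
  refine measurable_of_tendsto_metrizable
    (f := fun (n : ℕ) (z : ℝ × X) =>
      (1 / ((n : ℝ) + 1))⁻¹ * (F (z.1 + 1 / ((n : ℝ) + 1)) z.2 - F z.1 z.2)) (fun n => ?_) ?_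
  · have h1 : Measurable fun z : ℝ × X => F (z.1 + 1 / ((n : ℝ) + 1)) z.2 :=
      hF.comp ((measurable_fst.add_const _).prodMk measurable_snd)
    exact (h1.sub hF).const_mul _
  · rw [tendsto_pi_nhds]
    intro z
    have h1 := (hd z.1 z.2).tendsto_slope_zero_right
    have h2 : Filter.Tendsto (fun n : ℕ => 1 / ((n : ℝ) + 1)) Filter.atTop
        (nhdsWithin 0 (Set.Ioi 0)) :=
      tendsto_nhdsWithin_iff.2 ⟨tendsto_one_div_add_atTop_nhds_zero_nat,
        Filter.Eventually.of_forall fun n => by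
          simp only [Set.mem_Ioi]; positivity⟩
    exact h1.comp h2

/-- The fundamental theorem of calculus for each `x`, then Tonelli. An L¹ bound on the derivative at
each time suffices; no dominating function is needed. -/
lemma lintegral_enorm_sub_le [SFinite P] {G G' : ℝ → X → ℝ}
    (hG : Measurable (Function.uncurry G))
    (hd : ∀ t x, HasDerivAt (fun t => G t x) (G' t x) t)
    (hc : ∀ x, Continuous fun t => G' t x) {a b : ℝ} (hab : a ≤ b) {c : ℝ → ENNReal}
    (hbd : ∀ s, a ≤ s → s ≤ b → ∫⁻ x, ‖G' s x‖ₑ ∂P ≤ c s) :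
    ∫⁻ x, ‖G b x - G a x‖ₑ ∂P ≤ ∫⁻ s in Set.Ioc a b, c s := by
  have hm := measurable_of_hasDerivAt hG hd
  calc ∫⁻ x, ‖G b x - G a x‖ₑ ∂P ≤ ∫⁻ x, (∫⁻ s in Set.Ioc a b, ‖G' s x‖ₑ) ∂P := by
        refine lintegral_mono fun x => ?_
        rw [← intervalIntegral.integral_eq_sub_of_hasDerivAt (fun t _ => hd t x)
          ((hc x).intervalIntegrable a b), intervalIntegral.integral_of_le hab]
        exact enorm_integral_le_lintegral_enorm _
    _ = ∫⁻ s in Set.Ioc a b, ∫⁻ x, ‖G' s x‖ₑ ∂P := by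
        refine lintegral_lintegral_swap ?_
        have : Measurable fun z : X × ℝ => ‖Function.uncurry G' (z.2, z.1)‖ₑ :=
          (hm.comp measurable_swap).enorm
        exact this.aemeasurable
    _ ≤ ∫⁻ s in Set.Ioc a b, c s :=
        setLIntegral_mono' measurableSet_Ioc fun s hs => hbd s hs.1.le hs.2

lemma lintegral_enorm_sub_le_mul [SFinite P] {G G' : ℝ → X → ℝ}
    (hG : Measurable (Function.uncurry G))
    (hd : ∀ t x, HasDerivAt (fun t => G t x) (G' t x) t)
    (hc : ∀ x, Continuous fun t => G' t x) {a b : ℝ} (hab : a ≤ b) {c : ENNReal}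
    (hbd : ∀ s, a ≤ s → s ≤ b → ∫⁻ x, ‖G' s x‖ₑ ∂P ≤ c) :
    ∫⁻ x, ‖G b x - G a x‖ₑ ∂P ≤ ENNReal.ofReal (b - a) * c := by
  refine (lintegral_enorm_sub_le hG hd hc hab (c := fun _ => c) hbd).trans ?_
  simp [mul_comm]

/-- The even part `G t + G (-t)` has derivative `G' t - G' (-t)`, of L¹ norm at most `2 * t * c`;
integrating once more gives `t ^ 2 * c`. -/
lemma lintegral_enorm_second_difference_le [SFinite P] {G G' G'' : ℝ → X → ℝ}
    (hG : Measurable (Function.uncurry G))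
    (hd : ∀ t x, HasDerivAt (fun t => G t x) (G' t x) t)
    (hd' : ∀ t x, HasDerivAt (fun t => G' t x) (G'' t x) t)
    (hc : ∀ x, Continuous fun t => G'' t x) {t : ℝ} (ht : 0 ≤ t) {c : ENNReal}
    (hbd : ∀ s, |s| ≤ t → ∫⁻ x, ‖G'' s x‖ₑ ∂P ≤ c) :
    ∫⁻ x, ‖G t x - 2 * G 0 x + G (-t) x‖ₑ ∂P ≤ ENNReal.ofReal (t ^ 2) * c := by
  have hm := measurable_of_hasDerivAt hG hd
  have hc' : ∀ x, Continuous fun t => G' t x := fun x =>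
    continuous_iff_continuousAt.2 fun t => (hd' t x).continuousAt
  have h1 := lintegral_enorm_sub_le (P := P) (G := fun t x => G t x + G (-t) x)
    (G' := fun t x => G' t x - G' (-t) x)
    (hG.add (hG.comp (measurable_fst.neg.prodMk measurable_snd)))
    (fun t x => by
      have h2 := (hd (-t) x).comp t (hasDerivAt_neg t)
      exact ((hd t x).add h2).congr_deriv (by ring))
    (fun x => (hc' x).sub ((hc' x).comp continuous_neg)) ht
    (c := fun s => ENNReal.ofReal (2 * s) * c) ?_
  · calc _ = ∫⁻ x, ‖G t x + G (-t) x - (G 0 x + G (-0) x)‖ₑ ∂P := by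
          refine lintegral_congr fun x => ?_
          rw [neg_zero]; congr 1; ring
      _ ≤ _ := h1
      _ = ENNReal.ofReal (t ^ 2) * c := by
          have h3 : Measurable fun s : ℝ => ENNReal.ofReal (2 * s) := by fun_prop
          rw [lintegral_mul_const _ h3]
          congr 1
          rw [← ofReal_integral_eq_lintegral_ofReal]
          · rw [← intervalIntegral.integral_of_le ht, intervalIntegral.integral_const_mul,
              integral_id]
            congr 1; ring
          · exact (Continuous.integrableOn_Icc (by fun_prop)).mono_set Set.Ioc_subset_Icc_self
          · refine (ae_restrict_iff' measurableSet_Ioc).2 (Filter.Eventually.of_forall fun s hs => ?_)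
            have := hs.1
            simp only [Pi.zero_apply]; positivity
  · intro s hs hst
    have h2 := lintegral_enorm_sub_le_mul (P := P) hm hd' hc (a := -s) (b := s) (by linarith)
      (c := c) (fun r h1 h2 => hbd r (abs_le.2 ⟨by linarith, by linarith⟩))
    rwa [show s - -s = 2 * s by ring] at h2

/-- Cauchy–Schwarz for the measure with density `w`. -/
lemma lintegral_abs_mul_abs_le {a b : X → ℝ} (ha : Measurable a) (hb : Measurable b)
    {w : X → ENNReal} (hw : Measurable w) {α β : ℝ} (hα : 0 ≤ α) (hβ : 0 ≤ β)
    (h1 : ∫⁻ x, ENNReal.ofReal (a x ^ 2) * w x ∂P ≤ ENNReal.ofReal α)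
    (h2 : ∫⁻ x, ENNReal.ofReal (b x ^ 2) * w x ∂P ≤ ENNReal.ofReal β) :
    ∫⁻ x, ENNReal.ofReal (|a x| * |b x|) * w x ∂P ≤ ENNReal.ofReal (√α * √β) := by
  have hsq : ∀ r : ℝ, ENNReal.ofReal |r| ^ (2 : ℝ) = ENNReal.ofReal (r ^ 2) := by
    intro r
    rw [ENNReal.ofReal_rpow_of_nonneg (abs_nonneg _) (by norm_num)]
    norm_num
  have hconv : ∀ φ : X → ENNReal, Measurable φ →
      ∫⁻ x, φ x ∂(P.withDensity w) = ∫⁻ x, φ x * w x ∂P := by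
    intro φ hφ
    rw [lintegral_withDensity_eq_lintegral_mul _ hw hφ]
    simp [mul_comm]
  have hroot : ∀ r : ℝ, 0 ≤ r → ENNReal.ofReal r ^ (1 / (2 : ℝ)) = ENNReal.ofReal √r := by
    intro r hr
    rw [ENNReal.ofReal_rpow_of_nonneg hr (by norm_num), Real.sqrt_eq_rpow]
  rw [← hconv _ (by fun_prop)] at h1 h2 ⊢
  have h := ENNReal.lintegral_mul_le_Lp_mul_Lq (P.withDensity w) Real.HolderConjugate.two_two
    (f := fun x => ENNReal.ofReal |a x|) (g := fun x => ENNReal.ofReal |b x|)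
    (by fun_prop) (by fun_prop)
  simp only [hsq, Pi.mul_apply] at h
  calc _ = ∫⁻ x, ENNReal.ofReal |a x| * ENNReal.ofReal |b x| ∂(P.withDensity w) :=
        lintegral_congr fun x => ENNReal.ofReal_mul (abs_nonneg _)
    _ ≤ _ := h
    _ ≤ ENNReal.ofReal α ^ (1 / (2 : ℝ)) * ENNReal.ofReal β ^ (1 / (2 : ℝ)) := by gcongr
    _ = ENNReal.ofReal (√α * √β) := by
        rw [hroot α hα, hroot β hβ, ENNReal.ofReal_mul (Real.sqrt_nonneg _)]

/-- A family of functions `F t` weighted by densities `exp (l t)` with respect to `P`, with bounds on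
the derivatives in `t` in terms of a fixed function `D` and on the moments of the scores. -/
structure WeightedFamily (P : Measure X) (l l' l'' F F' F'' : ℝ → X → ℝ) (D : X → ℝ)
    (L₀ L₁ L₂ B G G4 K : ℝ) : Prop where
  measurable_l : Measurable (Function.uncurry l)
  measurable_F : Measurable (Function.uncurry F)
  measurable_D : Measurable D
  hasDerivAt_l : ∀ t x, HasDerivAt (fun t => l t x) (l' t x) t
  hasDerivAt_l' : ∀ t x, HasDerivAt (fun t => l' t x) (l'' t x) t
  continuous_l'' : ∀ x, Continuous fun t => l'' t x
  hasDerivAt_F : ∀ t x, HasDerivAt (fun t => F t x) (F' t x) t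
  hasDerivAt_F' : ∀ t x, HasDerivAt (fun t => F' t x) (F'' t x) t
  continuous_F'' : ∀ x, Continuous fun t => F'' t x
  l_zero : ∀ x, l 0 x = 0
  D_nonneg : ∀ x, 0 ≤ D x
  D_le : ∀ x, D x ≤ B
  F_le : ∀ t x, |F t x| ≤ L₀ * D x
  F'_le : ∀ t x, |F' t x| ≤ L₁ * D x
  F''_le : ∀ t x, |F'' t x| ≤ L₂ * D x
  L₀_nonneg : 0 ≤ L₀
  L₁_nonneg : 0 ≤ L₁
  L₂_nonneg : 0 ≤ L₂
  G_nonneg : 0 ≤ G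
  G4_nonneg : 0 ≤ G4
  K_nonneg : 0 ≤ K
  mass : ∀ t, ∫⁻ x, ENNReal.ofReal (Real.exp (l t x)) ∂P ≤ 1
  moment_two : ∀ t, ∫⁻ x, ENNReal.ofReal (l' t x ^ 2) * ENNReal.ofReal (Real.exp (l t x)) ∂P ≤
    ENNReal.ofReal G
  moment_four : ∀ t, ∫⁻ x, ENNReal.ofReal (l' t x ^ 4) * ENNReal.ofReal (Real.exp (l t x)) ∂P ≤
    ENNReal.ofReal G4
  moment_deriv : ∀ t, ∫⁻ x, ENNReal.ofReal (l'' t x ^ 2) * ENNReal.ofReal (Real.exp (l t x)) ∂P ≤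
    ENNReal.ofReal K

namespace WeightedFamily

variable {l l' l'' F F' F'' : ℝ → X → ℝ} {D : X → ℝ}
  {L₀ L₁ L₂ B G G4 K : ℝ}

section

variable (hW : WeightedFamily P l l' l'' F F' F'' D L₀ L₁ L₂ B G G4 K)

include hW

lemma measurable_l_apply (t : ℝ) : Measurable (l t) :=
  hW.measurable_l.comp measurable_prodMk_left

lemma measurable_l' : Measurable (Function.uncurry l') :=
  measurable_of_hasDerivAt hW.measurable_l hW.hasDerivAt_l

lemma measurable_l'_apply (t : ℝ) : Measurable (l' t) :=
  hW.measurable_l'.comp measurable_prodMk_left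

lemma measurable_l''_apply (t : ℝ) : Measurable (l'' t) :=
  (measurable_of_hasDerivAt hW.measurable_l' hW.hasDerivAt_l').comp measurable_prodMk_left

lemma measurable_weight (t : ℝ) : Measurable fun x => ENNReal.ofReal (Real.exp (l t x)) :=
  (Real.measurable_exp.comp (hW.measurable_l_apply t)).ennreal_ofReal

lemma hasDerivAt_exp (t : ℝ) (x : X) :
    HasDerivAt (fun t => Real.exp (l t x)) (Real.exp (l t x) * l' t x) t :=
  (hW.hasDerivAt_l t x).exp

lemma continuous_l (x : X) : Continuous fun t => l t x :=
  continuous_iff_continuousAt.2 fun t => (hW.hasDerivAt_l t x).continuousAt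

lemma continuous_l' (x : X) : Continuous fun t => l' t x :=
  continuous_iff_continuousAt.2 fun t => (hW.hasDerivAt_l' t x).continuousAt

lemma continuous_F (x : X) : Continuous fun t => F t x :=
  continuous_iff_continuousAt.2 fun t => (hW.hasDerivAt_F t x).continuousAt

lemma continuous_F' (x : X) : Continuous fun t => F' t x :=
  continuous_iff_continuousAt.2 fun t => (hW.hasDerivAt_F' t x).continuousAt

lemma integrable_sq [IsProbabilityMeasure P] : Integrable (fun x => D x ^ 2) P :=
  integrable_of_measurable_of_bound (hW.measurable_D.pow_const 2) (B ^ 2) fun x => by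
    rw [abs_of_nonneg (sq_nonneg _)]
    exact pow_le_pow_left₀ (hW.D_nonneg x) (hW.D_le x) 2

/-- The weighted second moment of `D` moves at rate at most `B ^ 2 * √G`, since the derivative of
the weight is the weight times the score. The crude bound `B` enters only through this term, which
disappears as `t` tends to zero. -/
lemma second_moment_le [IsProbabilityMeasure P] {s t : ℝ} (hs : |s| ≤ t) :
    ∫⁻ x, ENNReal.ofReal (D x ^ 2) * ENNReal.ofReal (Real.exp (l s x)) ∂P ≤
      ENNReal.ofReal (∫ x, D x ^ 2 ∂P + B ^ 2 * √G * t) := by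
  have ht : 0 ≤ t := (abs_nonneg s).trans hs
  have hder : ∀ r, ∫⁻ x, ‖D x ^ 2 * (Real.exp (l r x) * l' r x)‖ₑ ∂P ≤
      ENNReal.ofReal (B ^ 2 * √G) := by
    intro r
    have h1 := lintegral_abs_mul_abs_le (P := P) (a := l' r) (b := fun _ => 1)
      (hW.measurable_l'_apply r) measurable_const (hW.measurable_weight r) hW.G_nonneg zero_le_one
      (hW.moment_two r) (by simpa using hW.mass r)
    calc _ ≤ ∫⁻ x, ENNReal.ofReal (B ^ 2) *
          (ENNReal.ofReal (|l' r x| * |1|) * ENNReal.ofReal (Real.exp (l r x))) ∂P := by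
          refine lintegral_mono fun x => ?_
          rw [← ENNReal.ofReal_mul (by positivity), ← ENNReal.ofReal_mul (by positivity),
            Real.enorm_eq_ofReal_abs]
          refine ENNReal.ofReal_le_ofReal ?_
          rw [abs_mul, abs_mul, Real.abs_exp, abs_of_nonneg (sq_nonneg (D x)), abs_one, mul_one,
            mul_comm (Real.exp _)]
          gcongr
          · exact hW.D_nonneg x
          · exact hW.D_le x
      _ ≤ ENNReal.ofReal (B ^ 2) * ENNReal.ofReal (√G * √1) := by
          rw [lintegral_const_mul' _ _ ENNReal.ofReal_ne_top]
          gcongr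
      _ = _ := by rw [← ENNReal.ofReal_mul (by positivity), Real.sqrt_one, mul_one]
  have hmeas : Measurable (Function.uncurry fun (t : ℝ) (x : X) => D x ^ 2 * Real.exp (l t x)) :=
    ((hW.measurable_D.comp measurable_snd).pow_const 2).mul
      (Real.measurable_exp.comp hW.measurable_l)
  have hdiff : ∫⁻ x, ‖D x ^ 2 * Real.exp (l s x) - D x ^ 2‖ₑ ∂P ≤
      ENNReal.ofReal (B ^ 2 * √G * t) := by
    have key : ∀ a b : ℝ, a ≤ b → b - a ≤ t →
        ∫⁻ x, ‖D x ^ 2 * Real.exp (l b x) - D x ^ 2 * Real.exp (l a x)‖ₑ ∂P ≤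
          ENNReal.ofReal (B ^ 2 * √G * t) := by
      intro a b hab hbt
      have := lintegral_enorm_sub_le_mul (P := P) hmeas
        (fun t x => (hW.hasDerivAt_exp t x).const_mul (D x ^ 2))
        (fun x => continuous_const.mul ((Real.continuous_exp.comp (hW.continuous_l x)).mul
          (hW.continuous_l' x))) hab (fun r _ _ => hder r)
      refine this.trans ?_
      rw [← ENNReal.ofReal_mul (by linarith), mul_comm]
      gcongr
    rcases le_total 0 s with h | h
    · have := key 0 s h (by rw [abs_of_nonneg h] at hs; linarith)
      simpa [hW.l_zero] using this
    · have := key s 0 h (by rw [abs_of_nonpos h] at hs; linarith)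
      simp only [hW.l_zero, Real.exp_zero, mul_one] at this
      simpa only [enorm_sub_rev] using this
  rw [ENNReal.ofReal_add (integral_nonneg fun x => sq_nonneg _) (by positivity),
    ofReal_integral_eq_lintegral_ofReal hW.integrable_sq
      (Filter.Eventually.of_forall fun x => sq_nonneg _)]
  refine le_trans ?_ (add_le_add_right hdiff _)
  rw [← lintegral_add_left (hW.measurable_D.pow_const 2).ennreal_ofReal]
  refine lintegral_mono fun x => ?_
  rw [← ENNReal.ofReal_mul (sq_nonneg _), Real.enorm_eq_ofReal_abs,
    ← ENNReal.ofReal_add (sq_nonneg _) (abs_nonneg _)]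
  exact ENNReal.ofReal_le_ofReal (by linarith [le_abs_self (D x ^ 2 * Real.exp (l s x) - D x ^ 2)])

lemma lintegral_abs_mul_D_le [IsProbabilityMeasure P] {s t : ℝ} (hs : |s| ≤ t) {a : X → ℝ} (ha : Measurable a) {α : ℝ}
    (hα : 0 ≤ α)
    (h : ∫⁻ x, ENNReal.ofReal (a x ^ 2) * ENNReal.ofReal (Real.exp (l s x)) ∂P ≤ ENNReal.ofReal α) :
    ∫⁻ x, ENNReal.ofReal (|a x| * |D x|) * ENNReal.ofReal (Real.exp (l s x)) ∂P ≤
      ENNReal.ofReal (√α * √(∫ x, D x ^ 2 ∂P + B ^ 2 * √G * t)) :=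
  lintegral_abs_mul_abs_le ha hW.measurable_D (hW.measurable_weight s) hα
    (add_nonneg (integral_nonneg fun _ => sq_nonneg _)
      (mul_nonneg (by positivity) ((abs_nonneg s).trans hs))) h (hW.second_moment_le hs)

/-- Every term of the derivative of `exp l * F` is a score factor times a multiple of `D`, so
weighted Cauchy–Schwarz separates the score moment from the moment of `D`. -/
lemma lintegral_deriv_le [IsProbabilityMeasure P] {s t : ℝ} (hs : |s| ≤ t) :
    ∫⁻ x, ‖Real.exp (l s x) * (l' s x * F s x + F' s x)‖ₑ ∂P ≤
      ENNReal.ofReal ((L₀ * √G + L₁) * √(∫ x, D x ^ 2 ∂P + B ^ 2 * √G * t)) := by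
  have h1 := hW.lintegral_abs_mul_D_le hs (hW.measurable_l'_apply s) hW.G_nonneg (hW.moment_two s)
  have h2 := hW.lintegral_abs_mul_D_le hs (a := fun _ => 1) measurable_const zero_le_one
    (by simpa using hW.mass s)
  set R := √(∫ x, D x ^ 2 ∂P + B ^ 2 * √G * t)
  have hm : Measurable fun x => ENNReal.ofReal (|l' s x| * |D x|) *
      ENNReal.ofReal (Real.exp (l s x)) :=
    ((hW.measurable_l'_apply s).abs.mul hW.measurable_D.abs).ennreal_ofReal.mul
      (hW.measurable_weight s)
  calc _ ≤ ∫⁻ x, (ENNReal.ofReal L₀ * (ENNReal.ofReal (|l' s x| * |D x|) *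
          ENNReal.ofReal (Real.exp (l s x))) + ENNReal.ofReal L₁ *
          (ENNReal.ofReal (|1| * |D x|) * ENNReal.ofReal (Real.exp (l s x)))) ∂P := by
        refine lintegral_mono fun x => ?_
        have hL₀ := hW.L₀_nonneg
        have hL₁ := hW.L₁_nonneg
        rw [← ENNReal.ofReal_mul (by positivity), ← ENNReal.ofReal_mul (by positivity),
          ← ENNReal.ofReal_mul (by positivity), ← ENNReal.ofReal_mul (by positivity),
          ← ENNReal.ofReal_add (by positivity) (by positivity), Real.enorm_eq_ofReal_abs]
        refine ENNReal.ofReal_le_ofReal ?_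
        rw [abs_mul, Real.abs_exp, abs_one, one_mul, abs_of_nonneg (hW.D_nonneg x)]
        have h3 : |l' s x * F s x + F' s x| ≤ |l' s x| * (L₀ * D x) + L₁ * D x := by
          refine (abs_add_le _ _).trans (add_le_add ?_ (hW.F'_le s x))
          rw [abs_mul]
          gcongr
          exact hW.F_le s x
        calc _ ≤ Real.exp (l s x) * (|l' s x| * (L₀ * D x) + L₁ * D x) := by gcongr
          _ = _ := by ring
    _ ≤ ENNReal.ofReal L₀ * ENNReal.ofReal (√G * R) + ENNReal.ofReal L₁ *
        ENNReal.ofReal (√1 * R) := by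
        rw [lintegral_add_left (hm.const_mul _), lintegral_const_mul' _ _ ENNReal.ofReal_ne_top,
          lintegral_const_mul' _ _ ENNReal.ofReal_ne_top]
        gcongr
    _ = _ := by
        have hL₀ := hW.L₀_nonneg
        have hL₁ := hW.L₁_nonneg
        rw [← ENNReal.ofReal_mul hL₀, ← ENNReal.ofReal_mul hL₁,
          ← ENNReal.ofReal_add (by positivity) (by positivity), Real.sqrt_one]
        congr 1; ring

/-- The same pairing for the second derivative. The square of the score calls for the fourth moment,
and the cross term `2 * l' * F'` explains the factor 2 before `L₁`. -/
lemma lintegral_deriv2_le [IsProbabilityMeasure P] {s t : ℝ} (hs : |s| ≤ t) :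
    ∫⁻ x, ‖Real.exp (l s x) *
        ((l' s x ^ 2 + l'' s x) * F s x + 2 * l' s x * F' s x + F'' s x)‖ₑ ∂P ≤
      ENNReal.ofReal ((L₀ * √K + L₀ * √G4 + 2 * L₁ * √G + L₂) *
        √(∫ x, D x ^ 2 ∂P + B ^ 2 * √G * t)) := by
  have h1 := hW.lintegral_abs_mul_D_le hs (hW.measurable_l'_apply s) hW.G_nonneg (hW.moment_two s)
  have h2 := hW.lintegral_abs_mul_D_le hs (a := fun _ => 1) measurable_const zero_le_one
    (by simpa using hW.mass s)
  have h3 := hW.lintegral_abs_mul_D_le hs (hW.measurable_l''_apply s) hW.K_nonneg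
    (hW.moment_deriv s)
  have h4 := hW.lintegral_abs_mul_D_le hs ((hW.measurable_l'_apply s).pow_const 2) hW.G4_nonneg
    (by simpa only [← pow_mul] using hW.moment_four s)
  set R := √(∫ x, D x ^ 2 ∂P + B ^ 2 * √G * t)
  have hm : ∀ a : X → ℝ, Measurable a → Measurable fun x => ENNReal.ofReal (|a x| * |D x|) *
      ENNReal.ofReal (Real.exp (l s x)) := fun a ha =>
    (ha.abs.mul hW.measurable_D.abs).ennreal_ofReal.mul (hW.measurable_weight s)
  have hL₀ := hW.L₀_nonneg
  have hL₁ := hW.L₁_nonneg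
  have hL₂ := hW.L₂_nonneg
  calc _ ≤ ∫⁻ x, (ENNReal.ofReal L₀ * (ENNReal.ofReal (|l'' s x| * |D x|) *
          ENNReal.ofReal (Real.exp (l s x))) + (ENNReal.ofReal L₀ *
          (ENNReal.ofReal (|l' s x ^ 2| * |D x|) * ENNReal.ofReal (Real.exp (l s x))) +
          (ENNReal.ofReal (2 * L₁) * (ENNReal.ofReal (|l' s x| * |D x|) *
          ENNReal.ofReal (Real.exp (l s x))) + ENNReal.ofReal L₂ *
          (ENNReal.ofReal (|1| * |D x|) * ENNReal.ofReal (Real.exp (l s x)))))) ∂P := by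
        refine lintegral_mono fun x => ?_
        simp only [← ENNReal.ofReal_mul (mul_nonneg (abs_nonneg _) (abs_nonneg (D x))),
          ← ENNReal.ofReal_mul hL₀, ← ENNReal.ofReal_mul (mul_nonneg zero_le_two hL₁),
          ← ENNReal.ofReal_mul hL₂]
        rw [← ENNReal.ofReal_add (by positivity) (by positivity),
          ← ENNReal.ofReal_add (by positivity) (by positivity),
          ← ENNReal.ofReal_add (by positivity) (by positivity), Real.enorm_eq_ofReal_abs]
        refine ENNReal.ofReal_le_ofReal ?_
        rw [abs_mul, Real.abs_exp, abs_one, one_mul, abs_of_nonneg (hW.D_nonneg x)]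
        have h5 : |(l' s x ^ 2 + l'' s x) * F s x + 2 * l' s x * F' s x + F'' s x| ≤
            (|l' s x ^ 2| + |l'' s x|) * (L₀ * D x) + 2 * |l' s x| * (L₁ * D x) + L₂ * D x := by
          refine (abs_add_le _ _).trans (add_le_add ((abs_add_le _ _).trans
            (add_le_add ?_ ?_)) (hW.F''_le s x))
          · rw [abs_mul]
            exact mul_le_mul (abs_add_le _ _) (hW.F_le s x) (abs_nonneg _) (by positivity)
          · rw [abs_mul, abs_mul, abs_two]
            exact mul_le_mul_of_nonneg_left (hW.F'_le s x) (by positivity)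
        calc _ ≤ Real.exp (l s x) * ((|l' s x ^ 2| + |l'' s x|) * (L₀ * D x) +
              2 * |l' s x| * (L₁ * D x) + L₂ * D x) := by gcongr
          _ = _ := by ring
    _ ≤ ENNReal.ofReal L₀ * ENNReal.ofReal (√K * R) + (ENNReal.ofReal L₀ *
        ENNReal.ofReal (√G4 * R) + (ENNReal.ofReal (2 * L₁) * ENNReal.ofReal (√G * R) +
        ENNReal.ofReal L₂ * ENNReal.ofReal (√1 * R))) := by
        rw [lintegral_add_left ((hm _ (hW.measurable_l''_apply s)).const_mul _),
          lintegral_add_left ((hm _ ((hW.measurable_l'_apply s).pow_const 2)).const_mul _),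
          lintegral_add_left ((hm _ (hW.measurable_l'_apply s)).const_mul _),
          lintegral_const_mul' _ _ ENNReal.ofReal_ne_top,
          lintegral_const_mul' _ _ ENNReal.ofReal_ne_top,
          lintegral_const_mul' _ _ ENNReal.ofReal_ne_top,
          lintegral_const_mul' _ _ ENNReal.ofReal_ne_top]
        gcongr
    _ = _ := by
        rw [← ENNReal.ofReal_mul hL₀, ← ENNReal.ofReal_mul hL₂, ← ENNReal.ofReal_mul hL₀,
          ← ENNReal.ofReal_mul (by positivity),
          ← ENNReal.ofReal_add (by positivity) (by positivity),
          ← ENNReal.ofReal_add (by positivity) (by positivity),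
          ← ENNReal.ofReal_add (by positivity) (by positivity), Real.sqrt_one]
        congr 1; ring

lemma hasDerivAt_prod (t : ℝ) (x : X) :
    HasDerivAt (fun t => Real.exp (l t x) * F t x)
      (Real.exp (l t x) * (l' t x * F t x + F' t x)) t :=
  ((hW.hasDerivAt_exp t x).mul (hW.hasDerivAt_F t x)).congr_deriv (by ring)

lemma hasDerivAt_prod' (t : ℝ) (x : X) :
    HasDerivAt (fun t => Real.exp (l t x) * (l' t x * F t x + F' t x))
      (Real.exp (l t x) * ((l' t x ^ 2 + l'' t x) * F t x + 2 * l' t x * F' t x + F'' t x)) t :=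
  ((hW.hasDerivAt_exp t x).mul (((hW.hasDerivAt_l' t x).mul (hW.hasDerivAt_F t x)).add
    (hW.hasDerivAt_F' t x))).congr_deriv (by simp only [Pi.add_apply, Pi.mul_apply]; ring)

lemma measurable_prod : Measurable (Function.uncurry fun (t : ℝ) (x : X) =>
    Real.exp (l t x) * F t x) :=
  (Real.measurable_exp.comp hW.measurable_l).mul hW.measurable_F

lemma integrable_prod (t : ℝ) : Integrable (fun x => Real.exp (l t x) * F t x) P := by
  have h1 : Integrable (fun x => Real.exp (l t x)) P := by
    refine ⟨(Real.measurable_exp.comp (hW.measurable_l_apply t)).aestronglyMeasurable, ?_⟩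
    rw [hasFiniteIntegral_iff_ofReal (Filter.Eventually.of_forall fun x => (Real.exp_pos _).le)]
    exact (hW.mass t).trans_lt ENNReal.one_lt_top
  have h2 : Measurable (F t) := hW.measurable_F.comp measurable_prodMk_left
  refine h1.mul_bdd (c := L₀ * B) h2.aestronglyMeasurable
    (Filter.Eventually.of_forall fun x => ?_)
  exact (hW.F_le t x).trans (mul_le_mul_of_nonneg_left (hW.D_le x) hW.L₀_nonneg)

lemma abs_integral_le [IsProbabilityMeasure P] : |∫ x, F 0 x ∂P| ≤ L₀ * √(∫ x, D x ^ 2 ∂P) := by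
  have h := lintegral_abs_mul_abs_le (P := P) (a := fun _ => 1) (b := D) (w := fun _ => 1)
    measurable_const hW.measurable_D measurable_const zero_le_one
    (integral_nonneg fun _ => sq_nonneg _) (by simp)
    (by simp only [mul_one]
        exact (ofReal_integral_eq_lintegral_ofReal hW.integrable_sq
          (Filter.Eventually.of_forall fun x => sq_nonneg _)).ge)
  have h2 : ∫⁻ x, ‖F 0 x‖ₑ ∂P ≤ ENNReal.ofReal (L₀ * √(∫ x, D x ^ 2 ∂P)) := by
    calc _ ≤ ∫⁻ x, ENNReal.ofReal L₀ * (ENNReal.ofReal (|1| * |D x|) * 1) ∂P := by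
          refine lintegral_mono fun x => ?_
          rw [mul_one, ← ENNReal.ofReal_mul hW.L₀_nonneg, Real.enorm_eq_ofReal_abs, abs_one,
            one_mul, abs_of_nonneg (hW.D_nonneg x)]
          exact ENNReal.ofReal_le_ofReal (hW.F_le 0 x)
      _ ≤ _ := by
          rw [lintegral_const_mul' _ _ ENNReal.ofReal_ne_top, ENNReal.ofReal_mul hW.L₀_nonneg]
          gcongr
          simpa using h
  have h3 := (enorm_integral_le_lintegral_enorm (μ := P) (F 0)).trans h2
  rw [Real.enorm_eq_ofReal_abs] at h3
  exact (ENNReal.ofReal_le_ofReal_iff (mul_nonneg hW.L₀_nonneg (Real.sqrt_nonneg _))).1 h3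

/-- The factor that multiplies `t` is continuous in `t`, and its value at zero involves only the
moment of `D` under `P` itself. -/
lemma abs_integral_sub_le [IsProbabilityMeasure P] {t : ℝ} (ht : 0 ≤ t) :
    |∫ x, Real.exp (l t x) * F t x ∂P - ∫ x, Real.exp (l 0 x) * F 0 x ∂P| ≤
      t * ((L₀ * √G + L₁) * √(∫ x, D x ^ 2 ∂P + B ^ 2 * √G * t)) := by
  have hL₀ := hW.L₀_nonneg
  have hL₁ := hW.L₁_nonneg
  have h := lintegral_enorm_sub_le_mul (P := P) hW.measurable_prod hW.hasDerivAt_prod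
    (fun x => continuous_iff_continuousAt.2 fun t => (hW.hasDerivAt_prod' t x).continuousAt) ht
    (fun s h1 h2 => hW.lintegral_deriv_le (abs_le.2 ⟨by linarith, h2⟩))
  rw [sub_zero, ← ENNReal.ofReal_mul ht] at h
  rw [← integral_sub (hW.integrable_prod t) (hW.integrable_prod 0)]
  have h3 := (enorm_integral_le_lintegral_enorm (μ := P) _).trans h
  rw [Real.enorm_eq_ofReal_abs] at h3
  exact (ENNReal.ofReal_le_ofReal_iff (by positivity)).1 h3

lemma abs_integral_second_difference_le [IsProbabilityMeasure P] {t : ℝ} (ht : 0 ≤ t) :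
    |∫ x, Real.exp (l t x) * F t x ∂P - 2 * ∫ x, Real.exp (l 0 x) * F 0 x ∂P +
        ∫ x, Real.exp (l (-t) x) * F (-t) x ∂P| ≤
      t ^ 2 * ((L₀ * √K + L₀ * √G4 + 2 * L₁ * √G + L₂) *
        √(∫ x, D x ^ 2 ∂P + B ^ 2 * √G * t)) := by
  have hL₀ := hW.L₀_nonneg
  have hL₁ := hW.L₁_nonneg
  have hL₂ := hW.L₂_nonneg
  have h := lintegral_enorm_second_difference_le (P := P) hW.measurable_prod hW.hasDerivAt_prod
    hW.hasDerivAt_prod' (fun x => (Real.continuous_exp.comp (hW.continuous_l x)).mul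
      ((((((hW.continuous_l' x).pow 2).add (hW.continuous_l'' x)).mul (hW.continuous_F x)).add
        ((continuous_const.mul (hW.continuous_l' x)).mul (hW.continuous_F' x))).add
          (hW.continuous_F'' x))) ht
    (fun s h1 => hW.lintegral_deriv2_le h1)
  rw [← ENNReal.ofReal_mul (by positivity)] at h
  have h2 : Integrable (fun x => Real.exp (l t x) * F t x - 2 * (Real.exp (l 0 x) * F 0 x)) P :=
    (hW.integrable_prod t).sub ((hW.integrable_prod 0).const_mul 2)
  rw [← integral_const_mul, ← integral_sub (hW.integrable_prod t)
    ((hW.integrable_prod 0).const_mul 2), ← integral_add h2 (hW.integrable_prod (-t))]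
  have h3 := (enorm_integral_le_lintegral_enorm (μ := P) _).trans h
  rw [Real.enorm_eq_ofReal_abs] at h3
  exact (ENNReal.ofReal_le_ofReal_iff (by positivity)).1 h3

end

end WeightedFamily

end Differences

/-! ### Likelihood ratios along a line and moments of the score -/

lemma even_pow_sum_le {ι : Type*} (J : Finset ι) (φ : ι → ℝ) {p : ℕ} (hp : Even (p + 1)) :
    (∑ j ∈ J, φ j) ^ (p + 1) ≤ (J.card : ℝ) ^ p * ∑ j ∈ J, φ j ^ (p + 1) := by
  rcases J.eq_empty_or_nonempty with rfl | hJ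
  · simp
  · have h2 := pow_sum_div_card_le_sum_pow (s := J) (f := fun j => |φ j|)
      (fun _ _ => abs_nonneg _) p
    have hc : (0 : ℝ) < (J.card : ℝ) ^ p := by
      have : 0 < J.card := hJ.card_pos
      positivity
    rw [div_le_iff₀ hc] at h2
    simp only [hp.pow_abs] at h2
    calc (∑ j ∈ J, φ j) ^ (p + 1) = |∑ j ∈ J, φ j| ^ (p + 1) := (hp.pow_abs _).symm
      _ ≤ (∑ j ∈ J, |φ j|) ^ (p + 1) := by
          gcongr; exact Finset.abs_sum_le_sum_abs _ _
      _ ≤ _ := by linarith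

namespace Problem

variable {m : ℕ} {S : Set (EuclideanSpace ℝ (Fin m))} {A : Type*} [MeasurableSpace A]
  {d : ℕ} {Θ : Type*} [MeasurableSpace Θ] (M : Problem S A d Θ)

/-- The indices of the first `n` steps of an episode. -/
def firstSteps (n : ℕ) : Finset (Fin M.H) := Finset.univ.filter fun j => (j : ℕ) < n

lemma card_firstSteps {n : ℕ} (hn : n ≤ M.H) : (M.firstSteps n).card = n := by
  rw [firstSteps, Fin.card_filter_val_lt, min_eq_right hn]

/-- The log-likelihood ratio of the first `n` actions, for the policy parameters `ψ` and `ψ₀`. -/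
noncomputable def logRatio (ψ₀ ψ : EuclideanSpace ℝ (Fin d)) (n : ℕ) (τ : M.Traj) : ℝ :=
  ∑ j ∈ M.firstSteps n,
    (Real.log (M.dens ψ (τ j).1 (τ j).2) - Real.log (M.dens ψ₀ (τ j).1 (τ j).2))

lemma ratio_eq (ψ₀ ψ : EuclideanSpace ℝ (Fin d)) (n : ℕ) (τ : M.Traj) :
    M.ratio ψ₀ ψ n τ = ENNReal.ofReal (Real.exp (M.logRatio ψ₀ ψ n τ)) := by
  rw [ratio, logRatio, Real.exp_sum, ENNReal.ofReal_prod_of_nonneg fun _ _ => (Real.exp_pos _).le,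
    ← Finset.prod_filter]
  refine Finset.prod_congr rfl fun j _ => ?_
  rw [Real.exp_sub, Real.exp_log (M.dens_pos _ _ _), Real.exp_log (M.dens_pos _ _ _)]

lemma measurable_logRatio_line (ψ u : EuclideanSpace ℝ (Fin d)) (n : ℕ) :
    Measurable (Function.uncurry fun (t : ℝ) (τ : M.Traj) => M.logRatio ψ (ψ + t • u) n τ) := by
  change Measurable fun z : ℝ × M.Traj => ∑ j ∈ M.firstSteps n,
    (Real.log (M.dens (ψ + z.1 • u) (z.2 j).1 (z.2 j).2) -
      Real.log (M.dens ψ (z.2 j).1 (z.2 j).2))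
  refine Finset.measurable_sum _ fun j _ => ?_
  have hj : Measurable fun z : ℝ × M.Traj => z.2 j := (measurable_pi_apply j).comp measurable_snd
  have hl : Measurable fun z : ℝ × M.Traj => ψ + z.1 • u := by fun_prop
  exact (Real.measurable_log.comp (M.measurable_dens_comp hl hj)).sub
    (Real.measurable_log.comp (M.measurable_dens_comp measurable_const hj))

lemma lintegral_trajLaw_change_exp (θ : Θ) (ψ₀ ψ : EuclideanSpace ℝ (Fin d)) (n : ℕ)
    {F : M.Traj → ENNReal} (hF : Measurable F)
    (hn : ∀ τ τ', (∀ j ∈ M.firstSteps n, τ j = τ' j) → F τ = F τ') :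
    ∫⁻ τ, F τ * ENNReal.ofReal (Real.exp (M.logRatio ψ₀ ψ n τ)) ∂M.trajLaw θ ψ₀ =
      ∫⁻ τ, F τ ∂M.trajLaw θ ψ := by
  rw [M.lintegral_trajLaw_change θ ψ₀ ψ n hF fun τ τ' h => hn τ τ' fun j hj =>
    h j (by simpa [firstSteps] using hj)]
  simp only [ratio_eq]

/-- The identity for nonnegative functions, applied to the positive and the negative part. -/
lemma integral_trajLaw_change_exp (θ : Θ) (ψ₀ ψ : EuclideanSpace ℝ (Fin d)) (n : ℕ)
    {F : M.Traj → ℝ} (hF : Measurable F) {C : ℝ} (hC : ∀ τ, |F τ| ≤ C)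
    (hn : ∀ τ τ', (∀ j ∈ M.firstSteps n, τ j = τ' j) → F τ = F τ') :
    ∫ τ, Real.exp (M.logRatio ψ₀ ψ n τ) * F τ ∂M.trajLaw θ ψ₀ = ∫ τ, F τ ∂M.trajLaw θ ψ := by
  have hml : Measurable fun τ => M.logRatio ψ₀ ψ n τ := by
    -- The parameter `ψ` is the point at time 1 of the line from `ψ₀` in direction `ψ - ψ₀`.
    have h := (M.measurable_logRatio_line ψ₀ (ψ - ψ₀) n).comp
      (measurable_prodMk_left (x := (1 : ℝ)))
    simpa [Function.comp_def, Function.uncurry] using h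
  have hexp : Integrable (fun τ => Real.exp (M.logRatio ψ₀ ψ n τ)) (M.trajLaw θ ψ₀) := by
    refine ⟨(Real.measurable_exp.comp hml).aestronglyMeasurable, ?_⟩
    rw [hasFiniteIntegral_iff_ofReal (Filter.Eventually.of_forall fun x => (Real.exp_pos _).le)]
    have := M.lintegral_trajLaw_change_exp θ ψ₀ ψ n (F := fun _ => 1) measurable_const
      (fun _ _ _ => rfl)
    simp only [one_mul, lintegral_const, measure_univ] at this
    rw [this]
    exact ENNReal.one_lt_top
  have hneg : Measurable fun τ => ENNReal.ofReal (-F τ) := hF.neg.ennreal_ofReal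
  rw [integral_eq_lintegral_pos_part_sub_lintegral_neg_part
      (hexp.mul_bdd hF.aestronglyMeasurable (Filter.Eventually.of_forall hC)),
    integral_eq_lintegral_pos_part_sub_lintegral_neg_part
      (integrable_of_measurable_of_bound hF C hC),
    ← M.lintegral_trajLaw_change_exp θ ψ₀ ψ n hF.ennreal_ofReal
      (fun τ τ' h => by rw [hn τ τ' h]),
    ← M.lintegral_trajLaw_change_exp θ ψ₀ ψ n hneg
      (fun τ τ' h => by rw [hn τ τ' h])]
  congr 2
  · refine lintegral_congr fun τ => ?_
    rw [mul_comm, ENNReal.ofReal_mul' (Real.exp_pos _).le]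
  · refine lintegral_congr fun τ => ?_
    rw [mul_comm, ← ENNReal.ofReal_mul' (Real.exp_pos _).le, neg_mul]

/-- Moments of sums of functions of the first state-action pairs. -/
lemma lintegral_sum_pow_le (θ : Θ) (ψ : EuclideanSpace ℝ (Fin d)) {n : ℕ} (hn : n ≤ M.H)
    {p : ℕ} (hp : Even (p + 1)) {φ : S × A → ℝ} (hφ : Measurable φ) {c : ℝ}
    (hc : ∀ s, ∫⁻ a, ENNReal.ofReal (φ (s, a) ^ (p + 1)) ∂M.policy ψ s ≤ ENNReal.ofReal c) :
    ∫⁻ τ, ENNReal.ofReal ((∑ j ∈ M.firstSteps n, φ (τ j)) ^ (p + 1)) ∂M.trajLaw θ ψ ≤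
      ENNReal.ofReal ((n : ℝ) ^ (p + 1) * c) := by
  have hm : ∀ j : Fin M.H, Measurable fun τ : M.Traj => ENNReal.ofReal (φ (τ j) ^ (p + 1)) :=
    fun j => ((hφ.comp (measurable_pi_apply j)).pow_const _).ennreal_ofReal
  calc _ ≤ ∫⁻ τ, ENNReal.ofReal ((n : ℝ) ^ p) *
        ∑ j ∈ M.firstSteps n, ENNReal.ofReal (φ (τ j) ^ (p + 1)) ∂M.trajLaw θ ψ := by
        refine lintegral_mono fun τ => ?_
        rw [← ENNReal.ofReal_sum_of_nonneg fun j _ => hp.pow_nonneg _,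
          ← ENNReal.ofReal_mul (by positivity)]
        refine ENNReal.ofReal_le_ofReal ?_
        -- The power mean inequality contributes `n ^ p` and the sum over `n` steps one more factor.
        -- No independence of the steps is used.
        have := even_pow_sum_le (M.firstSteps n) (fun j => φ (τ j)) hp
        rwa [M.card_firstSteps hn] at this
    _ = ENNReal.ofReal ((n : ℝ) ^ p) * ∑ j ∈ M.firstSteps n,
          ∫⁻ τ, ENNReal.ofReal (φ (τ j) ^ (p + 1)) ∂M.trajLaw θ ψ := by
        rw [lintegral_const_mul' _ _ ENNReal.ofReal_ne_top, lintegral_finsetSum _ fun j _ => hm j]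
    _ ≤ ENNReal.ofReal ((n : ℝ) ^ p) * ∑ j ∈ M.firstSteps n, ENNReal.ofReal c := by
        gcongr with j _
        exact M.lintegral_trajLaw_coord_le θ ψ (hφ.pow_const _).ennreal_ofReal hc j
    _ = _ := by
        rw [Finset.sum_const, M.card_firstSteps hn, nsmul_eq_mul, ← ENNReal.ofReal_natCast,
          ← ENNReal.ofReal_mul (by positivity), ← ENNReal.ofReal_mul (by positivity)]
        congr 1; ring

section Line

variable {χg χf χh : ℝ} (hpol : M.PolicyRegular χg χf χh) (ψ u : EuclideanSpace ℝ (Fin d))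

lemma measurable_logDens_line :
    Measurable (Function.uncurry fun (t : ℝ) (x : S × A) =>
      Real.log (M.dens (ψ + t • u) x.1 x.2)) := by
  have hl : Measurable fun z : ℝ × (S × A) => ψ + z.1 • u := by fun_prop
  exact Real.measurable_log.comp (M.measurable_dens_comp hl measurable_snd)

include hpol

lemma hasDerivAt_logDens_line (t : ℝ) (x : S × A) :
    HasDerivAt (fun t : ℝ => Real.log (M.dens (ψ + t • u) x.1 x.2))
      ⟪M.score (ψ + t • u) x.1 x.2, u⟫ t :=
  hasDerivAt_comp_line (f := fun ψ => Real.log (M.dens ψ x.1 x.2)) (hpol.contDiff x.1 x.2) ψ u t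

lemma hasDerivAt_score_line (t : ℝ) (x : S × A) :
    HasDerivAt (fun t : ℝ => ⟪M.score (ψ + t • u) x.1 x.2, u⟫)
      ⟪M.scoreHess (ψ + t • u) x.1 x.2 u, u⟫ t :=
  hasDerivAt_gradient_line (f := fun ψ => Real.log (M.dens ψ x.1 x.2)) (hpol.contDiff x.1 x.2) ψ u t

lemma measurable_score_line :
    Measurable (Function.uncurry fun (t : ℝ) (x : S × A) =>
      ⟪M.score (ψ + t • u) x.1 x.2, u⟫) :=
  measurable_of_hasDerivAt (M.measurable_logDens_line ψ u) (M.hasDerivAt_logDens_line hpol ψ u)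

lemma measurable_scoreHess_line :
    Measurable (Function.uncurry fun (t : ℝ) (x : S × A) =>
      ⟪M.scoreHess (ψ + t • u) x.1 x.2 u, u⟫) :=
  measurable_of_hasDerivAt (M.measurable_score_line hpol ψ u) (M.hasDerivAt_score_line hpol ψ u)

variable {u}

/-- The signs follow from the moment bounds at a single state and unit vector. For `d = 0` there is
no unit vector and nothing can be concluded. -/
lemma PolicyRegular.nonneg (hu : ‖u‖ = 1) : 0 ≤ χg ∧ 0 ≤ χf ∧ 0 ≤ χh := by
  obtain ⟨s⟩ : Nonempty S := nonempty_of_isProbabilityMeasure M.μ₁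
  exact ⟨(integral_nonneg fun _ => by positivity).trans (hpol.second_moment 0 s u hu).2,
    (integral_nonneg fun _ => by positivity).trans (hpol.fourth_moment 0 s u hu).2,
    (integral_nonneg fun _ => by positivity).trans (hpol.hess_moment 0 s u hu).2⟩

lemma lintegral_score_sq_le (hu : ‖u‖ = 1) (s : S) :
    ∫⁻ a, ENNReal.ofReal (⟪M.score ψ s a, u⟫ ^ 2) ∂M.policy ψ s ≤ ENNReal.ofReal χg := by
  obtain ⟨h1, h2⟩ := hpol.second_moment ψ s u hu
  rw [← ofReal_integral_eq_lintegral_ofReal h1 (Filter.Eventually.of_forall fun _ => by positivity)]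
  exact ENNReal.ofReal_le_ofReal h2

lemma lintegral_score_pow_four_le (hu : ‖u‖ = 1) (s : S) :
    ∫⁻ a, ENNReal.ofReal (⟪M.score ψ s a, u⟫ ^ 4) ∂M.policy ψ s ≤ ENNReal.ofReal χf := by
  obtain ⟨h1, h2⟩ := hpol.fourth_moment ψ s u hu
  rw [← ofReal_integral_eq_lintegral_ofReal h1 (Filter.Eventually.of_forall fun _ => by positivity)]
  exact ENNReal.ofReal_le_ofReal h2

lemma lintegral_scoreHess_sq_le (hu : ‖u‖ = 1) (s : S) :
    ∫⁻ a, ENNReal.ofReal (⟪M.scoreHess ψ s a u, u⟫ ^ 2) ∂M.policy ψ s ≤ ENNReal.ofReal χh := by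
  obtain ⟨h1, h2⟩ := hpol.hess_moment ψ s u hu
  refine le_trans (lintegral_mono fun a => ENNReal.ofReal_le_ofReal ?_) (le_trans
    (ofReal_integral_eq_lintegral_ofReal h1
      (Filter.Eventually.of_forall fun _ => by positivity)).ge (ENNReal.ofReal_le_ofReal h2))
  rw [← sq_abs]
  gcongr
  simpa [hu] using abs_real_inner_le_norm (M.scoreHess ψ s a u) u

end Line

end Problem

/-! ### Value gaps under a fixed trajectory law -/

namespace Problem

variable {m : ℕ} {S : Set (EuclideanSpace ℝ (Fin m))} {A : Type*} [MeasurableSpace A]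
  {d : ℕ} {Θ : Type*} [MeasurableSpace Θ] (M : Problem S A d Θ)

open Classical in
/-- The restriction of a function of the `i`-th state-action pair of a trajectory to the trajectories
whose `i`-th state belongs to the `i`-th stage. -/
noncomputable def onStage (i : Fin M.H) (φ : S × A → ℝ) (τ : M.Traj) : ℝ :=
  if (τ i).1 ∈ M.stage i then φ (τ i) else 0

variable {M} in
lemma onStage_of_mem {i : Fin M.H} {φ : S × A → ℝ} {τ : M.Traj} (h : (τ i).1 ∈ M.stage i) :
    M.onStage i φ τ = φ (τ i) := if_pos h

variable {M} in
lemma onStage_of_notMem {i : Fin M.H} {φ : S × A → ℝ} {τ : M.Traj} (h : (τ i).1 ∉ M.stage i) :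
    M.onStage i φ τ = 0 := if_neg h

lemma measurable_onStage {γ : Type*} [MeasurableSpace γ] (i : Fin M.H) {φ : γ → S × A → ℝ}
    {τ : γ → M.Traj} (hτ : Measurable τ) (hφ : Measurable fun z => φ z (τ z i)) :
    Measurable fun z => M.onStage i (φ z) (τ z) := by
  classical
  refine Measurable.ite ?_ hφ measurable_const
  exact ((measurable_pi_apply i).comp hτ).fst (M.measurableSet_stage i)

/-- The one-step prediction error of the dynamics `θ`. -/
noncomputable def dynGap (θs θ : Θ) (x : S × A) : ℝ :=
  ‖(M.dyn θ x.1 x.2 : EuclideanSpace ℝ (Fin m)) - M.dyn θs x.1 x.2‖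

lemma measurable_dynGap_comp {γ : Type*} [MeasurableSpace γ] {f g : γ → Θ} {h : γ → S × A}
    (hf : Measurable f) (hg : Measurable g) (hh : Measurable h) :
    Measurable fun z => M.dynGap (f z) (g z) (h z) :=
  ((measurable_subtype_coe.comp (M.measurable_dyn_comp hg hh)).sub
    (measurable_subtype_coe.comp (M.measurable_dyn_comp hf hh))).norm

section

variable {χg χf χh L₀ L₁ L₂ B : ℝ}

/-- The gradient in the policy parameter of a one-step value gap. -/
noncomputable def gapGrad (θs θ : Θ) (ψ : EuclideanSpace ℝ (Fin d)) (h : ℕ) (x : S × A) :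
    EuclideanSpace ℝ (Fin d) :=
  gradient (fun ψ' => M.value θ ψ' h (M.dyn θ x.1 x.2)) ψ -
    gradient (fun ψ' => M.value θ ψ' h (M.dyn θs x.1 x.2)) ψ

/-- The Hessian in the policy parameter of a one-step value gap. -/
noncomputable def gapHess (θs θ : Θ) (ψ : EuclideanSpace ℝ (Fin d)) (h : ℕ) (x : S × A) :
    EuclideanSpace ℝ (Fin d) →L[ℝ] EuclideanSpace ℝ (Fin d) :=
  hess (fun ψ' => M.value θ ψ' h (M.dyn θ x.1 x.2)) ψ -
    hess (fun ψ' => M.value θ ψ' h (M.dyn θs x.1 x.2)) ψ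

/-- The expected one-step value gaps, as integrals with respect to a fixed law of trajectories,
satisfy the hypotheses of the bounds on differences. -/
lemma weightedFamily (hpol : M.PolicyRegular χg χf χh) (hval : M.ValueLipschitz L₀ L₁ L₂)
    (θs θ : Θ) (hB : ∀ h < M.H, ∀ s ∈ M.stage h, ∀ a, M.dynGap θs θ (s, a) ≤ B)
    (ψ : EuclideanSpace ℝ (Fin d)) {u : EuclideanSpace ℝ (Fin d)} (hu : ‖u‖ = 1)
    (i : Fin M.H) (hi : (i : ℕ) + 1 < M.H) :
    WeightedFamily (M.trajLaw θs ψ)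
      (fun t τ => M.logRatio ψ (ψ + t • u) (i + 1) τ)
      (fun t τ => ∑ j ∈ M.firstSteps (i + 1), ⟪M.score (ψ + t • u) (τ j).1 (τ j).2, u⟫)
      (fun t τ => ∑ j ∈ M.firstSteps (i + 1), ⟪M.scoreHess (ψ + t • u) (τ j).1 (τ j).2 u, u⟫)
      (fun t => M.onStage i (M.valueGap θs θ (ψ + t • u) (M.H - (i + 1))))
      (fun t => M.onStage i fun x => ⟪M.gapGrad θs θ (ψ + t • u) (i + 1) x, u⟫)
      (fun t => M.onStage i fun x => ⟪M.gapHess θs θ (ψ + t • u) (i + 1) x u, u⟫)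
      (M.onStage i (M.dynGap θs θ))
      |L₀| |L₁| |L₂| (max B 0) (((i : ℕ) + 1 : ℝ) ^ 2 * χg) (((i : ℕ) + 1 : ℝ) ^ 4 * χf)
      (((i : ℕ) + 1 : ℝ) ^ 2 * χh) := by
  obtain ⟨hχg, hχf, hχh⟩ := hpol.nonneg M hu
  have hn : (i : ℕ) + 1 ≤ M.H := hi.le
  have hcast : (((i : ℕ) + 1 : ℕ) : ℝ) = ((i : ℕ) + 1 : ℝ) := by push_cast; rfl
  have hcoord : ∀ j : Fin M.H, Measurable fun z : ℝ × M.Traj => z.2 j := fun j =>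
    (measurable_pi_apply j).comp measurable_snd
  have hline : Measurable fun z : ℝ × M.Traj => ψ + z.1 • u := by fun_prop
  have hmem : ∀ θ' (x : S × A), x.1 ∈ M.stage i → M.dyn θ' x.1 x.2 ∈ M.stage (i + 1) :=
    fun θ' x hx => M.dyn_mem_stage θ' i hi x.1 hx x.2
  have hscore : ∀ t, Measurable fun x : S × A => ⟪M.score (ψ + t • u) x.1 x.2, u⟫ := fun t =>
    (M.measurable_score_line hpol ψ u).of_uncurry_left (x := t)
  have hscoreHess : ∀ t, Measurable fun x : S × A => ⟪M.scoreHess (ψ + t • u) x.1 x.2 u, u⟫ :=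
    fun t => (M.measurable_scoreHess_line hpol ψ u).of_uncurry_left (x := t)
  have hsum : ∀ φ : S × A → ℝ, Measurable φ → ∀ p : ℕ, Measurable fun τ : M.Traj =>
      ENNReal.ofReal ((∑ j ∈ M.firstSteps (i + 1), φ (τ j)) ^ p) := fun φ hφ p =>
    ((Finset.measurable_sum _ fun j _ => hφ.comp (measurable_pi_apply j)).pow_const p
      : Measurable fun τ : M.Traj => (∑ j ∈ M.firstSteps (i + 1), φ (τ j)) ^ p).ennreal_ofReal
  have hprefix : ∀ (φ : S × A → ℝ) (p : ℕ) (τ τ' : M.Traj),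
      (∀ j ∈ M.firstSteps (i + 1), τ j = τ' j) →
      ENNReal.ofReal ((∑ j ∈ M.firstSteps (i + 1), φ (τ j)) ^ p) =
        ENNReal.ofReal ((∑ j ∈ M.firstSteps (i + 1), φ (τ' j)) ^ p) := by
    intro φ p τ τ' h
    have hs : ∑ j ∈ M.firstSteps (i + 1), φ (τ j) = ∑ j ∈ M.firstSteps (i + 1), φ (τ' j) :=
      Finset.sum_congr rfl fun j hj => by rw [h j hj]
    rw [hs]
  -- The absolute values of the Lipschitz constants and `max B 0` provide nonnegativity that the
  -- hypotheses do not state.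
  refine ⟨M.measurable_logRatio_line ψ u _, ?_, ?_, fun t τ => ?_, fun t τ => ?_, fun τ => ?_,
    fun t τ => ?_, fun t τ => ?_, fun τ => ?_, fun τ => ?_, fun τ => ?_, fun τ => ?_,
    fun t τ => ?_, fun t τ => ?_, fun t τ => ?_, abs_nonneg _, abs_nonneg _, abs_nonneg _,
    by positivity, by positivity, by positivity, fun t => ?_, fun t => ?_, fun t => ?_,
    fun t => ?_⟩
  · exact M.measurable_onStage i measurable_snd
      (φ := fun z : ℝ × M.Traj => M.valueGap θs θ (ψ + z.1 • u) (M.H - (i + 1)))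
      (M.measurable_valueGap_comp θs θ _ hline (hcoord i))
  · exact M.measurable_onStage i measurable_id (φ := fun _ : M.Traj => M.dynGap θs θ)
      (M.measurable_dynGap_comp measurable_const measurable_const (measurable_pi_apply i))
  · exact HasDerivAt.fun_sum fun j _ =>
      (M.hasDerivAt_logDens_line hpol ψ u t (τ j)).sub_const _
  · exact HasDerivAt.fun_sum fun j _ => M.hasDerivAt_score_line hpol ψ u t (τ j)
  · exact continuous_finsetSum _ fun j _ =>
      continuous_hess_line (f := fun ψ => Real.log (M.dens ψ (τ j).1 (τ j).2))
        (hpol.contDiff _ _) ψ u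
  -- Regularity of the values is known only on the stages; elsewhere the truncated gap vanishes
  -- identically and has derivative zero.
  · by_cases h : (τ i).1 ∈ M.stage i
    · simp only [onStage_of_mem h, gapGrad, inner_sub_left]
      exact (hasDerivAt_comp_line (hval.contDiff θ _ hi _ (hmem θ _ h)) ψ u t).sub
        (hasDerivAt_comp_line (hval.contDiff θ _ hi _ (hmem θs _ h)) ψ u t)
    · simp only [onStage_of_notMem h]
      exact hasDerivAt_const _ _
  · by_cases h : (τ i).1 ∈ M.stage i
    · simp only [onStage_of_mem h, gapGrad, gapHess, inner_sub_left, sub_apply]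
      exact (hasDerivAt_gradient_line (hval.contDiff θ _ hi _ (hmem θ _ h)) ψ u t).sub
        (hasDerivAt_gradient_line (hval.contDiff θ _ hi _ (hmem θs _ h)) ψ u t)
    · simp only [onStage_of_notMem h]
      exact hasDerivAt_const _ _
  · by_cases h : (τ i).1 ∈ M.stage i
    · simp only [onStage_of_mem h, gapHess, inner_sub_left, sub_apply]
      exact (continuous_hess_line (hval.contDiff θ _ hi _ (hmem θ _ h)) ψ u).sub
        (continuous_hess_line (hval.contDiff θ _ hi _ (hmem θs _ h)) ψ u)
    · simp only [onStage_of_notMem h]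
      exact continuous_const
  · simp [logRatio]
  · by_cases h : (τ i).1 ∈ M.stage i
    · rw [onStage_of_mem h]; exact norm_nonneg _
    · rw [onStage_of_notMem h]
  · by_cases h : (τ i).1 ∈ M.stage i
    · rw [onStage_of_mem h]; exact (hB i i.2 _ h _).trans (le_max_left _ _)
    · rw [onStage_of_notMem h]; exact le_max_right _ _
  · by_cases h : (τ i).1 ∈ M.stage i
    · rw [onStage_of_mem h, onStage_of_mem h]
      refine (hval.value_lip θ _ _ hi _ (hmem θ _ h) _ (hmem θs _ h)).trans ?_
      exact mul_le_mul_of_nonneg_right (le_abs_self _) (norm_nonneg _)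
    · rw [onStage_of_notMem h, onStage_of_notMem h]; simp
  · by_cases h : (τ i).1 ∈ M.stage i
    · rw [onStage_of_mem h, onStage_of_mem h]
      refine (abs_real_inner_le_norm _ _).trans ?_
      rw [hu, mul_one]
      refine (hval.grad_lip θ _ _ hi _ (hmem θ _ h) _ (hmem θs _ h)).trans ?_
      exact mul_le_mul_of_nonneg_right (le_abs_self _) (norm_nonneg _)
    · rw [onStage_of_notMem h, onStage_of_notMem h]; simp
  · by_cases h : (τ i).1 ∈ M.stage i
    · rw [onStage_of_mem h, onStage_of_mem h]
      refine (abs_inner_apply_le _ _).trans ?_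
      rw [hu, one_pow, mul_one]
      refine (hval.hess_lip θ _ _ hi _ (hmem θ _ h) _ (hmem θs _ h)).trans ?_
      exact mul_le_mul_of_nonneg_right (le_abs_self _) (norm_nonneg _)
    · rw [onStage_of_notMem h, onStage_of_notMem h]; simp
  · have h := M.lintegral_trajLaw_change_exp θs ψ (ψ + t • u) (i + 1) (F := fun _ => 1)
      measurable_const (fun _ _ _ => rfl)
    simp only [one_mul, lintegral_const, measure_univ] at h
    exact h.le
  -- The weight turns the law for `ψ` into the law for `ψ + t • u`, which is the policy whose score
  -- is integrated.
  · rw [M.lintegral_trajLaw_change_exp θs ψ (ψ + t • u) (i + 1) (hsum _ (hscore t) 2)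
      (hprefix (fun x => ⟪M.score (ψ + t • u) x.1 x.2, u⟫) 2), ← hcast]
    exact M.lintegral_sum_pow_le θs _ hn (p := 1) (by decide) (hscore t)
      (M.lintegral_score_sq_le hpol _ hu)
  · rw [M.lintegral_trajLaw_change_exp θs ψ (ψ + t • u) (i + 1) (hsum _ (hscore t) 4)
      (hprefix (fun x => ⟪M.score (ψ + t • u) x.1 x.2, u⟫) 4), ← hcast]
    exact M.lintegral_sum_pow_le θs _ hn (p := 3) (by decide) (hscore t)
      (M.lintegral_score_pow_four_le hpol _ hu)
  · rw [M.lintegral_trajLaw_change_exp θs ψ (ψ + t • u) (i + 1) (hsum _ (hscoreHess t) 2)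
      (hprefix (fun x => ⟪M.scoreHess (ψ + t • u) x.1 x.2 u, u⟫) 2), ← hcast]
    exact M.lintegral_sum_pow_le θs _ hn (p := 1) (by decide) (hscoreHess t)
      (M.lintegral_scoreHess_sq_le hpol _ hu)

/-- The law on the right no longer depends on `ψ`. Reweighting the first `i + 1` actions is enough,
because the gap reads only the `i`-th pair; truncation to the stage is free because trajectories
stay in the stages almost surely. -/
lemma integral_valueGap_eq (θs θ : Θ) (ψ₀ ψ : EuclideanSpace ℝ (Fin d)) (i : Fin M.H) :
    ∫ τ, M.valueGap θs θ ψ (M.H - (i + 1)) (τ i) ∂M.trajLaw θs ψ =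
      ∫ τ, Real.exp (M.logRatio ψ₀ ψ (i + 1) τ) *
        M.onStage i (M.valueGap θs θ ψ (M.H - (i + 1))) τ ∂M.trajLaw θs ψ₀ := by
  rw [M.integral_trajLaw_change_exp θs ψ₀ ψ (i + 1) (C := 2 * (M.H - (i + 1) : ℕ))]
  · refine integral_congr_ae ?_
    filter_upwards [M.ae_trajLaw_mem_stage θs ψ] with τ hτ
    rw [onStage_of_mem (hτ i)]
  · exact M.measurable_onStage i measurable_id
      (φ := fun _ : M.Traj => M.valueGap θs θ ψ (M.H - (i + 1)))
      (M.measurable_valueGap_comp θs θ _ measurable_const (measurable_pi_apply i))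
  · intro τ
    by_cases h : (τ i).1 ∈ M.stage i
    · rw [onStage_of_mem h]; exact M.abs_valueGap_le _ _ _ _ _
    · rw [onStage_of_notMem h, abs_zero]; positivity
  · intro τ τ' h
    have : τ i = τ' i := h i (by simp [firstSteps])
    unfold onStage
    rw [this]

end

end Problem

/-! ### From differences to derivatives, and sums over steps -/

section Limits

/-- First and second derivatives along a line from bounds on differences. -/
lemma abs_le_of_difference_bounds {f₀ d₁ d₂ ζ : ℝ} {f : ℝ → ℝ} {b₁ b₂ : ℝ → ℝ}
    (hb₁ : Continuous b₁) (hb₂ : Continuous b₂)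
    (hT : ∀ t, 0 ≤ t → |f t - (f₀ + t * d₁ + t ^ 2 / 2 * d₂)| ≤ ζ * t ^ 3)
    (hT' : ∀ t, 0 ≤ t → |f (-t) - (f₀ - t * d₁ + t ^ 2 / 2 * d₂)| ≤ ζ * t ^ 3)
    (h₁ : ∀ t, 0 ≤ t → |f t - f₀| ≤ t * b₁ t)
    (h₂ : ∀ t, 0 ≤ t → |f t - 2 * f₀ + f (-t)| ≤ t ^ 2 * b₂ t) :
    |d₁| ≤ b₁ 0 ∧ |d₂| ≤ b₂ 0 := by
  -- After division by `t` or `t ^ 2`, the Taylor remainders become terms that vanish at zero, and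
  -- continuity leaves `b₁ 0` and `b₂ 0`.
  have hlim : ∀ (c : ℝ) (g : ℝ → ℝ), Continuous g → (∀ t, 0 < t → c ≤ g t) → c ≤ g 0 := by
    intro c g hg h
    refine ge_of_tendsto (hg.continuousWithinAt (s := Set.Ioi 0) (x := 0)) ?_
    exact Filter.eventually_of_mem self_mem_nhdsWithin h
  constructor
  · have := hlim |d₁| (fun t => b₁ t + (t / 2 * |d₂| + ζ * t ^ 2)) (by fun_prop) fun t ht => ?_
    · simpa using this
    · refine le_of_mul_le_mul_left ?_ ht
      have e1 := hT t ht.le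
      have e2 := h₁ t ht.le
      have e3 : t * |d₁| = |t * d₁| := by rw [abs_mul, abs_of_pos ht]
      have e4 : t ^ 2 / 2 * |d₂| = |t ^ 2 / 2 * d₂| := by
        rw [abs_mul, abs_of_nonneg (by positivity : 0 ≤ t ^ 2 / 2)]
      have e5 : t * (b₁ t + (t / 2 * |d₂| + ζ * t ^ 2)) =
        t * b₁ t + t ^ 2 / 2 * |d₂| + ζ * t ^ 3 := by ring
      rw [e5, e3, e4]
      have e6 := abs_le.1 e1
      have e7 := abs_le.1 e2
      have e8 := abs_le.1 (le_refl |t ^ 2 / 2 * d₂|)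
      rw [abs_le]
      constructor <;> linarith
  · have := hlim |d₂| (fun t => b₂ t + 2 * ζ * t) (by fun_prop) fun t ht => ?_
    · simpa using this
    · have ht2 : 0 < t ^ 2 := by positivity
      refine le_of_mul_le_mul_left ?_ ht2
      have e1 := abs_le.1 (hT t ht.le)
      have e2 := abs_le.1 (hT' t ht.le)
      have e3 := abs_le.1 (h₂ t ht.le)
      have e4 : t ^ 2 * |d₂| = |t ^ 2 * d₂| := by
        rw [abs_mul, abs_of_nonneg ht2.le]
      have e5 : t ^ 2 * (b₂ t + 2 * ζ * t) = t ^ 2 * b₂ t + 2 * (ζ * t ^ 3) := by ring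
      rw [e4, e5, abs_le]
      constructor <;> linarith

/-- The last step must be left out: with it the bound fails for `H = 1`. The factor 1/2 is needed to
reach the coefficient 8 before the product of `χg` and `L₁ ^ 2` in `c₁`. -/
lemma sum_fin_sq_le (H : ℕ) :
    ∑ i ∈ Finset.univ.filter (fun i : Fin H => (i : ℕ) + 1 < H),
      (((i : ℕ) : ℝ) + 1) ^ 2 ≤ (H : ℝ) ^ 3 / 2 := by
  rw [Finset.sum_filter,
    Fin.sum_univ_eq_sum_range (fun i : ℕ => if i + 1 < H then ((i : ℝ) + 1) ^ 2 else (0 : ℝ)) H]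
  rcases H with _ | N
  · simp
  have h : ∀ N : ℕ, ∑ i ∈ Finset.range N, ((i : ℝ) + 1) ^ 2 = (N : ℝ) * (N + 1) * (2 * N + 1) / 6 := by
    intro N
    induction N with
    | zero => simp
    | succ n ih => rw [Finset.sum_range_succ, ih]; push_cast; ring
  rw [Finset.sum_range_succ, Finset.sum_congr rfl fun i hi => by
    rw [if_pos (by simpa using hi : i + 1 < N + 1)], h, if_neg (lt_irrefl _)]
  push_cast
  have hN : (0 : ℝ) ≤ N := Nat.cast_nonneg N
  nlinarith [mul_nonneg hN hN, mul_nonneg hN (mul_nonneg hN hN)]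

/-- Cauchy–Schwarz over the steps, which collects the one-step errors into the total expected loss.
-/
lemma sq_sum_mul_sqrt_le {ι : Type*} (I : Finset ι) {c e : ι → ℝ} (he : ∀ i ∈ I, 0 ≤ e i)
    {x C E : ℝ} (hx : |x| ≤ ∑ i ∈ I, c i * √(e i)) (hC : ∑ i ∈ I, c i ^ 2 ≤ C)
    (hE : ∑ i ∈ I, e i ≤ E) : x ^ 2 ≤ C * E := by
  have h0 : 0 ≤ ∑ i ∈ I, c i ^ 2 := Finset.sum_nonneg fun _ _ => sq_nonneg _
  have h1 : 0 ≤ ∑ i ∈ I, e i := Finset.sum_nonneg he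
  calc x ^ 2 = |x| ^ 2 := (sq_abs x).symm
    _ ≤ (∑ i ∈ I, c i * √(e i)) ^ 2 := by gcongr
    _ ≤ (∑ i ∈ I, c i ^ 2) * ∑ i ∈ I, √(e i) ^ 2 := Finset.sum_mul_sq_le_sq_mul_sq _ _ _
    _ = (∑ i ∈ I, c i ^ 2) * ∑ i ∈ I, e i := by
        rw [Finset.sum_congr rfl fun i hi => Real.sq_sqrt (he i hi)]
    _ ≤ C * E := mul_le_mul hC hE h1 (h0.trans hC)

end Limits

/-! ### Second-order model error in terms of the prediction loss -/

namespace Problem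

variable {m : ℕ} {S : Set (EuclideanSpace ℝ (Fin m))} {A : Type*} [MeasurableSpace A]
  {d : ℕ} {Θ : Type*} [MeasurableSpace Θ] (M : Problem S A d Θ)

/-- The expected total squared prediction error of the dynamics `θ` along a true trajectory. -/
noncomputable def expErr (θs θ : Θ) (ψ : EuclideanSpace ℝ (Fin d)) : ℝ :=
  ∫ τ, ∑ i, M.dynGap θs θ (τ i) ^ 2 ∂M.trajLaw θs ψ

variable {B : ℝ}

lemma dynGap_nonneg (θs θ : Θ) (x : S × A) : 0 ≤ M.dynGap θs θ x := norm_nonneg _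

lemma ae_dynGap_le {θs θ : Θ} (hB : ∀ h < M.H, ∀ s ∈ M.stage h, ∀ a, M.dynGap θs θ (s, a) ≤ B)
    (ψ : EuclideanSpace ℝ (Fin d)) :
    ∀ᵐ τ ∂M.trajLaw θs ψ, ∀ i, M.dynGap θs θ (τ i) ≤ B := by
  filter_upwards [M.ae_trajLaw_mem_stage θs ψ] with τ hτ i
  exact hB i i.2 _ (hτ i) _

lemma integrable_dynGap_sq {θs θ : Θ}
    (hB : ∀ h < M.H, ∀ s ∈ M.stage h, ∀ a, M.dynGap θs θ (s, a) ≤ B)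
    (ψ : EuclideanSpace ℝ (Fin d)) (i : Fin M.H) :
    Integrable (fun τ => M.dynGap θs θ (τ i) ^ 2) (M.trajLaw θs ψ) := by
  refine Integrable.of_bound ((M.measurable_dynGap_comp measurable_const measurable_const
    (measurable_pi_apply i)).pow_const 2).aestronglyMeasurable (B ^ 2) ?_
  filter_upwards [M.ae_dynGap_le hB ψ] with τ hτ
  rw [Real.norm_eq_abs, abs_of_nonneg (sq_nonneg _)]
  exact pow_le_pow_left₀ (M.dynGap_nonneg _ _ _) (hτ i) 2

lemma sum_onStage_le_expErr {θs θ : Θ}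
    (hB : ∀ h < M.H, ∀ s ∈ M.stage h, ∀ a, M.dynGap θs θ (s, a) ≤ B)
    (ψ : EuclideanSpace ℝ (Fin d)) (I : Finset (Fin M.H)) :
    ∑ i ∈ I, ∫ τ, M.onStage i (M.dynGap θs θ) τ ^ 2 ∂M.trajLaw θs ψ ≤ M.expErr θs θ ψ := by
  rw [expErr, integral_finsetSum _ fun i _ => M.integrable_dynGap_sq hB ψ i]
  calc _ = ∑ i ∈ I, ∫ τ, M.dynGap θs θ (τ i) ^ 2 ∂M.trajLaw θs ψ := by
        refine Finset.sum_congr rfl fun i _ => integral_congr_ae ?_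
        filter_upwards [M.ae_trajLaw_mem_stage θs ψ] with τ hτ
        rw [onStage_of_mem (hτ i)]
    _ ≤ _ := Finset.sum_le_sum_of_subset_of_nonneg (Finset.subset_univ _) fun i _ _ =>
        integral_nonneg fun _ => sq_nonneg _

/-- The steps that are followed by another step. -/
def innerSteps : Finset (Fin M.H) := Finset.univ.filter fun i => (i : ℕ) + 1 < M.H

lemma valueToGo_zero (θ : Θ) (ψ : EuclideanSpace ℝ (Fin d)) (s : S) : M.valueToGo θ ψ 0 s = 0 := by
  simp [valueToGo]

/-- After the final step there is no value left, so its gap is zero. The remaining steps are those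
whose successor is a genuine step, where the Lipschitz hypotheses apply. -/
lemma ret_sub_eq (θs θ : Θ) (ψ₀ ψ : EuclideanSpace ℝ (Fin d)) :
    M.ret θ ψ - M.ret θs ψ = ∑ i ∈ M.innerSteps,
      ∫ τ, Real.exp (M.logRatio ψ₀ ψ (i + 1) τ) *
        M.onStage i (M.valueGap θs θ ψ (M.H - (i + 1))) τ ∂M.trajLaw θs ψ₀ := by
  rw [M.ret_sub, innerSteps, Finset.sum_filter]
  refine Finset.sum_congr rfl fun i _ => ?_
  split_ifs with h
  · exact M.integral_valueGap_eq θs θ ψ₀ ψ i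
  · have h0 : M.H - ((i : ℕ) + 1) = 0 := by omega
    have h1 : ∀ x, M.valueGap θs θ ψ (M.H - (i + 1)) x = 0 := fun x => by
      rw [valueGap, h0, valueToGo_zero, valueToGo_zero, sub_self]
    simp [h1]

variable {χg χf χh L₀ L₁ L₂ ζg ζh ζ3 : ℝ}

/-- The weighted-family bounds are summed over the steps and passed to the limit `t → 0`; the
smoothness of the return supplies the Taylor expansion that identifies the limits as derivatives. -/
lemma ret_error_bounds (hpol : M.PolicyRegular χg χf χh) (hval : M.ValueLipschitz L₀ L₁ L₂)
    (hsmooth : ∀ θ, SmoothBounds (M.ret θ) ζg ζh ζ3) {θs θ : Θ}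
    (hB : ∀ h < M.H, ∀ s ∈ M.stage h, ∀ a, M.dynGap θs θ (s, a) ≤ B)
    (ψ : EuclideanSpace ℝ (Fin d)) {u : EuclideanSpace ℝ (Fin d)} (hu : ‖u‖ = 1) :
    (M.ret θ ψ - M.ret θs ψ) ^ 2 ≤ M.H * L₀ ^ 2 * M.expErr θs θ ψ ∧
    ⟪gradient (M.ret θ) ψ - gradient (M.ret θs) ψ, u⟫ ^ 2 ≤
      (2 * M.H ^ 3 * χg * L₀ ^ 2 + 2 * M.H * L₁ ^ 2) * M.expErr θs θ ψ ∧
    ⟪(hess (M.ret θ) ψ - hess (M.ret θs) ψ) u, u⟫ ^ 2 ≤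
      (4 * M.H ^ 3 * χh * L₀ ^ 2 + 4 * M.H ^ 5 * χf * L₀ ^ 2 + 8 * M.H ^ 3 * χg * L₁ ^ 2 +
        4 * M.H * L₂ ^ 2) * M.expErr θs θ ψ := by
  obtain ⟨hχg, hχf, hχh⟩ := hpol.nonneg M hu
  have hW := fun (i : Fin M.H) (hi : i ∈ M.innerSteps) =>
    M.weightedFamily hpol hval θs θ hB ψ hu i (by simpa [innerSteps] using hi)
  set I := M.innerSteps with hI
  set P := M.trajLaw θs ψ with hP
  set e : Fin M.H → ℝ := fun i => ∫ τ, M.onStage i (M.dynGap θs θ) τ ^ 2 ∂P with he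
  have he0 : ∀ i ∈ I, 0 ≤ e i := fun i _ => integral_nonneg fun _ => sq_nonneg _
  have hE : ∑ i ∈ I, e i ≤ M.expErr θs θ ψ := M.sum_onStage_le_expErr hB ψ I
  have hcard : (I.card : ℝ) ≤ M.H := by
    exact_mod_cast (Finset.card_le_univ I).trans (by simp)
  have hsq : ∑ i ∈ I, (((i : ℕ) : ℝ) + 1) ^ 2 ≤ (M.H : ℝ) ^ 3 / 2 := sum_fin_sq_le M.H
  have hnle : ∀ i : Fin M.H, ((i : ℕ) : ℝ) + 1 ≤ M.H := fun i => by exact_mod_cast i.2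
  have hsq4 : ∑ i ∈ I, (((i : ℕ) : ℝ) + 1) ^ 4 ≤ (M.H : ℝ) ^ 5 := by
    calc ∑ i ∈ I, (((i : ℕ) : ℝ) + 1) ^ 4 ≤ ∑ _i ∈ I, (M.H : ℝ) ^ 4 :=
          Finset.sum_le_sum fun i _ => pow_le_pow_left₀ (by positivity) (hnle i) 4
      _ = I.card * (M.H : ℝ) ^ 4 := by simp
      _ ≤ M.H * (M.H : ℝ) ^ 4 := by gcongr
      _ = _ := by ring
  set J : ℝ → Fin M.H → ℝ := fun t i => ∫ τ, Real.exp (M.logRatio ψ (ψ + t • u) (i + 1) τ) *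
    M.onStage i (M.valueGap θs θ (ψ + t • u) (M.H - (i + 1))) τ ∂P with hJ
  set f : ℝ → ℝ := fun t => M.ret θ (ψ + t • u) - M.ret θs (ψ + t • u) with hf
  have hfJ : ∀ t, f t = ∑ i ∈ I, J t i := fun t => M.ret_sub_eq θs θ ψ (ψ + t • u)
  have hf0 : f 0 = M.ret θ ψ - M.ret θs ψ := by simp [hf]
  have hJ0 : ∀ i ∈ I, |J 0 i| ≤ |L₀| * √(e i) := by
    intro i hi
    have h := (hW i hi).abs_integral_le
    have h2 : J 0 i = ∫ τ, M.onStage i (M.valueGap θs θ (ψ + (0 : ℝ) • u) (M.H - (i + 1))) τ ∂P := by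
      refine integral_congr_ae (Filter.Eventually.of_forall fun τ => ?_)
      have hz : M.logRatio ψ (ψ + (0 : ℝ) • u) (i + 1) τ = 0 := (hW i hi).l_zero τ
      simp only [hz, Real.exp_zero, one_mul]
    rw [h2]
    exact h
  have hfirst : |f 0| ≤ ∑ i ∈ I, |L₀| * √(e i) := by
    rw [hfJ 0]
    exact (Finset.abs_sum_le_sum_abs _ _).trans (Finset.sum_le_sum hJ0)
  set n : Fin M.H → ℝ := fun i => ((i : ℕ) : ℝ) + 1 with hn
  have hn0 : ∀ i, 0 ≤ n i := fun i => by positivity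
  set C : Fin M.H → ℝ := fun i => (max B 0) ^ 2 * √(n i ^ 2 * χg) with hC
  have hder := abs_le_of_difference_bounds (f := f) (f₀ := f 0) (ζ := ζ3 / 3)
    (d₁ := ⟪gradient (M.ret θ) ψ - gradient (M.ret θs) ψ, u⟫)
    (d₂ := ⟪(hess (M.ret θ) ψ - hess (M.ret θs) ψ) u, u⟫)
    (b₁ := fun t => ∑ i ∈ I, (|L₀| * √(n i ^ 2 * χg) + |L₁|) * √(e i + C i * t))
    (b₂ := fun t => ∑ i ∈ I, (|L₀| * √(n i ^ 2 * χh) + |L₀| * √(n i ^ 4 * χf) +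
      2 * |L₁| * √(n i ^ 2 * χg) + |L₂|) * √(e i + C i * t))
    (by fun_prop) (by fun_prop) ?_ ?_ ?_ ?_
  · obtain ⟨hd1, hd2⟩ := hder
    simp only [mul_zero, add_zero] at hd1 hd2
    refine ⟨?_, sq_sum_mul_sqrt_le I he0 hd1 ?_ hE, sq_sum_mul_sqrt_le I he0 hd2 ?_ hE⟩
    · rw [← hf0]
      refine sq_sum_mul_sqrt_le I he0 hfirst ?_ hE
      simp only [sq_abs, Finset.sum_const, nsmul_eq_mul]
      gcongr
    · have hterm : ∀ i, (|L₀| * √(n i ^ 2 * χg) + |L₁|) ^ 2 ≤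
          2 * (χg * L₀ ^ 2) * n i ^ 2 + 2 * L₁ ^ 2 := by
        intro i
        have h1 : (|L₀| * √(n i ^ 2 * χg)) ^ 2 = L₀ ^ 2 * (n i ^ 2 * χg) := by
          rw [mul_pow, sq_abs, Real.sq_sqrt (by positivity)]
        have h2 := add_sq_le (a := |L₀| * √(n i ^ 2 * χg)) (b := |L₁|)
        rw [h1, sq_abs] at h2
        linarith
      refine (Finset.sum_le_sum fun i _ => hterm i).trans ?_
      rw [Finset.sum_add_distrib, ← Finset.mul_sum, Finset.sum_const, nsmul_eq_mul]
      have h3 : 2 * (χg * L₀ ^ 2) * ∑ i ∈ I, n i ^ 2 ≤ 2 * (χg * L₀ ^ 2) * (M.H ^ 3 / 2) := by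
        gcongr
      have h4 : (I.card : ℝ) * (2 * L₁ ^ 2) ≤ M.H * (2 * L₁ ^ 2) := by gcongr
      have h5 : 0 ≤ χg * L₀ ^ 2 * (M.H : ℝ) ^ 3 := by positivity
      linarith
    -- A square of four terms is at most four times the sum of squares. The term in `L₁` then has
    -- coefficient 16, which the factor 1/2 in `hsq` reduces to 8.
    · have hterm : ∀ i, (|L₀| * √(n i ^ 2 * χh) + |L₀| * √(n i ^ 4 * χf) +
          2 * |L₁| * √(n i ^ 2 * χg) + |L₂|) ^ 2 ≤
          (4 * (χh * L₀ ^ 2) + 16 * (χg * L₁ ^ 2)) * n i ^ 2 + 4 * (χf * L₀ ^ 2) * n i ^ 4 +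
            4 * L₂ ^ 2 := by
        intro i
        have h1 : (|L₀| * √(n i ^ 2 * χh)) ^ 2 = L₀ ^ 2 * (n i ^ 2 * χh) := by
          rw [mul_pow, sq_abs, Real.sq_sqrt (by positivity)]
        have h2 : (|L₀| * √(n i ^ 4 * χf)) ^ 2 = L₀ ^ 2 * (n i ^ 4 * χf) := by
          rw [mul_pow, sq_abs, Real.sq_sqrt (by positivity)]
        have h3 : (2 * |L₁| * √(n i ^ 2 * χg)) ^ 2 = 4 * L₁ ^ 2 * (n i ^ 2 * χg) := by
          rw [mul_pow, mul_pow, sq_abs, Real.sq_sqrt (by positivity)]; ring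
        have h4 : |L₂| ^ 2 = L₂ ^ 2 := sq_abs _
        have key : ∀ a b c d : ℝ, (a + b + c + d) ^ 2 ≤ 4 * (a ^ 2 + b ^ 2 + c ^ 2 + d ^ 2) := by
          intro a b c d
          nlinarith [sq_nonneg (a - b), sq_nonneg (a - c), sq_nonneg (a - d), sq_nonneg (b - c),
            sq_nonneg (b - d), sq_nonneg (c - d)]
        refine (key _ _ _ _).trans (le_of_eq ?_)
        rw [h1, h2, h3, h4]; ring
      refine (Finset.sum_le_sum fun i _ => hterm i).trans ?_
      rw [Finset.sum_add_distrib, Finset.sum_add_distrib, ← Finset.mul_sum, ← Finset.mul_sum,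
        Finset.sum_const, nsmul_eq_mul]
      have h3 : (4 * (χh * L₀ ^ 2) + 16 * (χg * L₁ ^ 2)) * ∑ i ∈ I, n i ^ 2 ≤
          (4 * (χh * L₀ ^ 2) + 16 * (χg * L₁ ^ 2)) * (M.H ^ 3 / 2) := by gcongr
      have h4 : (I.card : ℝ) * (4 * L₂ ^ 2) ≤ M.H * (4 * L₂ ^ 2) := by gcongr
      have h5 : 4 * (χf * L₀ ^ 2) * ∑ i ∈ I, n i ^ 4 ≤ 4 * (χf * L₀ ^ 2) * M.H ^ 5 := by gcongr
      have h6 : 0 ≤ χh * L₀ ^ 2 * (M.H : ℝ) ^ 3 := by positivity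
      linarith
  · intro t ht
    have h1 := abs_le.1 ((hsmooth θ).cubic_bound ψ hu ht)
    have h2 := abs_le.1 ((hsmooth θs).cubic_bound ψ hu ht)
    rw [inner_sub_left, sub_apply, inner_sub_left, hf0, abs_le]
    constructor <;> linarith
  · intro t ht
    -- The value at `-t` is reached in direction `-u`, which flips only the first-order term.
    have hu' : ‖-u‖ = 1 := by rwa [norm_neg]
    have h1 := abs_le.1 ((hsmooth θ).cubic_bound ψ hu' ht)
    have h2 := abs_le.1 ((hsmooth θs).cubic_bound ψ hu' ht)
    simp only [smul_neg, ← neg_smul, map_neg, inner_neg_left, inner_neg_right, neg_neg] at h1 h2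
    rw [inner_sub_left, sub_apply, inner_sub_left, hf0, abs_le]
    constructor <;> linarith
  · intro t ht
    rw [hfJ t, hfJ 0, ← Finset.sum_sub_distrib, Finset.mul_sum]
    exact (Finset.abs_sum_le_sum_abs _ _).trans
      (Finset.sum_le_sum fun i hi => (hW i hi).abs_integral_sub_le ht)
  · intro t ht
    rw [hfJ t, hfJ 0, hfJ (-t), Finset.mul_sum, ← Finset.sum_sub_distrib,
      ← Finset.sum_add_distrib, Finset.mul_sum]
    exact (Finset.abs_sum_le_sum_abs _ _).trans
      (Finset.sum_le_sum fun i hi => (hW i hi).abs_integral_second_difference_le ht)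

end Problem

/-! ### Consequences of finite Rademacher complexity -/

namespace Problem

variable {m : ℕ} {S : Set (EuclideanSpace ℝ (Fin m))} {A : Type*} [MeasurableSpace A]
  {d : ℕ} {Θ : Type*} [MeasurableSpace Θ] (M : Problem S A d Θ)

lemma loss_eq (θs : Θ) (z : M.Datum) (θ : Θ) :
    M.loss θs z θ = ∑ i, M.dynGap θs θ (z.1 i) ^ 2 + ∑ i, M.dynGap θs θ (z.2 i) ^ 2 := rfl

lemma sum_dynGap_nonneg (θs θ : Θ) (τ : M.Traj) : 0 ≤ ∑ i, M.dynGap θs θ (τ i) ^ 2 :=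
  Finset.sum_nonneg fun _ _ => sq_nonneg _

lemma loss_nonneg (θs : Θ) (z : M.Datum) (θ : Θ) : 0 ≤ M.loss θs z θ :=
  add_nonneg (M.sum_dynGap_nonneg _ _ _) (M.sum_dynGap_nonneg _ _ _)

lemma loss_self (θs : Θ) (z : M.Datum) : M.loss θs z θs = 0 := by
  simp [loss]

lemma exists_admissible (θs : Θ) : ∃ τ : M.Traj, ∀ i : Fin M.H, (τ i).1 ∈ M.stage i :=
  (M.ae_trajLaw_mem_stage θs 0).exists

/-- The Rademacher complexity, bounded below by the trees that always show the same data point. -/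
lemma le_dynRademacher (θs : Θ) (T : ℕ) {z : M.Datum} (hz : z ∈ M.admissible) (θ : Θ) :
    ((((2 : ℝ) ^ T)⁻¹ * (T * M.loss θs z θ) : ℝ) : EReal) ≤ M.dynRademacher θs T := by
  refine le_trans ?_ (le_iSup _ fun _ _ => (⟨z, hz⟩ : M.admissible))
  rw [EReal.coe_mul]
  refine mul_le_mul_of_nonneg_left ?_ (by exact_mod_cast (by positivity : (0 : ℝ) ≤ (2 ^ T)⁻¹))
  -- The true parameter has loss zero, so no sign pattern contributes negatively and the pattern of
  -- all ones may be kept alone.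
  have hnn : ∀ ε : Fin T → ℤˣ, (0 : EReal) ≤
      ⨆ θ : Θ, ((∑ t : Fin T, ((ε t : ℤ) : ℝ) * M.loss θs z θ : ℝ) : EReal) := by
    intro ε
    refine le_trans ?_ (le_iSup _ θs)
    simp [loss_self]
  refine le_trans ?_ (Finset.single_le_sum (fun ε _ => hnn ε) (Finset.mem_univ fun _ => 1))
  refine le_trans ?_ (le_iSup _ θ)
  simp

variable {T : ℕ} {θs : Θ}

lemma dynRademacher_nonneg (θs : Θ) (T : ℕ) : 0 ≤ M.dynRademacher θs T := by
  obtain ⟨τ, hτ⟩ := M.exists_admissible θs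
  simpa [loss_self] using M.le_dynRademacher θs T (z := (τ, τ)) (fun i => ⟨hτ i, hτ i⟩) θs

lemma coe_toReal_dynRademacher (hfin : M.dynRademacher θs T < ⊤) :
    ((M.dynRademacher θs T).toReal : EReal) = M.dynRademacher θs T :=
  EReal.coe_toReal hfin.ne (ne_bot_of_le_ne_bot (by simp) (M.dynRademacher_nonneg θs T))

lemma toReal_dynRademacher_nonneg (θs : Θ) (T : ℕ) : 0 ≤ (M.dynRademacher θs T).toReal :=
  EReal.toReal_nonneg (M.dynRademacher_nonneg θs T)

/-- Finiteness of the Rademacher complexity makes the loss bounded. -/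
lemma loss_le (hT : 0 < T) (hfin : M.dynRademacher θs T < ⊤) {z : M.Datum}
    (hz : z ∈ M.admissible) (θ : Θ) :
    M.loss θs z θ ≤ 2 ^ T * (M.dynRademacher θs T).toReal := by
  have h := M.le_dynRademacher θs T hz θ
  rw [← M.coe_toReal_dynRademacher hfin, EReal.coe_le_coe_iff, inv_mul_le_iff₀ (by positivity)] at h
  refine le_trans ?_ h
  exact le_mul_of_one_le_left (M.loss_nonneg _ _ _) (by exact_mod_cast hT)

/-- A qualitative bound, uniform in `θ`: it serves integrability and the limit along lines, and does
not enter the final constants. -/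
lemma dynGap_le (hT : 0 < T) (hfin : M.dynRademacher θs T < ⊤) (θ : Θ) :
    ∀ h < M.H, ∀ s ∈ M.stage h, ∀ a,
      M.dynGap θs θ (s, a) ≤ √(2 ^ T * (M.dynRademacher θs T).toReal) := by
  classical
  intro h hh s hs a
  obtain ⟨τ, hτ⟩ := M.exists_admissible θs
  -- Admissibility constrains only the stages of the states, so a pair may be inserted without
  -- regard to the dynamics.
  set τ' : M.Traj := Function.update τ ⟨h, hh⟩ (s, a)
  have hτ' : ∀ i : Fin M.H, (τ' i).1 ∈ M.stage i := by
    intro i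
    by_cases hi : i = ⟨h, hh⟩
    · subst hi; simpa [τ'] using hs
    · simpa [τ', hi] using hτ i
  refine Real.le_sqrt_of_sq_le ?_
  refine le_trans ?_ (M.loss_le hT hfin (z := (τ', τ')) (fun i => ⟨hτ' i, hτ' i⟩) θ)
  rw [loss_eq]
  have h1 := Finset.single_le_sum (f := fun i => M.dynGap θs θ (τ' i) ^ 2)
    (fun i _ => sq_nonneg _) (Finset.mem_univ (⟨h, hh⟩ : Fin M.H))
  have h2 := M.sum_dynGap_nonneg θs θ τ'
  simp only [τ', Function.update_self] at h1 h2 ⊢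
  linarith

lemma measurable_sum_dynGap (θs : Θ) :
    Measurable fun x : Θ × M.Traj => ∑ i, M.dynGap θs x.1 (x.2 i) ^ 2 :=
  Finset.measurable_sum _ fun i _ => (M.measurable_dynGap_comp measurable_const measurable_fst
    ((measurable_pi_apply i).comp measurable_snd)).pow_const 2

lemma measurable_loss (θs : Θ) : Measurable fun x : M.Datum × Θ => M.loss θs x.1 x.2 := by
  simp only [loss_eq]
  refine Measurable.add ?_ ?_
  · exact Finset.measurable_sum _ fun i _ => (M.measurable_dynGap_comp measurable_const
      measurable_snd ((measurable_pi_apply i).comp measurable_fst.fst)).pow_const 2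
  · exact Finset.measurable_sum _ fun i _ => (M.measurable_dynGap_comp measurable_const
      measurable_snd ((measurable_pi_apply i).comp measurable_fst.snd)).pow_const 2

/-- The cumulative expected loss of the learner. -/
lemma sum_integral_loss_le {R : (t : ℕ) → Kernel (Fin t → M.Datum) Θ}
    (hfin : M.dynRademacher θs T < ⊤)
    (hR : HasRademacherRegret R T M.admissible (M.loss θs)) {z : Fin T → M.Datum}
    (hz : ∀ t, z t ∈ M.admissible) :
    ∑ t : Fin T, ∫ θ, M.loss θs (z t) θ ∂(R t (histUpTo z t)) ≤
      2 * (M.dynRademacher θs T).toReal := by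
  have h := hR z hz
  change _ ≤ 2 * M.dynRademacher θs T at h
  rw [← M.coe_toReal_dynRademacher hfin] at h
  have h' : onlineRegret R (M.loss θs) z ≤ 2 * (M.dynRademacher θs T).toReal := by
    rwa [show (2 : EReal) = ((2 : ℝ) : EReal) from rfl, ← EReal.coe_mul,
      EReal.coe_le_coe_iff] at h
  -- The best parameter in hindsight does no worse than the true one, which never errs; regret
  -- therefore bounds cumulative loss.
  have hinf : ⨅ θ, ∑ t : Fin T, M.loss θs (z t) θ ≤ 0 := by
    refine (ciInf_le ⟨0, ?_⟩ θs).trans (by simp [loss_self])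
    rintro _ ⟨θ, rfl⟩
    exact Finset.sum_nonneg fun _ _ => M.loss_nonneg _ _ _
  unfold onlineRegret at h'
  linarith

lemma expErr_nonneg (θs θ : Θ) (ψ : EuclideanSpace ℝ (Fin d)) : 0 ≤ M.expErr θs θ ψ :=
  integral_nonneg fun _ => M.sum_dynGap_nonneg _ _ _

lemma measurable_expErr (θs : Θ) (ψ : EuclideanSpace ℝ (Fin d)) :
    Measurable fun θ => M.expErr θs θ ψ :=
  measurable_integral_of_measurable (κ := fun _ : Θ => M.trajLaw θs ψ) measurable_const
    (fun _ => inferInstance) (M.measurable_sum_dynGap θs)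

variable {B : ℝ}

lemma expErr_le {θ : Θ} (hB : ∀ h < M.H, ∀ s ∈ M.stage h, ∀ a, M.dynGap θs θ (s, a) ≤ B)
    (ψ : EuclideanSpace ℝ (Fin d)) : M.expErr θs θ ψ ≤ M.H * B ^ 2 := by
  have h : ∀ᵐ τ ∂M.trajLaw θs ψ, ∑ i, M.dynGap θs θ (τ i) ^ 2 ≤ M.H * B ^ 2 := by
    filter_upwards [M.ae_dynGap_le hB ψ] with τ hτ
    calc ∑ i, M.dynGap θs θ (τ i) ^ 2 ≤ ∑ _i : Fin M.H, B ^ 2 :=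
          Finset.sum_le_sum fun i _ => pow_le_pow_left₀ (M.dynGap_nonneg _ _ _) (hτ i) 2
      _ = M.H * B ^ 2 := by simp
  calc M.expErr θs θ ψ ≤ ∫ _, (M.H * B ^ 2 : ℝ) ∂M.trajLaw θs ψ :=
        integral_mono_ae (integrable_finsetSum _ fun i _ => M.integrable_dynGap_sq hB ψ i)
          (integrable_const _) h
    _ = _ := by simp

lemma lintegral_loss_eq {θ : Θ} (hB : ∀ h < M.H, ∀ s ∈ M.stage h, ∀ a, M.dynGap θs θ (s, a) ≤ B)
    (ψ ψ' : EuclideanSpace ℝ (Fin d)) :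
    ∫⁻ z, ENNReal.ofReal (M.loss θs z θ) ∂(M.trajLaw θs ψ).prod (M.trajLaw θs ψ') =
      ENNReal.ofReal (M.expErr θs θ ψ + M.expErr θs θ ψ') := by
  have hm : Measurable fun τ : M.Traj => ENNReal.ofReal (∑ i, M.dynGap θs θ (τ i) ^ 2) :=
    (Finset.measurable_sum _ fun i _ => (M.measurable_dynGap_comp measurable_const
      measurable_const (measurable_pi_apply i)).pow_const 2).ennreal_ofReal
  have he : ∀ ψ, ENNReal.ofReal (M.expErr θs θ ψ) =
      ∫⁻ τ, ENNReal.ofReal (∑ i, M.dynGap θs θ (τ i) ^ 2) ∂M.trajLaw θs ψ := fun ψ =>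
    ofReal_integral_eq_lintegral_ofReal
      (integrable_finsetSum _ fun i _ => M.integrable_dynGap_sq hB ψ i)
      (Filter.Eventually.of_forall fun τ => M.sum_dynGap_nonneg _ _ _)
  simp only [loss_eq, ENNReal.ofReal_add (M.sum_dynGap_nonneg _ _ _) (M.sum_dynGap_nonneg _ _ _),
    ENNReal.ofReal_add (M.expErr_nonneg _ _ _) (M.expErr_nonneg _ _ _), he]
  have hm1 : Measurable fun z : M.Datum => ENNReal.ofReal (∑ i, M.dynGap θs θ (z.1 i) ^ 2) :=
    hm.comp measurable_fst
  have hm2 : Measurable fun z : M.Datum => ENNReal.ofReal (∑ i, M.dynGap θs θ (z.2 i) ^ 2) :=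
    hm.comp measurable_snd
  rw [lintegral_add_left hm1, lintegral_prod _ hm1.aemeasurable, lintegral_prod _ hm2.aemeasurable]
  simp

end Problem

/-! ### The law of a run -/

namespace Alg

variable {m : ℕ} {S : Set (EuclideanSpace ℝ (Fin m))} {A : Type*} [MeasurableSpace A]
  {d : ℕ} {Θ : Type*} [MeasurableSpace Θ] {M : Problem S A d Θ} (alg : Alg M)

instance (t : ℕ) : IsMarkovKernel (alg.learner t) := alg.isMarkovKernel_learner t

lemma measurable_prev (t : ℕ) : Measurable (alg.prev t) := by
  cases t with
  | zero => exact measurable_const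
  | succ t =>
    exact (alg.measurable_plan t).comp (measurable_pi_lambda _ fun i => measurable_pi_apply _)

lemma measurable_roundLaw (θs : Θ) (t : ℕ) : Measurable (alg.roundLaw θs t) := by
  have h : alg.roundLaw θs t = fun hist => (M.trajLaw θs (alg.plan t hist)).bind fun τ =>
      (M.trajLaw θs (alg.prev t hist)).map (Prod.mk τ) := by
    funext hist
    rw [roundLaw, Measure.prod]
  rw [h]
  refine measurable_bind_of_measurable
    (κ := fun hist => M.trajLaw θs (alg.plan t hist))
    (η := fun x : (Fin t → M.Datum) × M.Traj =>
      (M.trajLaw θs (alg.prev t x.1)).map (Prod.mk x.2))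
    ((M.measurable_trajLaw θs).comp (alg.measurable_plan t)) (fun _ => inferInstance) ?_
  exact measurable_map_of_measurable
    (κ := fun x : (Fin t → M.Datum) × M.Traj => M.trajLaw θs (alg.prev t x.1))
    (f := fun y => (y.1.2, y.2))
    ((M.measurable_trajLaw θs).comp ((alg.measurable_prev t).comp measurable_fst))
    (fun _ => inferInstance) (measurable_fst.snd.prodMk measurable_snd)

instance (θs : Θ) (t : ℕ) (hist : Fin t → M.Datum) :
    IsProbabilityMeasure (alg.roundLaw θs t hist) := by
  unfold roundLaw; infer_instance

lemma measurable_finSnoc {Z : Type*} [MeasurableSpace Z] (t : ℕ) :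
    Measurable fun x : (Fin t → Z) × Z => (Fin.snoc x.1 x.2 : Fin (t + 1) → Z) := by
  refine measurable_pi_lambda _ fun i => ?_
  refine Fin.lastCases ?_ (fun j => ?_) i
  · simpa using measurable_snd
  · simp only [Fin.snoc_castSucc]; fun_prop

lemma measurable_finSnoc_right {Z : Type*} [MeasurableSpace Z] (t : ℕ) (h : Fin t → Z) :
    Measurable fun z => (Fin.snoc h z : Fin (t + 1) → Z) :=
  (measurable_finSnoc t).comp (measurable_const.prodMk measurable_id)

lemma measurable_runStep (θs : Θ) (t : ℕ) :
    Measurable fun hist => (alg.roundLaw θs t hist).map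
      fun z => (Fin.snoc hist z : Fin (t + 1) → M.Datum) :=
  measurable_map_of_measurable (alg.measurable_roundLaw θs t) (fun _ => inferInstance)
    (f := fun x => (Fin.snoc x.1 x.2 : Fin (t + 1) → M.Datum)) (measurable_finSnoc t)

instance (θs : Θ) (t : ℕ) : IsProbabilityMeasure (alg.runLaw θs t) := by
  induction t with
  | zero => unfold runLaw; infer_instance
  | succ t ih =>
    exact isProbabilityMeasure_bind (alg.measurable_runStep θs t).aemeasurable
      (Filter.Eventually.of_forall fun hist =>
        Measure.isProbabilityMeasure_map (measurable_finSnoc_right t hist).aemeasurable)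

lemma lintegral_runLaw_succ (θs : Θ) (t : ℕ) {F : (Fin (t + 1) → M.Datum) → ENNReal}
    (hF : Measurable F) :
    ∫⁻ hist, F hist ∂alg.runLaw θs (t + 1) =
      ∫⁻ hist, ∫⁻ z, F (Fin.snoc hist z) ∂alg.roundLaw θs t hist ∂alg.runLaw θs t := by
  rw [runLaw, Measure.lintegral_bind (alg.measurable_runStep θs t).aemeasurable hF.aemeasurable]
  refine lintegral_congr fun hist => ?_
  rw [lintegral_map hF (measurable_finSnoc_right t hist)]

lemma measurable_histUpTo {Z : Type*} [MeasurableSpace Z] {T : ℕ} (t : Fin T) :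
    Measurable fun z : Fin T → Z => histUpTo z t :=
  measurable_pi_lambda _ fun _ => measurable_pi_apply _

lemma histUpTo_snoc_castSucc {Z : Type*} {T : ℕ} (h : Fin T → Z) (z : Z) (t : Fin T) :
    histUpTo (Fin.snoc h z : Fin (T + 1) → Z) t.castSucc = histUpTo h t := by
  funext i
  exact Fin.snoc_castSucc (α := fun _ => Z) z h (Fin.castLE t.isLt.le i)

lemma histUpTo_snoc_last {Z : Type*} {T : ℕ} (h : Fin T → Z) (z : Z) :
    histUpTo (Fin.snoc h z : Fin (T + 1) → Z) (Fin.last T) = h := by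
  funext i
  exact Fin.snoc_castSucc (α := fun _ => Z) z h i

/-- Expectations over a run of sums over the rounds. -/
lemma lintegral_runLaw_sum (θs : Θ) (T : ℕ) (φ : (t : ℕ) → (Fin t → M.Datum) → M.Datum → ENNReal)
    (hφ : ∀ t, Measurable (Function.uncurry (φ t))) :
    ∫⁻ hist, ∑ t : Fin T, φ t (histUpTo hist t) (hist t) ∂alg.runLaw θs T =
      ∑ t : Fin T, ∫⁻ hist, ∫⁻ z, φ t hist z ∂alg.roundLaw θs t hist ∂alg.runLaw θs t := by
  have hm : ∀ T, Measurable fun hist : Fin T → M.Datum =>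
      ∑ t : Fin T, φ t (histUpTo hist t) (hist t) := fun T =>
    Finset.measurable_sum _ fun t _ =>
      (hφ t).comp ((measurable_histUpTo t).prodMk (measurable_pi_apply t))
  induction T with
  | zero => simp
  | succ T ih =>
    rw [alg.lintegral_runLaw_succ θs T (hm (T + 1)), Fin.sum_univ_castSucc]
    simp only [Fin.sum_univ_castSucc, histUpTo_snoc_castSucc, Fin.snoc_castSucc,
      histUpTo_snoc_last, Fin.snoc_last, Fin.val_castSucc, Fin.val_last]
    rw [← ih, ← lintegral_add_left (hm T)]
    refine lintegral_congr fun hist => ?_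
    -- The terms of the earlier rounds do not depend on the new data point, whose law has mass one.
    rw [lintegral_add_left measurable_const]
    simp

lemma measurableSet_admissible : MeasurableSet M.admissible := by
  have : M.admissible = ⋂ i : Fin M.H,
      {z : M.Datum | (z.1 i).1 ∈ M.stage i} ∩ {z : M.Datum | (z.2 i).1 ∈ M.stage i} := by
    ext z; simp [Problem.admissible]
  rw [this]
  refine MeasurableSet.iInter fun i => MeasurableSet.inter ?_ ?_
  · exact ((measurable_pi_apply i).comp measurable_fst).fst (M.measurableSet_stage i)
  · exact ((measurable_pi_apply i).comp measurable_snd).fst (M.measurableSet_stage i)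

lemma ae_roundLaw_admissible (θs : Θ) (t : ℕ) (hist : Fin t → M.Datum) :
    ∀ᵐ z ∂alg.roundLaw θs t hist, z ∈ M.admissible := by
  have h1 := (Measure.quasiMeasurePreserving_fst (μ := M.trajLaw θs (alg.plan t hist))
    (ν := M.trajLaw θs (alg.prev t hist))).ae (M.ae_trajLaw_mem_stage θs (alg.plan t hist))
  have h2 := (Measure.quasiMeasurePreserving_snd (μ := M.trajLaw θs (alg.plan t hist))
    (ν := M.trajLaw θs (alg.prev t hist))).ae (M.ae_trajLaw_mem_stage θs (alg.prev t hist))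
  unfold roundLaw
  filter_upwards [h1, h2] with z hz1 hz2 i using ⟨hz1 i, hz2 i⟩

lemma ae_runLaw_admissible (θs : Θ) (T : ℕ) :
    ∀ᵐ hist ∂alg.runLaw θs T, ∀ t, hist t ∈ M.admissible := by
  have hms : ∀ T, MeasurableSet {hist : Fin T → M.Datum | ∀ t, hist t ∈ M.admissible} := by
    intro T
    simp only [Set.ofPred_forall]
    exact MeasurableSet.iInter fun t => (measurable_pi_apply t) measurableSet_admissible
  induction T with
  | zero => exact Filter.Eventually.of_forall fun _ t => t.elim0
  | succ T ih =>
    refine ae_bind_of_forall_ae (alg.measurable_runStep θs T) (hms _) ?_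
    filter_upwards [ih] with hist hh
    rw [ae_map_iff (measurable_finSnoc_right T hist).aemeasurable (hms _)]
    filter_upwards [alg.ae_roundLaw_admissible θs T hist] with z hz t
    refine Fin.lastCases ?_ (fun j => ?_) t
    · simpa using hz
    · simpa using hh j

end Alg

/-! ### Scalar inequalities for the regret -/

lemma sum_le_of_recursion {y D : ℕ → ℝ} {g : ℝ} (hg0 : 0 ≤ g) (hg1 : g ≤ 1) (hy : ∀ t, y t ≤ 1)
    (T : ℕ) (hD : ∀ t < T, 0 ≤ D t) (hrec : ∀ t < T, y (t + 1) ≤ max (y t - g) 0 + D t) :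
    g * ∑ t ∈ Finset.range T, y (t + 1) ≤ 1 + ∑ t ∈ Finset.range T, D t := by
  have hz : ∀ t < T, max (y (t + 1)) 0 ≤ (1 - g) * max (y t) 0 + D t := by
    intro t ht
    -- For `0 ≤ y ≤ 1` one has `y - g ≤ y - g * y`: an additive decrease is also a contraction. Here
    -- the normalization of the return is used.
    have h1 : max (y t - g) 0 ≤ (1 - g) * max (y t) 0 := by
      have h2 := hy t
      have h3 := le_max_left (y t) 0
      have h4 := le_max_right (y t) 0
      have h5 : max (y t) 0 ≤ 1 := max_le h2 zero_le_one
      refine max_le ?_ (mul_nonneg (by linarith) h4)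
      nlinarith
    refine max_le ((hrec t ht).trans (by linarith)) ?_
    exact add_nonneg ((le_max_right _ _).trans h1) (hD t ht)
  -- The extra term on the left is the remaining potential, which makes the sum telescope.
  have key : ∀ n ≤ T, g * ∑ t ∈ Finset.range n, max (y (t + 1)) 0 + (1 - g) * max (y n) 0 ≤
      1 + ∑ t ∈ Finset.range n, D t := by
    intro n
    induction n with
    | zero =>
      intro _
      have h5 : max (y 0) 0 ≤ 1 := max_le (hy 0) zero_le_one
      have h4 := le_max_right (y 0) 0
      simp only [Finset.range_zero, Finset.sum_empty, mul_zero, zero_add, add_zero]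
      nlinarith
    | succ n ih =>
      intro hn
      rw [Finset.sum_range_succ, Finset.sum_range_succ]
      have h1 := ih (by omega)
      have h2 := hz n (by omega)
      linarith
  have h1 := key T le_rfl
  have h2 : g * ∑ t ∈ Finset.range T, y (t + 1) ≤
      g * ∑ t ∈ Finset.range T, max (y (t + 1)) 0 :=
    mul_le_mul_of_nonneg_left (Finset.sum_le_sum fun _ _ => le_max_left _ _) hg0
  have h3 : 0 ≤ (1 - g) * max (y T) 0 := mul_nonneg (by linarith) (le_max_right _ _)
  linarith

/-- The optimal `κ` is `√a / √b`. It is not positive when `a = 0`; then `κ` tends to zero instead.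
-/
lemma le_sqrt_of_forall_le {x a b : ℝ} (ha : 0 ≤ a) (hb : 0 < b)
    (h : ∀ κ : ℝ, 0 < κ → x ≤ (a / κ + b * κ) / 2) : x ≤ √(a * b) := by
  rcases ha.eq_or_lt with rfl | ha
  · rw [zero_mul, Real.sqrt_zero]
    refine le_of_forall_pos_le_add fun δ hδ => ?_
    have := h (δ / b) (by positivity)
    rw [zero_div, mul_div_cancel₀ _ hb.ne'] at this
    linarith
  · have hs : 0 < √a := Real.sqrt_pos.2 ha
    have ht : 0 < √b := Real.sqrt_pos.2 hb
    have h1 := h (√a / √b) (by positivity)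
    rw [Real.sqrt_mul ha.le]
    have h2 : a / (√a / √b) = √a * √b := by
      rw [div_div_eq_mul_div, div_eq_iff hs.ne']
      nth_rw 1 [← Real.mul_self_sqrt ha.le]; ring
    have h3 : b * (√a / √b) = √a * √b := by
      rw [mul_div_assoc', div_eq_iff ht.ne']
      nth_rw 1 [← Real.mul_self_sqrt hb.le]; ring
    rw [h2, h3] at h1
    linarith

lemma inv_gain_eq {ζh ζ3 ε : ℝ} (hζh : 0 < ζh) (hζ3 : 0 < ζ3) (hε : 0 < ε) :
    max (2 * ζh * ε ^ (-2 : ℝ)) (√ζ3 * ε ^ (-(3 / 2) : ℝ)) * gain ζh ζ3 ε = 1 := by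
  have h1 : ε ^ (-2 : ℝ) = (ε ^ 2)⁻¹ := by
    rw [Real.rpow_neg hε.le]; norm_num
  have h2 : ε ^ (-(3 / 2) : ℝ) = (ε * √ε)⁻¹ := by
    rw [Real.rpow_neg hε.le, show (3 / 2 : ℝ) = 1 + 1 / 2 by norm_num, Real.rpow_add hε,
      Real.rpow_one, Real.sqrt_eq_rpow]
  have ha : 2 * ζh * ε ^ (-2 : ℝ) = (ε ^ 2 / (2 * ζh))⁻¹ := by
    rw [h1, inv_div]; rfl
  have hb : √ζ3 * ε ^ (-(3 / 2) : ℝ) = (ε * √(ε / ζ3))⁻¹ := by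
    have : 0 < √ε := Real.sqrt_pos.2 hε
    have : 0 < √ζ3 := Real.sqrt_pos.2 hζ3
    rw [h2, Real.sqrt_div hε.le]; field_simp
  have hA : 0 < ε ^ 2 / (2 * ζh) := by positivity
  have hB : 0 < ε * √(ε / ζ3) := by positivity
  rw [ha, hb, gain]
  rcases le_total (ε ^ 2 / (2 * ζh)) (ε * √(ε / ζ3)) with h | h
  · rw [min_eq_left h, max_eq_left (inv_anti₀ hA h), inv_mul_cancel₀ hA.ne']
  · rw [min_eq_right h, max_eq_right (inv_anti₀ hB h), inv_mul_cancel₀ hB.ne']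

lemma gain_le_one {ζh ζ3 ε : ℝ} (hε0 : 0 < ε) (hε1 : ε ≤ 1) (hε : ε ≤ ζ3 / 16) :
    gain ζh ζ3 ε ≤ 1 := by
  have hζ3 : 0 < ζ3 := by linarith
  have h : √(ε / ζ3) ≤ 1 := by
    refine Real.sqrt_le_iff.2 ⟨zero_le_one, ?_⟩
    rw [one_pow, div_le_one hζ3]; linarith
  calc gain ζh ζ3 ε ≤ ε * √(ε / ζ3) := min_le_right _ _
    _ ≤ 1 * 1 := mul_le_mul hε1 h (Real.sqrt_nonneg _) zero_le_one
    _ = 1 := one_mul 1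

/-! ### Progress in one round -/

namespace Problem

variable {m : ℕ} {S : Set (EuclideanSpace ℝ (Fin m))} {A : Type*} [MeasurableSpace A]
  {d : ℕ} {Θ : Type*} [MeasurableSpace Θ] (M : Problem S A d Θ)
  {χg χf χh L₀ L₁ L₂ ζg ζh ζ3 B : ℝ}

/-- All model errors that enter a round of the algorithm, in terms of the expected loss. -/
lemma sum_sq_errors_le (hpol : M.PolicyRegular χg χf χh) (hval : M.ValueLipschitz L₀ L₁ L₂)
    (hsmooth : ∀ θ, SmoothBounds (M.ret θ) ζg ζh ζ3) {θs θ : Θ}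
    (hB : ∀ h < M.H, ∀ s ∈ M.stage h, ∀ a, M.dynGap θs θ (s, a) ≤ B)
    (ψ ψ' : EuclideanSpace ℝ (Fin d)) {u : EuclideanSpace ℝ (Fin d)} (hu : ‖u‖ = 1) :
    0 ≤ c₁ M.H L₀ L₁ L₂ χg χf χh ∧
    (M.ret θ ψ' - M.ret θs ψ') ^ 2 + (M.ret θ ψ - M.ret θs ψ) ^ 2 +
      ⟪gradient (M.ret θ) ψ - gradient (M.ret θs) ψ, u⟫ ^ 2 +
      ⟪(hess (M.ret θ) ψ - hess (M.ret θs) ψ) u, u⟫ ^ 2 ≤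
      c₁ M.H L₀ L₁ L₂ χg χf χh * (M.expErr θs θ ψ' + M.expErr θs θ ψ) := by
  obtain ⟨hχg, hχf, hχh⟩ := hpol.nonneg M hu
  obtain ⟨h1, h2, h3⟩ := M.ret_error_bounds hpol hval hsmooth hB ψ hu
  obtain ⟨h4, -⟩ := M.ret_error_bounds hpol hval hsmooth hB ψ' hu
  have hc : 0 ≤ c₁ M.H L₀ L₁ L₂ χg χf χh := by unfold c₁; positivity
  refine ⟨hc, ?_⟩
  -- Only the value error is needed at `ψ'`, and `c₁` is more than enough for it. At `ψ`, `c₁` is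
  -- exactly the sum of the three constants.
  have h5 : M.H * L₀ ^ 2 * M.expErr θs θ ψ' ≤
      c₁ M.H L₀ L₁ L₂ χg χf χh * M.expErr θs θ ψ' := by
    refine mul_le_mul_of_nonneg_right ?_ (M.expErr_nonneg _ _ _)
    have : c₁ M.H L₀ L₁ L₂ χg χf χh - M.H * L₀ ^ 2 =
      M.H * L₀ ^ 2 * (4 * M.H ^ 2 * χh + 4 * M.H ^ 4 * χf + 2 * M.H ^ 2 * χg) +
        M.H * L₁ ^ 2 * (8 * M.H ^ 2 * χg + 2) + 4 * M.H * L₂ ^ 2 := by unfold c₁; ring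
    have h0 : 0 ≤ M.H * L₀ ^ 2 * (4 * M.H ^ 2 * χh + 4 * M.H ^ 4 * χf + 2 * M.H ^ 2 * χg) +
        M.H * L₁ ^ 2 * (8 * M.H ^ 2 * χg + 2) + 4 * M.H * L₂ ^ 2 := by positivity
    linarith
  have h6 : c₁ M.H L₀ L₁ L₂ χg χf χh * M.expErr θs θ ψ = M.H * L₀ ^ 2 * M.expErr θs θ ψ +
      (2 * M.H ^ 3 * χg * L₀ ^ 2 + 2 * M.H * L₁ ^ 2) * M.expErr θs θ ψ +
      (4 * M.H ^ 3 * χh * L₀ ^ 2 + 4 * M.H ^ 5 * χf * L₀ ^ 2 + 8 * M.H ^ 3 * χg * L₁ ^ 2 +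
        4 * M.H * L₂ ^ 2) * M.expErr θs θ ψ := by unfold c₁; ring
  rw [mul_add]
  linarith

lemma integrable_ret (p : Measure Θ) [IsFiniteMeasure p] (ψ : EuclideanSpace ℝ (Fin d)) :
    Integrable (fun θ => M.ret θ ψ) p :=
  integrable_of_measurable_of_bound (M.measurable_ret.comp measurable_prodMk_right) M.H
    fun θ => M.abs_ret_le θ ψ

/-- The progress made in one round: `ψ'` is the maximizer of the virtual return under the
distribution `p` of the dynamics, and `ψ` is the parameter of the previous round. -/
lemma round_progress (hζh : 0 < ζh) (hpol : M.PolicyRegular χg χf χh)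
    (hval : M.ValueLipschitz L₀ L₁ L₂) (hsmooth : ∀ θ, SmoothBounds (M.ret θ) ζg ζh ζ3) {θs : Θ}
    (hB : ∀ θ, ∀ h < M.H, ∀ s ∈ M.stage h, ∀ a, M.dynGap θs θ (s, a) ≤ B)
    {ε : ℝ} (hε0 : 0 < ε) (hε : ε ≤ ζ3 / 16)
    {u₀ : EuclideanSpace ℝ (Fin d)} (hu₀ : ‖u₀‖ = 1)
    (p : Measure Θ) [IsProbabilityMeasure p] {ψ ψ' : EuclideanSpace ℝ (Fin d)}
    (hmax : ∀ ψ'', ∫ θ, M.ret θ ψ'' ∂p ≤ ∫ θ, M.ret θ ψ' ∂p) {κ : ℝ} (hκ : 0 < κ) :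
    let D := (2 + ζg / ζh) * ((c₁ M.H L₀ L₁ L₂ χg χf χh *
      (∫ θ, (M.expErr θs θ ψ' + M.expErr θs θ ψ) ∂p) / κ + κ) / 2)
    0 ≤ D ∧ M.ret θs ψ - D ≤ M.ret θs ψ' ∧
      (ψ ∉ approxLocalMaxima (M.ret θs) ε (6 * √(ζ3 * ε)) →
        M.ret θs ψ + gain ζh ζ3 ε - D ≤ M.ret θs ψ') := by
  intro D
  set c := c₁ M.H L₀ L₁ L₂ χg χf χh with hcdef
  have hc : 0 ≤ c := (M.sum_sq_errors_le hpol hval hsmooth (hB θs) ψ ψ' hu₀).1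
  have hζg : 0 ≤ ζg := (norm_nonneg _).trans ((hsmooth θs).grad_le 0)
  set E : Θ → ℝ := fun θ => M.expErr θs θ ψ' + M.expErr θs θ ψ with hE
  have hE0 : ∀ θ, 0 ≤ E θ := fun θ => add_nonneg (M.expErr_nonneg _ _ _) (M.expErr_nonneg _ _ _)
  have hEint : Integrable E p := by
    refine integrable_of_measurable_of_bound
      ((M.measurable_expErr θs ψ').add (M.measurable_expErr θs ψ)) (M.H * B ^ 2 + M.H * B ^ 2)
      fun θ => ?_
    rw [abs_of_nonneg (hE0 θ)]
    exact add_le_add (M.expErr_le (hB θ) ψ') (M.expErr_le (hB θ) ψ)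
  -- By the arithmetic–geometric mean inequality `F` dominates the square root of `c * E`. It is
  -- linear in the loss, so its average over `θ` is explicit.
  set F : Θ → ℝ := fun θ => (c * E θ / κ + κ) / 2 with hF
  have hF0 : ∀ θ, 0 ≤ F θ := fun θ => by
    have := hE0 θ
    positivity
  have hFint : Integrable F p :=
    (((hEint.const_mul c).div_const κ).add (integrable_const κ)).div_const 2
  have hFsq : ∀ θ, c * E θ ≤ F θ ^ 2 := by
    intro θ
    have h1 : c * E θ = (c * E θ / κ) * κ := by field_simp
    have h2 : F θ ^ 2 - (c * E θ / κ) * κ = ((c * E θ / κ - κ) / 2) ^ 2 := by simp only [hF]; ring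
    have h3 := sq_nonneg ((c * E θ / κ - κ) / 2)
    linarith
  have hD : D = (2 + ζg / ζh) * ∫ θ, F θ ∂p := by
    have h1 : ∫ θ, F θ ∂p = (c * (∫ θ, E θ ∂p) / κ + κ) / 2 := by
      simp only [hF]
      rw [integral_div, integral_add ((hEint.const_mul c).div_const κ) (integrable_const κ),
        integral_div, integral_const_mul]
      simp
    rw [h1]
  have hIF : 0 ≤ ∫ θ, F θ ∂p := integral_nonneg hF0
  have herr : ∀ θ u, ‖u‖ = 1 → (M.ret θ ψ' - M.ret θs ψ') ^ 2 + (M.ret θ ψ - M.ret θs ψ) ^ 2 +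
      ⟪gradient (M.ret θ) ψ - gradient (M.ret θs) ψ, u⟫ ^ 2 +
      ⟪(hess (M.ret θ) ψ - hess (M.ret θs) ψ) u, u⟫ ^ 2 ≤ F θ ^ 2 := fun θ u hu =>
    (M.sum_sq_errors_le hpol hval hsmooth (hB θ) ψ ψ' hu).2.trans (hFsq θ)
  -- Averaging over `p` and using that `ψ'` beats the competitor `ψ''` on average cancels the
  -- virtual return of `ψ'` and leaves its true return. The competitor must not depend on `θ`.
  have hcompare : ∀ ψ'' b, (∀ θ, b - (2 + ζg / ζh) * F θ ≤
      M.ret θ ψ'' - (M.ret θ ψ' - M.ret θs ψ')) → b - D ≤ M.ret θs ψ' := by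
    intro ψ'' b h
    have hI : Integrable (fun θ => M.ret θ ψ' - M.ret θs ψ') p :=
      (M.integrable_ret p ψ').sub (integrable_const _)
    have h1 : ∫ θ, (b - (2 + ζg / ζh) * F θ) ∂p ≤
        ∫ θ, (M.ret θ ψ'' - (M.ret θ ψ' - M.ret θs ψ')) ∂p :=
      integral_mono ((integrable_const b).sub (hFint.const_mul _))
        ((M.integrable_ret p ψ'').sub hI) h
    rw [integral_sub (integrable_const b) (hFint.const_mul _), integral_const_mul,
      integral_sub (M.integrable_ret p ψ'') hI,
      integral_sub (M.integrable_ret p ψ') (integrable_const _), ← hD] at h1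
    simp only [integral_const, probReal_univ, one_smul] at h1
    linarith [hmax ψ'']
  refine ⟨by rw [hD]; positivity, hcompare ψ _ fun θ => ?_, fun hψ => ?_⟩
  -- Here the competitor is the previous parameter itself, so only the two value errors matter and
  -- the weight zero is taken.
  · have h1 := sum_le_two_mul_of_sq_le (hF0 θ) (herr θ u₀ hu₀) le_rfl zero_le_one
    have h2 : 0 ≤ ζg / ζh * F θ := mul_nonneg (by positivity) (hF0 θ)
    have h3 := le_abs_self (M.ret θ ψ' - M.ret θs ψ')
    have h4 := neg_abs_le (M.ret θ ψ - M.ret θs ψ)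
    linarith
  · obtain ⟨u, hu, α, h⟩ := exists_ascent hζh (hsmooth θs) hε0 hε hψ
    exact hcompare (ψ + α • u) _ fun θ => h _ (hsmooth θ) _ _ (hF0 θ) (herr θ u hu)

end Problem

/-! ### Cumulative loss and regret along a run -/

namespace Alg

variable {m : ℕ} {S : Set (EuclideanSpace ℝ (Fin m))} {A : Type*} [MeasurableSpace A]
  {d : ℕ} {Θ : Type*} [MeasurableSpace Θ] {M : Problem S A d Θ} (alg : Alg M)
  {χg χf χh L₀ L₁ L₂ ζg ζh ζ3 B : ℝ}

/-- The expected loss of the learner in a round, given the data of the earlier rounds. -/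
noncomputable def roundErr (θs : Θ) (t : ℕ) (hist : Fin t → M.Datum) : ℝ :=
  ∫ θ, (M.expErr θs θ (alg.plan t hist) + M.expErr θs θ (alg.prev t hist)) ∂alg.learner t hist

lemma roundErr_nonneg (θs : Θ) (t : ℕ) (hist : Fin t → M.Datum) : 0 ≤ alg.roundErr θs t hist :=
  integral_nonneg fun _ => add_nonneg (M.expErr_nonneg _ _ _) (M.expErr_nonneg _ _ _)

lemma measurable_lintegral_loss (θs : Θ) (t : ℕ) :
    Measurable (Function.uncurry fun (hist : Fin t → M.Datum) (z : M.Datum) =>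
      ∫⁻ θ, ENNReal.ofReal (M.loss θs z θ) ∂alg.learner t hist) := by
  refine measurable_lintegral_of_measurable
    (κ := fun x : (Fin t → M.Datum) × M.Datum => alg.learner t x.1)
    (F := fun y => ENNReal.ofReal (M.loss θs y.1.2 y.2))
    ((alg.learner t).measurable.comp measurable_fst) (fun _ => inferInstance) ?_
  exact ((M.measurable_loss θs).comp (measurable_fst.snd.prodMk measurable_snd)).ennreal_ofReal

/-- Given the history, the learner's parameter and the new data are independent, so the two
integrations may be exchanged. Thus the model error of a round is the learner's expected loss on
that round's data. -/
lemma ofReal_roundErr {θs : Θ}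
    (hB : ∀ θ, ∀ h < M.H, ∀ s ∈ M.stage h, ∀ a, M.dynGap θs θ (s, a) ≤ B) (t : ℕ)
    (hist : Fin t → M.Datum) :
    ENNReal.ofReal (alg.roundErr θs t hist) =
      ∫⁻ z, ∫⁻ θ, ENNReal.ofReal (M.loss θs z θ) ∂alg.learner t hist ∂alg.roundLaw θs t hist := by
  have hint : Integrable (fun θ => M.expErr θs θ (alg.plan t hist) +
      M.expErr θs θ (alg.prev t hist)) (alg.learner t hist) := by
    refine integrable_of_measurable_of_bound
      ((M.measurable_expErr θs _).add (M.measurable_expErr θs _)) (M.H * B ^ 2 + M.H * B ^ 2)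
      fun θ => ?_
    rw [abs_of_nonneg (add_nonneg (M.expErr_nonneg _ _ _) (M.expErr_nonneg _ _ _))]
    exact add_le_add (M.expErr_le (hB θ) _) (M.expErr_le (hB θ) _)
  have hm : Measurable (Function.uncurry fun (z : M.Datum) (θ : Θ) =>
      ENNReal.ofReal (M.loss θs z θ)) := (M.measurable_loss θs).ennreal_ofReal
  rw [lintegral_lintegral_swap hm.aemeasurable, roundErr, ofReal_integral_eq_lintegral_ofReal hint
    (Filter.Eventually.of_forall fun _ => add_nonneg (M.expErr_nonneg _ _ _)
      (M.expErr_nonneg _ _ _))]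
  refine lintegral_congr fun θ => ?_
  rw [roundLaw, M.lintegral_loss_eq (hB θ)]

lemma measurable_ofReal_roundErr {θs : Θ}
    (hB : ∀ θ, ∀ h < M.H, ∀ s ∈ M.stage h, ∀ a, M.dynGap θs θ (s, a) ≤ B) (t : ℕ) :
    Measurable fun hist => ENNReal.ofReal (alg.roundErr θs t hist) := by
  simp only [alg.ofReal_roundErr hB]
  exact measurable_lintegral_of_measurable (alg.measurable_roundLaw θs t) (fun _ => inferInstance)
    (F := fun x => ∫⁻ θ, ENNReal.ofReal (M.loss θs x.2 θ) ∂alg.learner t x.1)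
    (alg.measurable_lintegral_loss θs t)

lemma measurable_roundErr {θs : Θ}
    (hB : ∀ θ, ∀ h < M.H, ∀ s ∈ M.stage h, ∀ a, M.dynGap θs θ (s, a) ≤ B) (t : ℕ) :
    Measurable (alg.roundErr θs t) := by
  have h := (alg.measurable_ofReal_roundErr hB t).ennreal_toReal
  simpa only [ENNReal.toReal_ofReal (alg.roundErr_nonneg θs t _)] using h

/-- The expected cumulative loss of the learner along a run. -/
lemma lintegral_sum_roundErr_le {θs : Θ} {T : ℕ} (hT : 0 < T) (hfin : M.dynRademacher θs T < ⊤)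
    (hlearner : HasRademacherRegret alg.learner T M.admissible (M.loss θs)) :
    ∫⁻ hist, ENNReal.ofReal (∑ t : Fin T, alg.roundErr θs t (histUpTo hist t)) ∂alg.runLaw θs T ≤
      ENNReal.ofReal (2 * (M.dynRademacher θs T).toReal) := by
  have hB := fun θ => M.dynGap_le hT hfin θ
  simp only [ENNReal.ofReal_sum_of_nonneg fun t _ => alg.roundErr_nonneg θs _ _]
  rw [alg.lintegral_runLaw_sum θs T (fun t hist _ => ENNReal.ofReal (alg.roundErr θs t hist))
    fun t => (alg.measurable_ofReal_roundErr hB t).comp measurable_fst]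
  simp only [lintegral_const, measure_univ, mul_one, alg.ofReal_roundErr hB]
  rw [← alg.lintegral_runLaw_sum θs T
    (fun t hist z => ∫⁻ θ, ENNReal.ofReal (M.loss θs z θ) ∂alg.learner t hist)
    (alg.measurable_lintegral_loss θs)]
  calc _ ≤ ∫⁻ _, ENNReal.ofReal (2 * (M.dynRademacher θs T).toReal) ∂alg.runLaw θs T := by
        -- The regret guarantee holds for each admissible data sequence, and almost every run is
        -- one; no adaptivity argument is required.
        refine lintegral_mono_ae ?_
        filter_upwards [alg.ae_runLaw_admissible θs T] with hist hh
        have hint : ∀ t : Fin T, Integrable (fun θ => M.loss θs (hist t) θ)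
            (alg.learner t (histUpTo hist t)) := by
          intro t
          refine integrable_of_measurable_of_bound ((M.measurable_loss θs).of_uncurry_left
            (f := fun z θ => M.loss θs z θ))
            (2 ^ T * (M.dynRademacher θs T).toReal) fun θ => ?_
          rw [abs_of_nonneg (M.loss_nonneg _ _ _)]
          exact M.loss_le hT hfin (hh t) θ
        simp only [← ofReal_integral_eq_lintegral_ofReal (hint _)
          (Filter.Eventually.of_forall fun θ => M.loss_nonneg _ _ _)]
        rw [← ENNReal.ofReal_sum_of_nonneg fun t _ => integral_nonneg fun θ => M.loss_nonneg _ _ _]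
        exact ENNReal.ofReal_le_ofReal (M.sum_integral_loss_le hfin hlearner hh)
    _ = _ := by simp

lemma integrable_sum_roundErr {θs : Θ} {T : ℕ} (hT : 0 < T) (hfin : M.dynRademacher θs T < ⊤)
    (hlearner : HasRademacherRegret alg.learner T M.admissible (M.loss θs)) :
    Integrable (fun hist => ∑ t : Fin T, alg.roundErr θs t (histUpTo hist t))
      (alg.runLaw θs T) ∧
    ∫ hist, ∑ t : Fin T, alg.roundErr θs t (histUpTo hist t) ∂alg.runLaw θs T ≤
      2 * (M.dynRademacher θs T).toReal := by
  have h := alg.lintegral_sum_roundErr_le hT hfin hlearner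
  have hnn : ∀ hist : Fin T → M.Datum, 0 ≤ ∑ t : Fin T, alg.roundErr θs t (histUpTo hist t) :=
    fun hist => Finset.sum_nonneg fun t _ => alg.roundErr_nonneg θs _ _
  have hm : Measurable fun hist : Fin T → M.Datum =>
      ∑ t : Fin T, alg.roundErr θs t (histUpTo hist t) :=
    Finset.measurable_sum _ fun t _ =>
      (alg.measurable_roundErr (fun θ => M.dynGap_le hT hfin θ) t).comp (measurable_histUpTo t)
  have hint : Integrable (fun hist => ∑ t : Fin T, alg.roundErr θs t (histUpTo hist t))
      (alg.runLaw θs T) := by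
    refine ⟨hm.aestronglyMeasurable, ?_⟩
    rw [hasFiniteIntegral_iff_ofReal (Filter.Eventually.of_forall hnn)]
    exact h.trans_lt ENNReal.ofReal_lt_top
  refine ⟨hint, ?_⟩
  rw [← ofReal_integral_eq_lintegral_ofReal hint (Filter.Eventually.of_forall hnn)] at h
  exact (ENNReal.ofReal_le_ofReal_iff
    (mul_nonneg zero_le_two (M.toReal_dynRademacher_nonneg θs T))).1 h

/-- The policy parameters chosen along a run, starting with the initial one. -/
noncomputable def params {T : ℕ} (hist : Fin T → M.Datum) : ℕ → EuclideanSpace ℝ (Fin d)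
  | 0 => alg.ψ₀
  | t + 1 => if h : t < T then alg.plan t (histUpTo hist ⟨t, h⟩) else alg.ψ₀

lemma params_succ {T : ℕ} (hist : Fin T → M.Datum) (t : Fin T) :
    alg.params hist (t + 1) = alg.plan t (histUpTo hist t) := by
  simp [params, t.2]

/-- The indices are shifted by one: entry `t + 1` of `params` belongs to round `t`, and entry 0 is
the initial parameter. The fallback value beyond `T` is never met here. -/
lemma prev_eq_params {T : ℕ} (hist : Fin T → M.Datum) (t : Fin T) :
    alg.prev t (histUpTo hist t) = alg.params hist t := by
  obtain ⟨t, ht⟩ := t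
  cases t with
  | zero => rfl
  | succ t =>
    simp only [prev, params, dif_pos (Nat.lt_of_succ_lt ht)]
    rfl

/-- The bound on the local regret along every run. -/
lemma gain_mul_localRegret_le (hζh : 0 < ζh) (hpol : M.PolicyRegular χg χf χh)
    (hval : M.ValueLipschitz L₀ L₁ L₂) (hsmooth : ∀ θ, SmoothBounds (M.ret θ) ζg ζh ζ3) {θs : Θ}
    (hret : ∀ ψ, M.ret θs ψ ≤ 1)
    (hB : ∀ θ, ∀ h < M.H, ∀ s ∈ M.stage h, ∀ a, M.dynGap θs θ (s, a) ≤ B)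
    {ε : ℝ} (hε0 : 0 < ε) (hε1 : ε ≤ 1) (hε : ε ≤ ζ3 / 16)
    {u₀ : EuclideanSpace ℝ (Fin d)} (hu₀ : ‖u₀‖ = 1) {κ : ℝ} (hκ : 0 < κ) {T : ℕ}
    (hist : Fin T → M.Datum) :
    gain ζh ζ3 ε * alg.localRegret θs ε (6 * √(ζ3 * ε)) hist ≤
      1 + (2 + ζg / ζh) * ((c₁ M.H L₀ L₁ L₂ χg χf χh *
        (∑ t : Fin T, alg.roundErr θs t (histUpTo hist t)) / κ + T * κ) / 2) := by
  set 𝔄 := approxLocalMaxima (M.ret θs) ε (6 * √(ζ3 * ε)) with h𝔄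
  set C := 2 + ζg / ζh
  set c := c₁ M.H L₀ L₁ L₂ χg χf χh
  set v : ℝ := ⨅ ψ : 𝔄, M.ret θs ψ with hv
  have hbdd : BddBelow (Set.range fun ψ : 𝔄 => M.ret θs ψ) :=
    ⟨0, by rintro _ ⟨ψ, rfl⟩; exact M.ret_nonneg _ _⟩
  have hvle : ∀ ψ ∈ 𝔄, v ≤ M.ret θs ψ := fun ψ hψ => ciInf_le hbdd ⟨ψ, hψ⟩
  obtain ⟨ψ₁, hψ₁⟩ := approxLocalMaxima_nonempty hζh (hsmooth θs) hε0 hε hret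
  have hv1 : v ≤ 1 := (hvle ψ₁ hψ₁).trans (hret ψ₁)
  have hg0 : 0 < gain ζh ζ3 ε := gain_pos hζh (by linarith) hε0
  set D : ℕ → ℝ := fun t => if h : t < T then
    C * ((c * alg.roundErr θs t (histUpTo hist ⟨t, h⟩) / κ + κ) / 2) else 0 with hD
  have hprog : ∀ t : Fin T, _ := fun t =>
    M.round_progress hζh hpol hval hsmooth hB hε0 hε hu₀ (alg.learner t (histUpTo hist t))
      (ψ := alg.prev t (histUpTo hist t)) (alg.plan_argmax t (histUpTo hist t)) hκ
  -- By the shift, `y (t + 1)` is the regret of round `t`, and `y 0` belongs to the arbitrary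
  -- initial parameter. That `y ≤ 1` follows from `v ≤ 1` and nonnegative returns.
  have hseq := sum_le_of_recursion (y := fun t => v - M.ret θs (alg.params hist t)) (D := D)
    hg0.le (gain_le_one hε0 hε1 hε) (fun t => by linarith [M.ret_nonneg θs (alg.params hist t)]) T
    (fun t ht => ?_) (fun t ht => ?_)
  · have h1 : alg.localRegret θs ε (6 * √(ζ3 * ε)) hist =
        ∑ t ∈ Finset.range T, (v - M.ret θs (alg.params hist (t + 1))) := by
      rw [← Fin.sum_univ_eq_sum_range (fun t => v - M.ret θs (alg.params hist (t + 1))), localRegret]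
      exact Finset.sum_congr rfl fun t _ => by rw [params_succ]
    have h2 : ∑ t ∈ Finset.range T, D t = C * ((c *
        (∑ t : Fin T, alg.roundErr θs t (histUpTo hist t)) / κ + T * κ) / 2) := by
      rw [← Fin.sum_univ_eq_sum_range]
      simp only [hD, Fin.is_lt, dif_pos, Fin.eta]
      rw [← Finset.mul_sum, ← Finset.sum_div, Finset.sum_add_distrib, ← Finset.sum_div,
        ← Finset.mul_sum]
      simp
    rw [h1, ← h2]
    exact hseq
  · obtain ⟨h1, -, -⟩ := hprog ⟨t, ht⟩
    simp only [hD, dif_pos ht]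
    exact h1
  · obtain ⟨h1, h2, h3⟩ := hprog ⟨t, ht⟩
    have hprev : alg.prev t (histUpTo hist ⟨t, ht⟩) = alg.params hist t :=
      alg.prev_eq_params hist ⟨t, ht⟩
    simp only [hprev] at h2 h3
    have h4 : alg.params hist (t + 1) = alg.plan t (histUpTo hist ⟨t, ht⟩) :=
      alg.params_succ hist ⟨t, ht⟩
    have h5 : D t = C * ((c * alg.roundErr θs t (histUpTo hist ⟨t, ht⟩) / κ + κ) / 2) := by
      simp only [hD, dif_pos ht]
    rw [roundErr, hprev] at h5
    simp only [h4, h5]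
    -- At an approximate local maximum the return is already at least `v`, so the zero in the
    -- maximum applies; otherwise the round gains.
    by_cases hmem : alg.params hist t ∈ 𝔄
    · have h6 := hvle _ hmem
      have h7 := le_max_right (v - M.ret θs (alg.params hist t) - gain ζh ζ3 ε) 0
      linarith
    · have h6 := h3 hmem
      have h7 := le_max_left (v - M.ret θs (alg.params hist t) - gain ζh ζ3 ε) 0
      linarith

lemma integrable_localRegret {θs : Θ} (hret : ∀ ψ, M.ret θs ψ ≤ 1) (εg εh : ℝ) (T : ℕ) :
    Integrable (fun hist : Fin T → M.Datum => alg.localRegret θs εg εh hist) (alg.runLaw θs T) := by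
  refine integrable_finsetSum _ fun t _ => (integrable_const _).sub ?_
  refine integrable_of_measurable_of_bound ?_ 1 fun hist => ?_
  · exact (M.measurable_ret.comp measurable_prodMk_left).comp
      ((alg.measurable_plan t).comp (measurable_histUpTo t))
  · rw [abs_of_nonneg (M.ret_nonneg _ _)]
    exact hret _

lemma localRegret_eq_zero [Subsingleton (EuclideanSpace ℝ (Fin d))] {θs : Θ} {εg εh : ℝ}
    (hne : (approxLocalMaxima (M.ret θs) εg εh).Nonempty) {T : ℕ} (hist : Fin T → M.Datum) :
    alg.localRegret θs εg εh hist = 0 := by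
  have : Nonempty (approxLocalMaxima (M.ret θs) εg εh) := hne.to_subtype
  refine Finset.sum_eq_zero fun t _ => ?_
  have h : ∀ ψ : approxLocalMaxima (M.ret θs) εg εh,
      M.ret θs ψ = M.ret θs (alg.plan t (histUpTo hist t)) := fun ψ =>
    congrArg _ (Subsingleton.elim _ _)
  simp [h]

end Alg

end ViOlinRL

/-! ### Conclusion -/

open ViOlinRL in
theorem theorem4 {m d : ℕ} {S : Set (EuclideanSpace ℝ (Fin m))} {A Θ : Type*}
    [MeasurableSpace A] [MeasurableSpace Θ]
    (M : ViOlinRL.Problem S A d Θ) (θs : Θ)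
    (ζg ζh ζ3 L₀ L₁ L₂ χg χf χh : ℝ) (hζh : 0 < ζh)
    (hret : ∀ ψ, M.ret θs ψ ≤ 1)
    (hsmooth : ∀ θ, ViOlinRL.SmoothBounds (M.ret θ) ζg ζh ζ3)
    (hvalue : M.ValueLipschitz L₀ L₁ L₂)
    (hpolicy : M.PolicyRegular χg χf χh)
    (T : ℕ) (hfin : M.dynRademacher θs T < ⊤)
    (alg : ViOlinRL.Alg M)
    (hlearner : ViOlinRL.HasRademacherRegret alg.learner T M.admissible (M.loss θs))
    (ε : ℝ) (hε0 : 0 < ε) (hε : ε ≤ min 1 (ζ3 / 16)) :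
    (ViOlinRL.approxLocalMaxima (M.ret θs) ε (6 * Real.sqrt (ζ3 * ε))).Nonempty ∧
    MeasureTheory.Integrable
      (fun hist : Fin T → M.Datum => alg.localRegret θs ε (6 * Real.sqrt (ζ3 * ε)) hist)
      (alg.runLaw θs T) ∧
    ∫ hist : Fin T → M.Datum, alg.localRegret θs ε (6 * Real.sqrt (ζ3 * ε)) hist
        ∂(alg.runLaw θs T) ≤
      (1 + (2 + ζg / ζh) *
          Real.sqrt (2 * ViOlinRL.c₁ M.H L₀ L₁ L₂ χg χf χh * T * (M.dynRademacher θs T).toReal)) *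
        max (2 * ζh * ε ^ (-2 : ℝ)) (Real.sqrt ζ3 * ε ^ (-(3 / 2) : ℝ)) := by
  have hε1 : ε ≤ 1 := hε.trans (min_le_left _ _)
  have hε2 : ε ≤ ζ3 / 16 := hε.trans (min_le_right _ _)
  have hζ3 : 0 < ζ3 := by linarith
  have hζg : 0 ≤ ζg := (norm_nonneg _).trans ((hsmooth θs).grad_le 0)
  have hne := approxLocalMaxima_nonempty hζh (hsmooth θs) hε0 hε2 hret
  have hint := alg.integrable_localRegret hret ε (6 * Real.sqrt (ζ3 * ε)) T
  have hmax : 0 ≤ max (2 * ζh * ε ^ (-2 : ℝ)) (Real.sqrt ζ3 * ε ^ (-(3 / 2) : ℝ)) :=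
    le_max_of_le_left (by positivity)
  refine ⟨hne, hint, ?_⟩
  rcases Nat.eq_zero_or_pos T with rfl | hT
  · have h0 : ∀ hist : Fin 0 → M.Datum,
        alg.localRegret θs ε (6 * Real.sqrt (ζ3 * ε)) hist = 0 := fun hist => by
      simp [Alg.localRegret]
    simp only [h0, integral_zero]
    positivity
  -- For `d = 0` there is no unit vector and the sign of `c₁` is unknown, but there is only one
  -- policy and the regret vanishes.
  rcases subsingleton_or_nontrivial (EuclideanSpace ℝ (Fin d)) with hd | hd
  · simp only [alg.localRegret_eq_zero hne, integral_zero]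
    positivity
  obtain ⟨u₀, hu₀⟩ := exists_norm_eq (EuclideanSpace ℝ (Fin d)) zero_le_one
  have hB := fun θ => M.dynGap_le hT hfin θ
  have hc := (M.sum_sq_errors_le hpolicy hvalue hsmooth (hB θs) 0 0 hu₀).1
  have hR := M.toReal_dynRademacher_nonneg θs T
  have hg := gain_pos hζh hζ3 hε0
  have hTpos : (0 : ℝ) < T := by exact_mod_cast hT
  obtain ⟨hEint, hE⟩ := alg.integrable_sum_roundErr hT hfin hlearner
  set c := c₁ M.H L₀ L₁ L₂ χg χf χh
  set I := ∫ hist : Fin T → M.Datum, alg.localRegret θs ε (6 * Real.sqrt (ζ3 * ε)) hist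
    ∂(alg.runLaw θs T)
  set C := 2 + ζg / ζh with hC
  have hC0 : 0 < C := by positivity
  -- The same `κ` is used in all rounds and on all runs. Optimizing it after taking the expectation
  -- replaces Cauchy–Schwarz over the rounds and Jensen's inequality over the runs.
  have hκ : ∀ κ : ℝ, 0 < κ → (gain ζh ζ3 ε * I - 1) / C ≤
      (c * (2 * (M.dynRademacher θs T).toReal) / κ + T * κ) / 2 := by
    intro κ hκ
    have hI1 : Integrable (fun hist : Fin T → M.Datum =>
        c * (∑ t : Fin T, alg.roundErr θs t (histUpTo hist t)) / κ) (alg.runLaw θs T) :=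
      (hEint.const_mul c).div_const κ
    have hI2 : Integrable (fun hist : Fin T → M.Datum =>
        C * ((c * (∑ t : Fin T, alg.roundErr θs t (histUpTo hist t)) / κ + T * κ) / 2))
        (alg.runLaw θs T) :=
      ((hI1.add (integrable_const _)).div_const 2).const_mul C
    have h1 := integral_mono (μ := alg.runLaw θs T) (hint.const_mul (gain ζh ζ3 ε))
      ((integrable_const 1).add hI2)
      fun hist => alg.gain_mul_localRegret_le hζh hpolicy hvalue hsmooth hret hB hε0 hε1 hε2 hu₀
        hκ hist
    simp only [Pi.add_apply] at h1
    rw [integral_const_mul, integral_add (integrable_const 1) hI2, integral_const_mul,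
      integral_div, integral_add hI1 (integrable_const (T * κ)),
      integral_div, integral_const_mul] at h1
    simp only [integral_const, probReal_univ, one_smul] at h1
    rw [div_le_iff₀ hC0]
    have h2 : c * (∫ hist, ∑ t : Fin T, alg.roundErr θs t (histUpTo hist t) ∂alg.runLaw θs T) / κ ≤
        c * (2 * (M.dynRademacher θs T).toReal) / κ := by gcongr
    have h3 := mul_le_mul_of_nonneg_left h2 hC0.le
    linarith
  have hfinal := le_sqrt_of_forall_le (mul_nonneg hc (mul_nonneg zero_le_two hR)) hTpos hκ
  rw [div_le_iff₀ hC0, show c * (2 * (M.dynRademacher θs T).toReal) * T =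
    2 * c * T * (M.dynRademacher θs T).toReal by ring] at hfinal
  have hgI : gain ζh ζ3 ε * I ≤ 1 + C * Real.sqrt (2 * c * T * (M.dynRademacher θs T).toReal) := by
    linarith
  calc I = (gain ζh ζ3 ε * I) *
        max (2 * ζh * ε ^ (-2 : ℝ)) (Real.sqrt ζ3 * ε ^ (-(3 / 2) : ℝ)) := by
        linear_combination -I * inv_gain_eq hζh hζ3 hε0
    _ ≤ _ := mul_le_mul_of_nonneg_right hgI hmax
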